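/- Let $d\ge 2$, let $D\subset\mathbb R^d$ be a bounded Lipschitz domain with surface measure $\sigma$ on $\partial D$, let $\lambda,\beta>0$ and $r>d/2-1$. Let $\dot W$ be Gaussian white noise on $D$ over a probability space $(\Omega,\Sigma,P)$: a jointly Gaussian zero-mean family $\{\dot W(A)\}$ indexed by the Borel sets $A\subset D$, with $\mathbb E\,\dot W(A)\dot W(B)=|A\cap B|$ and $\dot W(A\cup B)=\dot W(A)+\dot W(B)$ a.s. for disjoint $A,B$; write $\dot W(\varphi)=\int_D\varphi\,d\dot W$ for $\varphi\in L^2(D)$ (the $L^2(P)$-limit of the integrals of simple functions approximating $\varphi$ in $L^2(D)$). *Spaces.* All spaces are real. $H^{-r}(D)$ is the dual of the closure of $C_c^\infty(D)$ in $H^r(\mathbb R^d)$ (equivalently, the space of restrictions to $D$ of elements of $H^{-r}(\mathbb R^d)$), with its Borel $\sigma$-algebra. $H^{1/2}(\partial D)\subset L^2(\partial D,\sigma)$ is the space of traces of functions in $H^1(D)$, with the quotient norm, and $H^{-1/2}(\partial D)$ is its dual; $L^2(\partial D,\sigma)\subset H^{-1/2}(\partial D)$ via $\langle g,w\rangle=\int_{\partial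 D}gw\,d\sigma$. For $u\in H^1(D)$ with $\Delta u\in L^2(D)$ the conormal derivative $\partial_n u\in H^{-1/2}(\partial D)$ is defined by $\langle\partial_n u,w|_{\partial D}\rangle=\int_D\nabla u\cdot\nabla w+(\Delta u)\,w\,dx$ for $w\in H^1(D)$. Fix an orthonormal basis $(f_k)_{k\ge1}$ of $H^{-1/2}(\partial D)$; $H_{sc}(\partial D)$ is the completion of $H^{-1/2}(\partial D)$ in the norm $\|u\|_{sc}=\bigl(\sum_{k\ge1}k^{-2}(u,f_k)_{H^{-1/2}(\partial D)}^2\bigr)^{1/2}$. *Measurable boundary values.* Let $X$ be a zero-mean Gaussian $H^{-r}(D)$-valued random variable with law $\mu_X$. Let $\mathbb B^*_{\mu_X}$ be the closure in $L^2(\mu_X)$ of the continuous linear functionals on $H^{-r}(D)$, and set $C_X\widehat h=\int \widehat h(b)\,b\,\mu_X(db)$ for $\widehat h\in\mathbb B^*_{\mu_X}$. The Cameron–Martin space is $H(\mu_X)=C_X(\mathbb B^*_{\mu_X})\subset H^{-r}(D)$ with $\|C_X\widehat h\|_{H(\mu_X)}=\|\widehat h\|_{L^2(\mu_X)}$. If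 $H(\mu_X)$ is continuously included in $H^1(D)$ and $\Delta h\in L^2(D)$ for all $h\in H(\mu_X)$, then for an orthonormal basis $(e_k)$ of $H(\mu_X)$, $e_k=C_X\widehat e_k$, the measurable trace and the measurable normal derivative of $X$ are the $H_{sc}(\partial D)$-valued random variables $$\widehat{Tr}\,X=\sum_{k=1}^\infty\widehat e_k(X)\,e_k|_{\partial D},\qquad \widehat{\partial_n}X=\sum_{k=1}^\infty\widehat e_k(X)\,\partial_n e_k,$$ the series converging almost surely in $H_{sc}(\partial D)$ (the sums do not depend, up to null sets, on the basis). **Theorem.** For each of the three boundary conditions (Dirichlet, Neumann, Robin) there exists a zero-mean Gaussian $H^{-r}(D)$-valued random variable $X$ on $(\Omega,\Sigma,P)$ such that 1. the Cameron–Martin space $H(\mu_X)$ is continuously included in $H^1(D)$, and $\Delta h\in L^2(D)$ for all $h\in H(\mu_X)$; 2. $-\Delta X+\lambda X=\dot W$ in the sense of generalized functions, i.e. $\langle X,-\Delta\varphi+\lambda\varphi\rangle=\dot W(\varphi)$ almost surely for every $\varphi\in C_c^\infty(D)$; 3. almost surely in $H_{sc}(\partial D)$: $\widehat{Tr}\,X=0$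 in the Dirichlet case, $\widehat{\partial_n}X=0$ in the Neumann case, and $\widehat{\partial_n}X+\beta\,\widehat{Tr}\,X=0$ in the Robin case. It is pathwise unique: for the given $\dot W$ and boundary condition, any two such random variables are equal almost surely. -/

import Mathlib

open MeasureTheory ProbabilityTheory Filter Topology TopologicalSpace
open scoped ENNReal NNReal Distributions SchwartzMap LineDeriv InnerProductSpace

noncomputable section

namespace WhiteNoiseBVP

/-- Euclidean space `ℝ^d`. -/
abbrev E (d : ℕ) : Type := EuclideanSpace ℝ (Fin d)

variable {d : ℕ}

/-! ### Bounded Lipschitz domains -/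

/-- `D` is a nonempty bounded open set which, near each boundary point and in suitable
orthonormal coordinates, is the region strictly below the graph of a Lipschitz function.
Here `ν` is the vertical direction and `y - ⟪ν, y⟫ • ν` is the horizontal part of `y`. -/
structure IsBoundedLipschitzDomain (D : Opens (E d)) : Prop where
  nonempty : (D : Set (E d)).Nonempty
  bounded : Bornology.IsBounded (D : Set (E d))
  lipschitz : ∀ x ∈ frontier (D : Set (E d)),
    ∃ (ν : E d) (ζ : E d → ℝ) (K : ℝ≥0) (ρ : ℝ), ‖ν‖ = 1 ∧ LipschitzWith K ζ ∧ 0 < ρ ∧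
      ∀ y ∈ Metric.ball x ρ, (y ∈ D ↔ ⟪ν, y⟫_ℝ < ζ (y - ⟪ν, y⟫_ℝ • ν))

/-- Surface measure on `∂D`: the normalised `(d-1)`-dimensional Hausdorff measure. -/
def surfaceMeasure (D : Opens (E d)) : Measure (E d) :=
  (μHE[d - 1] : Measure (E d)).restrict (frontier (D : Set (E d)))

/-! ### Lebesgue and Sobolev spaces on `D` -/

/-- Real `L²(D)`. -/
abbrev L2 (D : Opens (E d)) : Type := Lp ℝ 2 (volume.restrict (D : Set (E d)))

/-- `L²(D; ℝ^d)`. -/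
abbrev L2vec (D : Opens (E d)) : Type := Lp (E d) 2 (volume.restrict (D : Set (E d)))

/-- Real `L²(∂D)`. -/
abbrev L2bdry (D : Opens (E d)) : Type := Lp ℝ 2 (surfaceMeasure D)

lemma memLp_testFunction {D : Opens (E d)} (φ : 𝓓(D, ℝ)) :
    MemLp (fun x => φ x) 2 (volume.restrict (D : Set (E d))) :=
  (φ.continuous.memLp_of_hasCompactSupport φ.hasCompactSupport).restrict _

lemma memLp_testFunction_smul {D : Opens (E d)} (φ : 𝓓(D, ℝ)) (v : E d) :
    MemLp (fun x => φ x • v) 2 (volume.restrict (D : Set (E d))) :=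
  ((φ.continuous.smul continuous_const).memLp_of_hasCompactSupport
    φ.hasCompactSupport.smul_right).restrict _

lemma integral_eq_inner {D : Opens (E d)} (u : L2 D) (φ : 𝓓(D, ℝ)) :
    ∫ x in (D : Set (E d)), u x * φ x = ⟪(memLp_testFunction φ).toLp _, u⟫_ℝ := by
  rw [L2.inner_def]
  refine integral_congr_ae ?_
  filter_upwards [(memLp_testFunction φ).coeFn_toLp] with x hx
  rw [hx]; simp

lemma integral_vec_eq_inner {D : Opens (E d)} (g : L2vec D) (φ : 𝓓(D, ℝ)) (v : E d) :
    ∫ x in (D : Set (E d)), ⟪g x, v⟫_ℝ * φ x = ⟪(memLp_testFunction_smul φ v).toLp _, g⟫_ℝ := by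
  rw [L2.inner_def]
  refine integral_congr_ae ?_
  filter_upwards [(memLp_testFunction_smul φ v).coeFn_toLp] with x hx
  rw [hx, real_inner_smul_left, real_inner_comm]; ring

/-- `g` is the weak gradient of `u` on `D`. -/
def IsWeakGradient (D : Opens (E d)) (u : L2 D) (g : L2vec D) : Prop :=
  ∀ (φ : 𝓓(D, ℝ)) (v : E d),
    ∫ x in (D : Set (E d)), u x * (∂_{v} φ : 𝓓(D, ℝ)) x
      = - ∫ x in (D : Set (E d)), ⟪g x, v⟫_ℝ * φ x

/-- The Sobolev space `H¹(D)`: pairs `(u, ∇u)` in `L²(D) × L²(D; ℝ^d)`, with the Hilbert norm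
`(‖u‖² + ‖∇u‖²)^{1/2}`. -/
def H1Sub (D : Opens (E d)) : Submodule ℝ (WithLp 2 (L2 D × L2vec D)) where
  carrier := {p | IsWeakGradient D p.fst p.snd}
  zero_mem' := by
    intro φ v
    rw [integral_eq_inner, integral_vec_eq_inner]; simp
  add_mem' := by
    intro a b ha hb φ v
    have h1 := ha φ v
    have h2 := hb φ v
    rw [integral_eq_inner, integral_vec_eq_inner] at *
    simp only [WithLp.add_fst, WithLp.add_snd, inner_add_right]
    linarith
  smul_mem' := by
    intro c a ha φ v
    have h1 := ha φ v
    rw [integral_eq_inner, integral_vec_eq_inner] at *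
    simp only [WithLp.smul_fst, WithLp.smul_snd, inner_smul_right, h1]
    ring

/-- The Sobolev space `H¹(D)` as a type. -/
def H1 (D : Opens (E d)) : Type := H1Sub D

instance (D : Opens (E d)) : NormedAddCommGroup (H1 D) :=
  inferInstanceAs (NormedAddCommGroup (H1Sub D))

instance (D : Opens (E d)) : InnerProductSpace ℝ (H1 D) :=
  inferInstanceAs (InnerProductSpace ℝ (H1Sub D))

/-- The function underlying an element of `H¹(D)`. -/
def H1.fn {D : Opens (E d)} (u : H1 D) : L2 D := (u.1 : WithLp 2 (L2 D × L2vec D)).fst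

/-- The weak gradient of an element of `H¹(D)`. -/
def H1.grad {D : Opens (E d)} (u : H1 D) : L2vec D := (u.1 : WithLp 2 (L2 D × L2vec D)).snd

lemma isClosed_H1Sub (D : Opens (E d)) : IsClosed (H1Sub D : Set (WithLp 2 (L2 D × L2vec D))) := by
  have : (H1Sub D : Set (WithLp 2 (L2 D × L2vec D))) =
      ⋂ (φ : 𝓓(D, ℝ)) (v : E d), {p : WithLp 2 (L2 D × L2vec D) |
        ⟪(memLp_testFunction (∂_{v} φ : 𝓓(D, ℝ))).toLp _, WithLp.fstL 2 ℝ _ _ p⟫_ℝ =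
          - ⟪(memLp_testFunction_smul φ v).toLp _, WithLp.sndL 2 ℝ _ _ p⟫_ℝ} := by
    ext p
    simp only [Set.mem_iInter, Set.mem_ofPred_eq, ← integral_eq_inner, ← integral_vec_eq_inner]
    rfl
  rw [this]
  refine isClosed_iInter fun φ => isClosed_iInter fun v => isClosed_eq ?_ ?_
  · exact continuous_const.inner (ContinuousLinearMap.continuous _)
  · exact (continuous_const.inner (ContinuousLinearMap.continuous _)).neg

instance (D : Opens (E d)) : CompleteSpace (H1 D) := (isClosed_H1Sub D).completeSpace_coe

/-- The classical Laplacian `Δφ = ∑ᵢ ∂ᵢ∂ᵢφ` of a test function. -/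
def testLaplacian {D : Opens (E d)} (φ : 𝓓(D, ℝ)) : 𝓓(D, ℝ) :=
  ∑ i : Fin d, ∂_{EuclideanSpace.single i (1 : ℝ)} (∂_{EuclideanSpace.single i (1 : ℝ)} φ)

/-- `Δu = f` in the sense of distributions on `D`. -/
def IsWeakLaplacian (D : Opens (E d)) (u f : L2 D) : Prop :=
  ∀ φ : 𝓓(D, ℝ),
    ∫ x in (D : Set (E d)), u x * testLaplacian φ x = ∫ x in (D : Set (E d)), f x * φ x

/-! ### The Sobolev spaces `H^{-s}(D)` -/

/-- A real test function as a complex Schwartz function on `ℝ^d`. -/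
def toSchwartz {D : Opens (E d)} (φ : 𝓓(D, ℝ)) : 𝓢(E d, ℂ) :=
  HasCompactSupport.toSchwartzMap (f := fun x => (φ x : ℂ))
    (φ.hasCompactSupport.comp_left Complex.ofReal_zero)
    (Complex.ofRealCLM.contDiff.comp φ.contDiff)

/-- The Bessel potential `𝓕⁻¹ (1 + ‖ξ‖²)^{s/2} 𝓕 φ` of a test function, in `L²(ℝ^d; ℂ)`. -/
def bessel (D : Opens (E d)) (s : ℝ) : 𝓓(D, ℝ) →ₗ[ℝ] Lp ℂ 2 (volume : Measure (E d)) where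
  toFun φ := (SchwartzMap.fourierMultiplierCLM ℂ
    (fun ξ : E d => (1 + ‖ξ‖ ^ 2) ^ (s / 2)) (toSchwartz φ)).toLp 2
  map_add' φ ψ := by
    have : toSchwartz (φ + ψ) = toSchwartz φ + toSchwartz ψ := by
      ext x
      exact Complex.ofReal_add (φ x) (ψ x)
    rw [this, map_add]
    exact map_add (SchwartzMap.toLpCLM ℝ ℂ 2 volume) _ _
  map_smul' c φ := by
    have : toSchwartz (c • φ) = c • toSchwartz φ := by
      ext x
      exact (Complex.ofReal_mul c (φ x)).trans (Complex.real_smul).symm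
    rw [this, map_smul]
    exact map_smul (SchwartzMap.toLpCLM ℝ ℂ 2 volume) c _

/-- The closure of the real test functions on `D` in `H^s(ℝ^d)`, where the norm of `H^s(ℝ^d)` is
`‖φ‖ = ‖𝓕⁻¹ (1 + ‖ξ‖²)^{s/2} 𝓕 φ‖_{L²}`. Elements are represented by their Bessel potentials. -/
def Htilde (D : Opens (E d)) (s : ℝ) : Submodule ℝ (Lp ℂ 2 (volume : Measure (E d))) :=
  (LinearMap.range (bessel D s)).topologicalClosure

/-- A test function on `D` as an element of `Htilde D s`. -/
def testEmbed (D : Opens (E d)) (s : ℝ) (φ : 𝓓(D, ℝ)) : Htilde D s :=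
  ⟨bessel D s φ, Submodule.le_topologicalClosure _ ⟨φ, rfl⟩⟩

/-- The real Sobolev space `H^{-s}(D)`: the distributions on `D` that are bounded for the
`H^s(ℝ^d)`-norm of test functions, i.e. the dual of `Htilde D s`. Isometrically, it is the space
of restrictions to `D` of elements of `H^{-s}(ℝ^d)` with the quotient norm. -/
abbrev Hneg (D : Opens (E d)) (s : ℝ) : Type := StrongDual ℝ (Htilde D s)

/-- The distribution `h ∈ H^{-s}(D)` is (integration against) the function `u`. -/
def Represents {D : Opens (E d)} {s : ℝ} (h : Hneg D s) (u : L2 D) : Prop :=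
  ∀ φ : 𝓓(D, ℝ), h (testEmbed D s φ) = ∫ x in (D : Set (E d)), u x * φ x

/-! ### Traces, `H^{1/2}(∂D)`, `H^{-1/2}(∂D)` and conormal derivatives -/

/-- The pairs `(φ|_D, φ|_{∂D})` for `φ ∈ C_c^∞(ℝ^d)`. -/
def smoothTraceGraph (D : Opens (E d)) : Submodule ℝ (WithLp 2 (H1 D × L2bdry D)) where
  carrier := {p | ∃ φ : 𝓓((⊤ : Opens (E d)), ℝ),
    (∀ᵐ x ∂(volume.restrict (D : Set (E d))), p.fst.fn x = φ x) ∧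
    (∀ᵐ x ∂(surfaceMeasure D), p.snd x = φ x)}
  zero_mem' := by
    refine ⟨0, ?_, ?_⟩
    · filter_upwards [Lp.coeFn_zero ℝ 2 (volume.restrict (D : Set (E d)))] with x hx
      exact hx
    · filter_upwards [Lp.coeFn_zero ℝ 2 (surfaceMeasure D)] with x hx
      exact hx
  add_mem' := by
    rintro a b ⟨φ, h1, h2⟩ ⟨ψ, k1, k2⟩
    refine ⟨φ + ψ, ?_, ?_⟩
    · filter_upwards [h1, k1, Lp.coeFn_add a.fst.fn b.fst.fn] with x hx kx lx
      exact lx.trans (by simp [hx, kx])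
    · filter_upwards [h2, k2, Lp.coeFn_add a.snd b.snd] with x hx kx lx
      exact lx.trans (by simp [hx, kx])
  smul_mem' := by
    rintro c a ⟨φ, h1, h2⟩
    refine ⟨c • φ, ?_, ?_⟩
    · filter_upwards [h1, Lp.coeFn_smul c a.fst.fn] with x hx lx
      exact lx.trans (by simp [hx])
    · filter_upwards [h2, Lp.coeFn_smul c a.snd] with x hx lx
      exact lx.trans (by simp [hx])

/-- The graph of the trace operator `H¹(D) → L²(∂D)`, the continuous extension of
`φ|_D ↦ φ|_{∂D}`, `φ ∈ C_c^∞(ℝ^d)`. -/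
def traceGraph (D : Opens (E d)) : Submodule ℝ (WithLp 2 (H1 D × L2bdry D)) :=
  (smoothTraceGraph D).topologicalClosure

/-- The graph of the trace as a Hilbert space. -/
def TraceSpace (D : Opens (E d)) : Type := traceGraph D

instance (D : Opens (E d)) : NormedAddCommGroup (TraceSpace D) :=
  inferInstanceAs (NormedAddCommGroup (traceGraph D))

instance (D : Opens (E d)) : InnerProductSpace ℝ (TraceSpace D) :=
  inferInstanceAs (InnerProductSpace ℝ (traceGraph D))

instance (D : Opens (E d)) : CompleteSpace (TraceSpace D) :=
  (Submodule.isClosed_topologicalClosure (smoothTraceGraph D)).completeSpace_coe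

/-- The `H¹(D)` component of a point of the graph of the trace. -/
def TraceSpace.fn {D : Opens (E d)} (w : TraceSpace D) : H1 D :=
  (w.1 : WithLp 2 (H1 D × L2bdry D)).fst

/-- The `L²(∂D)` component of a point of the graph of the trace. -/
def TraceSpace.trace (D : Opens (E d)) : TraceSpace D →L[ℝ] L2bdry D :=
  (WithLp.sndL 2 ℝ (H1 D) (L2bdry D)).comp (traceGraph D).subtypeL

/-- The elements of `H¹(D)` with zero trace. -/
def traceKer (D : Opens (E d)) : Submodule ℝ (TraceSpace D) :=
  LinearMap.ker (TraceSpace.trace D).toLinearMap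

instance instIsClosedTraceKer (D : Opens (E d)) : IsClosed (traceKer D : Set (TraceSpace D)) :=
  (TraceSpace.trace D).isClosed_ker

instance (D : Opens (E d)) : CompleteSpace (traceKer D) :=
  (instIsClosedTraceKer D).completeSpace_coe

/-- `H^{1/2}(∂D)`, the space of traces of elements of `H¹(D)` with the quotient norm: the infimum
of `(‖w‖²_{H¹(D)} + ‖g‖²_{L²(∂D)})^{1/2}` over all `w` with trace `g`. -/
abbrev HHalf (D : Opens (E d)) : Type := TraceSpace D ⧸ traceKer D

/-- The inclusion of `H^{1/2}(∂D)` into `L²(∂D)`. -/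
def HHalf.toL2 (D : Opens (E d)) : HHalf D →L[ℝ] L2bdry D :=
  (traceKer D).liftQL (TraceSpace.trace D) le_rfl

/-- The inner product of the dual of a real Hilbert space; it induces the dual norm. -/
abbrev dualInnerProductSpace (H : Type*) [NormedAddCommGroup H] [InnerProductSpace ℝ H]
    [CompleteSpace H] : InnerProductSpace ℝ (StrongDual ℝ H) where
  inner x y := ⟪(InnerProductSpace.toDual ℝ H).symm x, (InnerProductSpace.toDual ℝ H).symm y⟫_ℝ
  norm_sq_eq_re_inner x := by simp
  conj_inner_symm x y := real_inner_comm _ _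
  add_left x y z := by rw [map_add, inner_add_left]
  smul_left x y c := by
    rw [LinearIsometryEquiv.map_smulₛₗ, inner_smul_left]; rfl

/-- `H^{-1/2}(∂D)`, the dual of `H^{1/2}(∂D)`, as a Hilbert space. -/
def HnegHalf (D : Opens (E d)) : Type := StrongDual ℝ (HHalf D)

instance (D : Opens (E d)) : NormedAddCommGroup (HnegHalf D) :=
  inferInstanceAs (NormedAddCommGroup (StrongDual ℝ (HHalf D)))

instance (D : Opens (E d)) : InnerProductSpace ℝ (HnegHalf D) := dualInnerProductSpace (HHalf D)

/-- An element of `H^{-1/2}(∂D)` as a functional on `H^{1/2}(∂D)`. -/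
def HnegHalf.functional {D : Opens (E d)} (t : HnegHalf D) : StrongDual ℝ (HHalf D) := t

/-- The inclusion of `L²(∂D)` into `H^{-1/2}(∂D)`: `g` is the functional `w ↦ ∫_{∂D} g w dσ`. -/
def bdryFunctional {D : Opens (E d)} (g : L2bdry D) : HnegHalf D :=
  ((innerSL ℝ g).comp (HHalf.toL2 D) : StrongDual ℝ (HHalf D))

/-- `t ∈ H^{-1/2}(∂D)` is the trace `u|_{∂D}` of `u ∈ H¹(D)`. -/
def IsTrace (D : Opens (E d)) (u : H1 D) (t : HnegHalf D) : Prop :=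
  ∃ g : L2bdry D, WithLp.toLp 2 (u, g) ∈ traceGraph D ∧ t = bdryFunctional g

/-- `t ∈ H^{-1/2}(∂D)` is the conormal derivative `∂ₙu` of `u ∈ H¹(D)` with `Δu ∈ L²(D)`:
`⟨t, w|_{∂D}⟩ = ∫_D ∇u · ∇w + (Δu) w dx` for all `w ∈ H¹(D)`. -/
def IsConormalDerivative (D : Opens (E d)) (u : H1 D) (t : HnegHalf D) : Prop :=
  ∃ f : L2 D, IsWeakLaplacian D u.fn f ∧
    ∀ w : TraceSpace D, t.functional ((traceKer D).mkQ w) =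
      ∫ x in (D : Set (E d)), (⟪u.grad x, w.fn.grad x⟫_ℝ + f x * w.fn.fn x)

/-! ### The space `H_sc(∂D)` -/

/-- `H_sc(∂D)`, the completion of `H^{-1/2}(∂D)` for the norm `‖u‖_sc`, modelled on `ℓ²`; the
inclusion `scEmbed f` below is isometric for `‖·‖_sc` and has dense range. -/
abbrev Hsc : Type := lp (fun _ : ℕ => ℝ) 2

/-- The inclusion of `H^{-1/2}(∂D)` into `H_sc(∂D)`, for a given orthonormal basis `f` (numbered
from `0`) of `H^{-1/2}(∂D)`: `u ↦ ((k+1)⁻¹ (u, f_k))_k`. -/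
def scEmbed {D : Opens (E d)} (f : HilbertBasis ℕ ℝ (HnegHalf D)) (u : HnegHalf D) : Hsc :=
  ⟨fun k => ((k : ℝ) + 1)⁻¹ * ⟪u, f k⟫_ℝ, by
    refine Memℓp.mono' (lp.memℓp (f.repr u)) fun k => ?_
    rw [HilbertBasis.repr_apply_apply, real_inner_comm, norm_mul]
    refine mul_le_of_le_one_left (norm_nonneg _) ?_
    rw [norm_inv, Real.norm_of_nonneg (by positivity)]
    exact inv_le_one_of_one_le₀ (by linarith [(Nat.cast_nonneg k : (0 : ℝ) ≤ k)])⟩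

/-- `‖u‖_sc² = ∑_k (k+1)⁻² (u, f_k)²`. -/
lemma norm_scEmbed {D : Opens (E d)} (f : HilbertBasis ℕ ℝ (HnegHalf D)) (u : HnegHalf D) :
    ‖scEmbed f u‖ ^ 2 = ∑' k : ℕ, (((k : ℝ) + 1) ^ 2)⁻¹ * ⟪u, f k⟫_ℝ ^ 2 := by
  rw [← real_inner_self_eq_norm_sq, lp.inner_eq_tsum]
  refine tsum_congr fun k => ?_
  simp only [scEmbed, RCLike.inner_apply, conj_trivial]
  rw [← inv_pow]; ring

lemma denseRange_scEmbed {D : Opens (E d)} (f : HilbertBasis ℕ ℝ (HnegHalf D)) :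
    DenseRange (scEmbed f) := by
  intro y
  have hy : HasSum (fun k => lp.single 2 k (y k) : ℕ → Hsc) y := lp.hasSum_single (by simp) y
  refine mem_closure_of_tendsto hy (Eventually.of_forall fun s => ?_)
  refine ⟨∑ k ∈ s, (((k : ℝ) + 1) * y k) • f k, ?_⟩
  ext j
  simp only [scEmbed, sum_inner, real_inner_smul_left]
  rw [lp.coeFn_sum, Finset.sum_apply]
  have h : ∀ k, ⟪f k, f j⟫_ℝ = if k = j then 1 else 0 :=
    fun k => orthonormal_iff_ite.1 f.orthonormal k j
  simp only [h, lp.single_apply, Pi.single_apply]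
  by_cases hj : j ∈ s
  · have h0 : ((j : ℝ) + 1) ≠ 0 := by positivity
    simp [hj, h0]
  · simp [hj]

/-! ### Cameron–Martin spaces -/

section CameronMartin

variable {B : Type*} [NormedAddCommGroup B] [NormedSpace ℝ B] [MeasurableSpace B] [BorelSpace B]

/-- The closure in `L²(μ)` of the continuous linear functionals: the `μ`-measurable linear
functionals, for `μ` a centred Gaussian measure. -/
def dualClosure (μ : Measure B) : Submodule ℝ (Lp ℝ 2 μ) :=
  (StrongDual.toLp (𝕜 := ℝ) μ 2).range.topologicalClosure

/-- The extended covariance operator `C ĥ = ∫ ĥ(b) b μ(db)` of a centred Gaussian measure `μ`.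
The Cameron–Martin space of `μ` is its range, with the norm `‖C ĥ‖ = ‖ĥ‖_{L²(μ)}`; the operator
is thus an isometry of `dualClosure μ` onto the Cameron–Martin space. -/
def covOp (μ : Measure B) (h : dualClosure μ) : B := ∫ b, (h : Lp ℝ 2 μ) b • b ∂μ

end CameronMartin

/-! ### White noise -/

/-- The Borel subsets of `D`. -/
abbrev BorelSubset (D : Opens (E d)) : Type :=
  {A : Set (E d) // MeasurableSet A ∧ A ⊆ (D : Set (E d))}

variable {Ω : Type*} [MeasurableSpace Ω]

/-- `W` is Gaussian white noise on `D`. -/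
structure IsWhiteNoise (D : Opens (E d)) (P : Measure Ω) (W : BorelSubset D → Ω → ℝ) : Prop where
  gaussian : IsGaussianProcess W P
  mean_zero : ∀ A, ∫ ω, W A ω ∂P = 0
  covariance : ∀ A B, ∫ ω, W A ω * W B ω ∂P = (volume (A.1 ∩ B.1)).toReal
  additive : ∀ A B C : BorelSubset D, Disjoint A.1 B.1 → C.1 = A.1 ∪ B.1 →
    ∀ᵐ ω ∂P, W C ω = W A ω + W B ω

/-- `Y = ∫_D φ dW`: there are simple functions `∑ᵢ cᵢ 1_{Aᵢ}` arbitrarily close to `φ` in `L²(D)`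
for which `∑ᵢ cᵢ W(Aᵢ)` is arbitrarily close to `Y` in `L²(P)`. -/
def IsWienerIntegral (D : Opens (E d)) (P : Measure Ω) (W : BorelSubset D → Ω → ℝ)
    (φ : E d → ℝ) (Y : Ω → ℝ) : Prop :=
  MemLp Y 2 P ∧ ∀ ε : ℝ≥0∞, 0 < ε → ∃ (n : ℕ) (c : Fin n → ℝ) (A : Fin n → BorelSubset D),
    eLpNorm (fun x => φ x - ∑ i, c i * (A i).1.indicator 1 x) 2
      (volume.restrict (D : Set (E d))) < ε ∧
    eLpNorm (fun ω => Y ω - ∑ i, c i * W (A i) ω) 2 P < ε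

/-! ### The boundary value problem -/

/-- `Y` is the `H_sc(∂D)`-valued random variable `∑_k ê_k(X) B e_k`, where `ê_k` is an orthonormal
basis of the measurable linear functionals, `e_k = C ê_k` is the corresponding orthonormal basis of
the Cameron–Martin space of `X`, and `B` is the trace or the conormal derivative (given through its
graph); the series converges to `Y` in `H_sc(∂D)` almost surely. -/
def IsMeasurableExtension {D : Opens (E d)} {r : ℝ} (P : Measure Ω) (X : Ω → Hneg D r)
    (f : HilbertBasis ℕ ℝ (HnegHalf D)) (B : H1 D → HnegHalf D → Prop) (Y : Ω → Hsc) : Prop :=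
  Nonempty (HilbertBasis ℕ ℝ (dualClosure (P.map X))) ∧
  ∀ e : HilbertBasis ℕ ℝ (dualClosure (P.map X)),
    ∃ (u : ℕ → H1 D) (t : ℕ → HnegHalf D),
      (∀ k, Represents (covOp (P.map X) (e k)) (u k).fn ∧ B (u k) (t k)) ∧
      ∀ᵐ ω ∂P, Tendsto
        (fun n => ∑ k ∈ Finset.range n,
          ((e k : Lp ℝ 2 (P.map X)) (X ω)) • scEmbed f (t k))
        atTop (𝓝 (Y ω))

/-- The three types of boundary conditions. -/
inductive BoundaryCondition : Type
  | dirichlet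
  | neumann
  | robin

/-- `X` satisfies the measurable boundary condition: the measurable trace `Z` and/or the measurable
normal derivative `Y` exist, and `Z = 0`, `Y = 0` or `Y + β Z = 0` almost surely in `H_sc(∂D)`. -/
def SatisfiesBC {D : Opens (E d)} {r : ℝ} (P : Measure Ω) (X : Ω → Hneg D r)
    (f : HilbertBasis ℕ ℝ (HnegHalf D)) (β : ℝ) : BoundaryCondition → Prop
  | .dirichlet => ∃ Z, IsMeasurableExtension P X f (IsTrace D) Z ∧ ∀ᵐ ω ∂P, Z ω = 0
  | .neumann => ∃ Y, IsMeasurableExtension P X f (IsConormalDerivative D) Y ∧ ∀ᵐ ω ∂P, Y ω = 0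
  | .robin => ∃ Y Z, IsMeasurableExtension P X f (IsConormalDerivative D) Y ∧
      IsMeasurableExtension P X f (IsTrace D) Z ∧ ∀ᵐ ω ∂P, Y ω + β • Z ω = 0

/-- `X` is a zero-mean Gaussian `H^{-r}(D)`-valued random variable which solves
`-ΔX + lam X = W` with the given boundary condition. -/
structure IsSolution (D : Opens (E d)) (r lam β : ℝ) (f : HilbertBasis ℕ ℝ (HnegHalf D))
    (P : Measure Ω) (W : BorelSubset D → Ω → ℝ) (bc : BoundaryCondition)
    (X : Ω → Hneg D r) : Prop where
  measurable : Measurable X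
  gaussian : HasGaussianLaw X P
  mean_zero : ∀ l : StrongDual ℝ (Hneg D r), ∫ ω, l (X ω) ∂P = 0
  /-- The Cameron–Martin space is continuously included in `H¹(D)`, and `Δh ∈ L²(D)` for all
  its elements `h`. -/
  cameronMartin : ∃ C : ℝ, ∀ h : dualClosure (P.map X), ∃ u : H1 D,
    Represents (covOp (P.map X) h) u.fn ∧ ‖u‖ ≤ C * ‖h‖ ∧ ∃ g : L2 D, IsWeakLaplacian D u.fn g
  /-- `-ΔX + lam X = W` in the sense of generalized functions. -/
  equation : ∀ φ : 𝓓(D, ℝ), IsWienerIntegral D P W φ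
    (fun ω => X ω (testEmbed D r (-testLaplacian φ + lam • φ)))
  boundary : SatisfiesBC P X f β bc

end WhiteNoiseBVP

end

open MeasureTheory ProbabilityTheory Filter Topology TopologicalSpace
open scoped ENNReal NNReal Distributions SchwartzMap LineDeriv InnerProductSpace

noncomputable section

namespace WhiteNoiseBVP

variable {d : ℕ}

/-! Formally the solution is `X = S W`, where `S` maps `g` to the variational solution of `-Δu + lam
u = g` under the given boundary condition; rigorously `X(φ) = ∫ (S φ) dW`. `S` is symmetric on
`L²(D)` and satisfies `S(-Δφ + lam φ) = φ` for test functions `φ`. These two identities drive both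
existence and uniqueness.

Existence. The white noise is an isometry `I` from `L²(D)` into `L²(P)` with Gaussian range
(`IsWhiteNoise.exists_isWienerMap`). For `X` to take values in `H^{-r}(D)`, `S` must be
Hilbert–Schmidt into that space (`IsBoundedLipschitzDomain.exists_hilbertSchmidt_bound`). On the
Fourier side, symmetry and Bessel's inequality bound the Hilbert–Schmidt norm by `∫ (1+|ξ|²)^{-r} ‖S
e_ξ‖² dξ` with `e_ξ` plane waves, and `‖S e_ξ‖ ≤ C (1+|ξ|²)^{-1/2}`, so that `r > d/2 - 1` is the
condition for convergence. The decay of `S e_ξ` follows by duality from `|∫_D e_ξ w| ≤ C |ξ|⁻¹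
‖w‖_{H¹}` (`IsBoundedLipschitzDomain.exists_wave_bound`), an integration by parts along lines in
cone directions: on each line the boundary term is a value at a single exit point, which is at most
the integral of the derivative along the line.

As `S(-Δφ + lam φ) = φ`, the measurable linear functionals of `X` form a copy of `L²(D)`, and its
Cameron–Martin space is `S(L²(D))`. The Cameron–Martin vectors therefore satisfy the boundary
condition. In the Dirichlet and Neumann cases the boundary series is termwise zero; in the Robin
case it converges because `H^{-1/2}(∂D) → H_sc(∂D)` is Hilbert–Schmidt and square-summable Gaussian
series converge almost surely (`ae_tendsto_sum_smul`).

Uniqueness. If `∑ ê_k(X) a_k` converges to zero almost surely, comparing characteristic functions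
gives `a_k = 0` for every `k` (`IsGaussianSubspace.eq_zero_of_tendsto_zero`). Hence every basis
vector of the Cameron–Martin space of a solution satisfies the homogeneous boundary condition and,
by deterministic uniqueness, equals `S g_k`. This fixes the covariance of `X(ψ)` with each `ê_k`;
the equation fixes that of `I v`. Both variables belong to the closed span of the `ê_k(X)`, so `X(ψ)
= I(S ψ)` almost surely.

Deterministic uniqueness uses two facts on Lipschitz domains: functions with zero trace are limits
of test functions, and smooth functions are dense in `H¹(D)`. Both come from mollifiers shifted
along the cone axis. -/

/-! ### Test functions -/

/-- Smooth compactly supported functions on the whole space. -/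
abbrev Smooth (d : ℕ) : Type := 𝓓((⊤ : Opens (E d)), ℝ)

lemma lineDerivOp_testFunction_apply {D : Opens (E d)} (φ : 𝓓(D, ℝ)) (v x : E d) :
    (∂_{v} φ : 𝓓(D, ℝ)) x = fderiv ℝ φ x v := by
  rw [TestFunction.lineDerivOp_eq_lineDerivCLM ℝ, TestFunction.lineDerivCLM_eq_fderivCLM,
    TestFunction.fderivCLM_apply_of_le _ (by simp)]

lemma contDiff_testFunction {D : Opens (E d)} (φ : 𝓓(D, ℝ)) : ContDiff ℝ (⊤ : ℕ∞) φ := φ.contDiff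

lemma differentiable_testFunction {D : Opens (E d)} (φ : 𝓓(D, ℝ)) : Differentiable ℝ φ :=
  (contDiff_testFunction φ).differentiable (by simp)

/-- The product of a smooth function and a test function. -/
def mulTest {D : Opens (E d)} (χ : E d → ℝ) (hχ : ContDiff ℝ (⊤ : ℕ∞) χ) (φ : 𝓓(D, ℝ)) :
    𝓓(D, ℝ) where
  toFun x := χ x * φ x
  contDiff' := hχ.mul φ.contDiff
  hasCompactSupport' := φ.hasCompactSupport.mul_left
  tsupport_subset' := (tsupport_mul_subset_right).trans φ.tsupport_subset

@[simp] lemma mulTest_apply {D : Opens (E d)} (χ : E d → ℝ) (hχ : ContDiff ℝ (⊤ : ℕ∞) χ)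
    (φ : 𝓓(D, ℝ)) (x : E d) : mulTest χ hχ φ x = χ x * φ x := rfl

/-- A test function on `D`, seen on the whole space. -/
def toSmooth {D : Opens (E d)} (φ : 𝓓(D, ℝ)) : Smooth d :=
  ⟨φ, φ.contDiff, φ.hasCompactSupport, Set.subset_univ _⟩

lemma continuous_fderiv_testFunction {D : Opens (E d)} (φ : 𝓓(D, ℝ)) (v : E d) :
    Continuous fun x => fderiv ℝ φ x v :=
  ((contDiff_testFunction φ).continuous_fderiv (by simp)).clm_apply continuous_const

lemma continuous_gradient_testFunction {D : Opens (E d)} (φ : 𝓓(D, ℝ)) :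
    Continuous (gradient φ) :=
  (InnerProductSpace.toDual ℝ (E d)).symm.continuous.comp
    ((contDiff_testFunction φ).continuous_fderiv (by simp))

lemma hasCompactSupport_gradient {D : Opens (E d)} (φ : 𝓓(D, ℝ)) :
    HasCompactSupport (gradient φ) :=
  (φ.hasCompactSupport.fderiv ℝ).comp_left (g := (InnerProductSpace.toDual ℝ (E d)).symm)
    (map_zero _)

lemma inner_gradient (φ : E d → ℝ) (x v : E d) : ⟪gradient φ x, v⟫_ℝ = fderiv ℝ φ x v := by
  simp [gradient]

lemma memLp_gradient {D : Opens (E d)} (φ : 𝓓(D, ℝ)) (μ : Measure (E d))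
    [IsFiniteMeasureOnCompacts μ] : MemLp (gradient φ) 2 μ :=
  (continuous_gradient_testFunction φ).memLp_of_hasCompactSupport (hasCompactSupport_gradient φ)

lemma memLp_smooth {D : Opens (E d)} (φ : 𝓓(D, ℝ)) (μ : Measure (E d))
    [IsFiniteMeasureOnCompacts μ] : MemLp (fun x => φ x) 2 μ :=
  φ.continuous.memLp_of_hasCompactSupport φ.hasCompactSupport

/-! ### Elements of `L²(D)` and `H¹(D)` -/

lemma Lp_eq_zero_of_forall_testFunction {F : Type*} [NormedAddCommGroup F] [NormedSpace ℝ F]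
    [CompleteSpace F] {D : Opens (E d)} (u : Lp F 2 (volume.restrict (D : Set (E d))))
    (h : ∀ φ : 𝓓(D, ℝ), ∫ x in (D : Set (E d)), φ x • u x = 0) : u = 0 := by
  rw [Lp.eq_zero_iff_ae_eq_zero]
  have hloc : LocallyIntegrableOn u D volume := by
    have : LocallyIntegrable u (volume.restrict (D : Set (E d))) :=
      (Lp.memLp u).locallyIntegrable (by norm_num)
    exact locallyIntegrableOn_of_locallyIntegrable_restrict this
  have := D.isOpen.ae_eq_zero_of_integral_contDiff_smul_eq_zero hloc (fun g hg hc hs => by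
    have h1 := h ⟨g, hg, hc, hs⟩
    rw [← h1]
    symm
    refine setIntegral_eq_integral_of_forall_compl_eq_zero fun x hx => ?_
    have : g x = 0 := image_eq_zero_of_notMem_tsupport fun h => hx (hs h)
    change g x • u x = 0
    simp [this])
  exact (ae_restrict_iff' D.isOpen.measurableSet).2 this

lemma L2_ext_of_testFunction {D : Opens (E d)} {u w : L2 D}
    (h : ∀ φ : 𝓓(D, ℝ), ∫ x in (D : Set (E d)), u x * φ x = ∫ x in (D : Set (E d)), w x * φ x) :
    u = w := by
  rw [← sub_eq_zero]
  refine Lp_eq_zero_of_forall_testFunction _ fun φ => ?_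
  have h1 := h φ
  have h2 := integral_eq_inner (u - w) φ
  rw [integral_eq_inner, integral_eq_inner] at h1
  rw [inner_sub_right, h1, sub_self] at h2
  simpa [mul_comm] using h2

/-- The class of a test function in `L²(D)`. -/
def testL2 {D : Opens (E d)} (φ : 𝓓(D, ℝ)) : L2 D := (memLp_testFunction φ).toLp _

lemma coeFn_testL2 {D : Opens (E d)} (φ : 𝓓(D, ℝ)) :
    testL2 φ =ᵐ[volume.restrict (D : Set (E d))] φ := (memLp_testFunction φ).coeFn_toLp

lemma integral_eq_inner_testL2 {D : Opens (E d)} (u : L2 D) (φ : 𝓓(D, ℝ)) :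
    ∫ x in (D : Set (E d)), u x * φ x = ⟪u, testL2 φ⟫_ℝ := by
  rw [integral_eq_inner, real_inner_comm]; rfl

/-- `testL2` as a linear map. -/
def testL2ₗ (D : Opens (E d)) : 𝓓(D, ℝ) →ₗ[ℝ] L2 D where
  toFun := testL2
  map_add' φ ψ := MemLp.toLp_add (memLp_testFunction φ) (memLp_testFunction ψ)
  map_smul' c φ := MemLp.toLp_const_smul c (memLp_testFunction φ)

lemma denseRange_testL2 (D : Opens (E d)) : DenseRange (testL2ₗ D) := by
  have : (LinearMap.range (testL2ₗ D)).topologicalClosure = ⊤ := by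
    rw [Submodule.topologicalClosure_eq_top_iff, Submodule.eq_bot_iff]
    intro u hu
    refine L2_ext_of_testFunction fun φ => ?_
    rw [integral_eq_inner_testL2, integral_eq_inner_testL2, inner_zero_left, real_inner_comm]
    exact hu _ ⟨φ, rfl⟩
  intro x
  have hx : x ∈ (LinearMap.range (testL2ₗ D)).topologicalClosure := this ▸ Submodule.mem_top
  exact hx

lemma L2vec_ext_of_testFunction {D : Opens (E d)} {g h : L2vec D}
    (hgh : ∀ (φ : 𝓓(D, ℝ)) (v : E d), ∫ x in (D : Set (E d)), ⟪g x, v⟫_ℝ * φ x =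
      ∫ x in (D : Set (E d)), ⟪h x, v⟫_ℝ * φ x) : g = h := by
  rw [← sub_eq_zero]
  refine Lp_eq_zero_of_forall_testFunction _ fun φ => ?_
  refine ext_inner_right ℝ fun v => ?_
  rw [inner_zero_left]
  have hInt : Integrable (fun x => φ x • (g - h : L2vec D) x) (volume.restrict (D : Set (E d))) :=
    memLp_one_iff_integrable.1 ((Lp.memLp (g - h)).smul (memLp_testFunction φ))
  rw [real_inner_comm, ← integral_inner hInt]
  have h1 := hgh φ v
  have h2 := integral_vec_eq_inner (g - h) φ v
  rw [integral_vec_eq_inner, integral_vec_eq_inner] at h1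
  rw [inner_sub_right, h1, sub_self] at h2
  rw [← h2]
  refine integral_congr_ae (.of_forall fun x => ?_)
  simp only [inner_smul_right]
  rw [real_inner_comm, mul_comm]

/-- The element of `H¹(D)` with a given function and weak gradient. -/
def H1.mk {D : Opens (E d)} (u : L2 D) (g : L2vec D) (h : IsWeakGradient D u g) : H1 D :=
  ⟨WithLp.toLp 2 (u, g), h⟩

lemma H1.isWeakGradient {D : Opens (E d)} (u : H1 D) : IsWeakGradient D u.fn u.grad := u.2

/-- Weak gradients are unique, so identities in `H¹(D)` can be checked on the function component
alone. -/
lemma H1.ext {D : Opens (E d)} {u w : H1 D} (h : u.fn = w.fn) : u = w := by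
  have hg : u.grad = w.grad := by
    refine L2vec_ext_of_testFunction fun φ v => ?_
    have h1 := u.isWeakGradient φ v
    have h2 := w.isWeakGradient φ v
    rw [h] at h1
    linarith
  apply Subtype.ext
  exact (WithLp.ofLp_injective 2) (Prod.ext h hg)

/-- `u ↦ u`, from `H¹(D)` to `L²(D)`. -/
def H1.fnL (D : Opens (E d)) : H1 D →L[ℝ] L2 D :=
  (WithLp.fstL 2 ℝ (L2 D) (L2vec D)).comp (H1Sub D).subtypeL

/-- `u ↦ ∇u`, from `H¹(D)` to `L²(D; ℝ^d)`. -/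
def H1.gradL (D : Opens (E d)) : H1 D →L[ℝ] L2vec D :=
  (WithLp.sndL 2 ℝ (L2 D) (L2vec D)).comp (H1Sub D).subtypeL

@[simp] lemma H1.fnL_apply {D : Opens (E d)} (u : H1 D) : H1.fnL D u = u.fn := rfl
@[simp] lemma H1.gradL_apply {D : Opens (E d)} (u : H1 D) : H1.gradL D u = u.grad := rfl

lemma H1.inner_eq {D : Opens (E d)} (u w : H1 D) :
    ⟪u, w⟫_ℝ = ⟪u.fn, w.fn⟫_ℝ + ⟪u.grad, w.grad⟫_ℝ := rfl

lemma H1.norm_sq {D : Opens (E d)} (u : H1 D) : ‖u‖ ^ 2 = ‖u.fn‖ ^ 2 + ‖u.grad‖ ^ 2 := by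
  rw [← real_inner_self_eq_norm_sq, H1.inner_eq, real_inner_self_eq_norm_sq,
    real_inner_self_eq_norm_sq]

lemma H1.norm_fn_le {D : Opens (E d)} (u : H1 D) : ‖u.fn‖ ≤ ‖u‖ :=
  abs_le_of_sq_le_sq' (by rw [H1.norm_sq]; nlinarith [sq_nonneg ‖u.grad‖]) (norm_nonneg _) |>.2

lemma H1.norm_grad_le {D : Opens (E d)} (u : H1 D) : ‖u.grad‖ ≤ ‖u‖ :=
  abs_le_of_sq_le_sq' (by rw [H1.norm_sq]; nlinarith [sq_nonneg ‖u.fn‖]) (norm_nonneg _) |>.2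

lemma H1.norm_le {D : Opens (E d)} (u : H1 D) : ‖u‖ ≤ ‖u.fn‖ + ‖u.grad‖ := by
  refine abs_le_of_sq_le_sq' ?_ (by positivity) |>.2
  rw [H1.norm_sq]; nlinarith [norm_nonneg u.fn, norm_nonneg u.grad]

/-- Integration by parts on the whole space against a test function. -/
lemma integral_mul_fderiv_testFunction {D : Opens (E d)} {φ : E d → ℝ}
    (hφ : ContDiff ℝ (⊤ : ℕ∞) φ) (ψ : 𝓓(D, ℝ)) (v : E d) :
    ∫ x, φ x * fderiv ℝ ψ x v = - ∫ x, fderiv ℝ φ x v * ψ x := by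
  have c1 : Continuous fun x => fderiv ℝ φ x v :=
    (hφ.continuous_fderiv (by simp)).clm_apply continuous_const
  refine integral_mul_fderiv_eq_neg_fderiv_mul_of_integrable ?_ ?_ ?_
    (fun x _ => hφ.differentiable (by simp) x) (fun x _ => differentiable_testFunction ψ x)
  · exact (c1.mul ψ.continuous).integrable_of_hasCompactSupport ψ.hasCompactSupport.mul_left
  · refine (hφ.continuous.mul (continuous_fderiv_testFunction ψ v)).integrable_of_hasCompactSupport
      (HasCompactSupport.mul_left ?_)
    exact ψ.hasCompactSupport.fderiv_apply (𝕜 := ℝ) v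
  · exact (hφ.continuous.mul ψ.continuous).integrable_of_hasCompactSupport
      ψ.hasCompactSupport.mul_left

lemma setIntegral_mul_testFunction {D : Opens (E d)} (f : E d → ℝ) (ψ : 𝓓(D, ℝ)) :
    ∫ x in (D : Set (E d)), f x * ψ x = ∫ x, f x * ψ x := by
  refine setIntegral_eq_integral_of_forall_compl_eq_zero fun x hx => ?_
  rw [image_eq_zero_of_notMem_tsupport fun h => hx (ψ.tsupport_subset h), mul_zero]

/-- The restriction to `D` of a smooth function, in `H¹(D)`. -/
def smoothH1 (D : Opens (E d)) (φ : Smooth d) : H1 D :=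
  H1.mk ((memLp_smooth φ (volume.restrict (D : Set (E d)))).toLp _)
    ((memLp_gradient φ (volume.restrict (D : Set (E d)))).toLp _) (by
    intro ψ v
    have e1 : ∫ x in (D : Set (E d)),
        ((memLp_smooth φ (volume.restrict (D : Set (E d)))).toLp _) x * (∂_{v} ψ : 𝓓(D, ℝ)) x =
        ∫ x in (D : Set (E d)), φ x * (∂_{v} ψ : 𝓓(D, ℝ)) x := by
      refine integral_congr_ae ?_
      filter_upwards [(memLp_smooth φ (volume.restrict (D : Set (E d)))).coeFn_toLp] with x hx
      rw [hx]
    have e2 : ∫ x in (D : Set (E d)),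
        ⟪((memLp_gradient φ (volume.restrict (D : Set (E d)))).toLp _) x, v⟫_ℝ * ψ x =
        ∫ x in (D : Set (E d)), fderiv ℝ φ x v * ψ x := by
      refine integral_congr_ae ?_
      filter_upwards [(memLp_gradient φ (volume.restrict (D : Set (E d)))).coeFn_toLp] with x hx
      rw [hx, inner_gradient]
    rw [e1, e2, setIntegral_mul_testFunction, setIntegral_mul_testFunction]
    simp_rw [lineDerivOp_testFunction_apply]
    exact integral_mul_fderiv_testFunction (contDiff_testFunction φ) ψ v)

lemma coeFn_smoothH1_fn (D : Opens (E d)) (φ : Smooth d) :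
    (smoothH1 D φ).fn =ᵐ[volume.restrict (D : Set (E d))] φ :=
  (memLp_smooth φ (volume.restrict (D : Set (E d)))).coeFn_toLp

lemma coeFn_smoothH1_grad (D : Opens (E d)) (φ : Smooth d) :
    (smoothH1 D φ).grad =ᵐ[volume.restrict (D : Set (E d))] gradient φ :=
  (memLp_gradient φ (volume.restrict (D : Set (E d)))).coeFn_toLp

lemma smoothH1_add (D : Opens (E d)) (φ ψ : Smooth d) :
    smoothH1 D (φ + ψ) = smoothH1 D φ + smoothH1 D ψ :=
  H1.ext (MemLp.toLp_add (memLp_smooth φ _) (memLp_smooth ψ _))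

lemma smoothH1_smul (D : Opens (E d)) (c : ℝ) (φ : Smooth d) :
    smoothH1 D (c • φ) = c • smoothH1 D φ :=
  H1.ext (MemLp.toLp_const_smul c (memLp_smooth φ _))

/-- The restriction of smooth functions to `D`, as a linear map. -/
def smoothH1ₗ (D : Opens (E d)) : Smooth d →ₗ[ℝ] H1 D where
  toFun := smoothH1 D
  map_add' := smoothH1_add D
  map_smul' := smoothH1_smul D

lemma norm_smooth_le (χ : Smooth d) : ∃ C, 0 ≤ C ∧ ∀ x, |χ x| ≤ C := by
  obtain ⟨C, hC⟩ := χ.hasCompactSupport.exists_bound_of_continuous χ.continuous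
  exact ⟨C, (norm_nonneg _).trans (hC 0), hC⟩

lemma norm_gradient_smooth_le (χ : Smooth d) : ∃ C, 0 ≤ C ∧ ∀ x, ‖gradient χ x‖ ≤ C := by
  obtain ⟨C, hC⟩ := (hasCompactSupport_gradient χ).exists_bound_of_continuous
    (continuous_gradient_testFunction χ)
  exact ⟨C, (norm_nonneg _).trans (hC 0), hC⟩

lemma memLp_smooth_smul {F : Type*} [NormedAddCommGroup F] [NormedSpace ℝ F] (χ : Smooth d)
    {μ : Measure (E d)} {u : E d → F} (hu : MemLp u 2 μ) : MemLp (fun x => χ x • u x) 2 μ := by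
  obtain ⟨C, -, hC⟩ := norm_smooth_le χ
  refine hu.of_le_mul (c := C)
    (χ.continuous.aestronglyMeasurable.smul hu.1) (.of_forall fun x => ?_)
  rw [norm_smul]
  exact mul_le_mul_of_nonneg_right (hC x) (norm_nonneg _)

lemma memLp_smul_gradient (χ : Smooth d) {μ : Measure (E d)} {u : E d → ℝ} (hu : MemLp u 2 μ) :
    MemLp (fun x => u x • gradient χ x) 2 μ := by
  obtain ⟨C, -, hC⟩ := norm_gradient_smooth_le χ
  refine hu.of_le_mul (c := C)
    (hu.1.smul (continuous_gradient_testFunction χ).aestronglyMeasurable) (.of_forall fun x => ?_)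
  rw [norm_smul, mul_comm]
  exact mul_le_mul_of_nonneg_right (hC x) (norm_nonneg _)

lemma fderiv_mul_testFunction {D : Opens (E d)} {χ : E d → ℝ} (hχ : ContDiff ℝ (⊤ : ℕ∞) χ)
    (φ : 𝓓(D, ℝ)) (x v : E d) : fderiv ℝ (fun y => χ y * φ y) x v =
      χ x * fderiv ℝ φ x v + fderiv ℝ χ x v * φ x := by
  rw [fderiv_fun_mul (hχ.differentiable (by simp) x) (differentiable_testFunction φ x)]
  simp [mul_comm]

lemma memLp_fderiv_apply {D : Opens (E d)} (φ : 𝓓(D, ℝ)) (v : E d) (μ : Measure (E d))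
    [IsFiniteMeasureOnCompacts μ] : MemLp (fun x => fderiv ℝ φ x v) 2 μ :=
  (continuous_fderiv_testFunction φ v).memLp_of_hasCompactSupport
    (φ.hasCompactSupport.fderiv_apply (𝕜 := ℝ) v)

/-- The product of an element of `H¹(D)` and a smooth function. -/
def mulH1 {D : Opens (E d)} (χ : Smooth d) (u : H1 D) : H1 D :=
  H1.mk ((memLp_smooth_smul χ (Lp.memLp u.fn)).toLp _)
    (((memLp_smooth_smul χ (Lp.memLp u.grad)).add (memLp_smul_gradient χ (Lp.memLp u.fn))).toLp _)
    (by
    intro ψ v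
    set μ := volume.restrict (D : Set (E d))
    have hχ := contDiff_testFunction χ
    have e1 : ∫ x in (D : Set (E d)),
        ((memLp_smooth_smul χ (Lp.memLp u.fn)).toLp _) x * (∂_{v} ψ : 𝓓(D, ℝ)) x =
        ∫ x in (D : Set (E d)), (u.fn x * (∂_{v} (mulTest χ hχ ψ) : 𝓓(D, ℝ)) x -
          u.fn x * (fderiv ℝ χ x v * ψ x)) := by
      refine integral_congr_ae ?_
      filter_upwards [(memLp_smooth_smul χ (Lp.memLp u.fn)).coeFn_toLp] with x hx
      rw [hx, lineDerivOp_testFunction_apply, lineDerivOp_testFunction_apply]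
      rw [show ⇑(mulTest χ hχ ψ) = fun y => χ y * ψ y from rfl, fderiv_mul_testFunction hχ]
      simp only [smul_eq_mul]; ring
    have hb : MemLp (fun x => fderiv ℝ χ x v * ψ x) 2 μ :=
      memLp_smooth (mulTest (fun x => fderiv ℝ χ x v)
        ((hχ.fderiv_right (m := (⊤ : ℕ∞)) (by simp)).clm_apply contDiff_const) ψ) μ
    have e2 : ∫ x in (D : Set (E d)),
        ⟪((((memLp_smooth_smul χ (Lp.memLp u.grad)).add
          (memLp_smul_gradient χ (Lp.memLp u.fn))).toLp _) : E d → E d) x, v⟫_ℝ * ψ x =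
        ∫ x in (D : Set (E d)), (⟪u.grad x, v⟫_ℝ * mulTest χ hχ ψ x +
          u.fn x * (fderiv ℝ χ x v * ψ x)) := by
      refine integral_congr_ae ?_
      filter_upwards [((memLp_smooth_smul χ (Lp.memLp u.grad)).add
          (memLp_smul_gradient χ (Lp.memLp u.fn))).coeFn_toLp] with x hx
      rw [hx]
      simp only [Pi.add_apply, inner_add_left, inner_smul_left, inner_gradient, mulTest_apply,
        conj_trivial]
      ring
    have i1 : Integrable (fun x => u.fn x * (fderiv ℝ χ x v * ψ x)) μ :=
      (Lp.memLp u.fn).integrable_mul hb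
    have i2 : Integrable (fun x => u.fn x * (∂_{v} (mulTest χ hχ ψ) : 𝓓(D, ℝ)) x) μ :=
      (Lp.memLp u.fn).integrable_mul (memLp_testFunction _)
    have i3 : Integrable (fun x => ⟪u.grad x, v⟫_ℝ * mulTest χ hχ ψ x) μ :=
      ((Lp.memLp u.grad).inner_const v).integrable_mul (memLp_testFunction _)
    rw [e1, e2, integral_sub i2 i1, integral_add i3 i1, u.isWeakGradient]
    ring)

lemma coeFn_mulH1_fn {D : Opens (E d)} (χ : Smooth d) (u : H1 D) :
    (mulH1 χ u).fn =ᵐ[volume.restrict (D : Set (E d))] fun x => χ x * u.fn x :=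
  (memLp_smooth_smul χ (Lp.memLp u.fn)).coeFn_toLp

lemma coeFn_mulH1_grad {D : Opens (E d)} (χ : Smooth d) (u : H1 D) :
    (mulH1 χ u).grad =ᵐ[volume.restrict (D : Set (E d))]
      fun x => χ x • u.grad x + u.fn x • gradient χ x :=
  ((memLp_smooth_smul χ (Lp.memLp u.grad)).add
    (memLp_smul_gradient χ (Lp.memLp u.fn))).coeFn_toLp


/-! ### The cone property of Lipschitz domains -/

/-- Near `x`, moving from the closure of `D` in the directions `-v`, `v` close to `ν`, leads
into `D`. -/
structure IsConePatch (D : Opens (E d)) (x : E d) (ρ ε : ℝ) (ν : E d) : Prop where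
  radius_pos : 0 < ρ
  aperture_pos : 0 < ε
  aperture_lt : ε < 1
  norm_axis : ‖ν‖ = 1
  sub_smul_mem : ∀ v ∈ Metric.ball ν ε, ∀ y ∈ closure (D : Set (E d)), y ∈ Metric.ball x ρ →
    ∀ t : ℝ, 0 < t → y - t • v ∈ Metric.ball x ρ → y - t • v ∈ D

/-- At an interior point any direction works. Near a boundary point, a step `-t v` with `v` close to
`ν` lowers the height by `t⟪ν, v⟫`, while the graph below which the point must stay moves by at most
`K t ‖proj v‖`, which is smaller. -/
lemma IsBoundedLipschitzDomain.exists_isConePatch {D : Opens (E d)}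
    (hD : IsBoundedLipschitzDomain D) (hd : 0 < d) {x : E d} (hx : x ∈ closure (D : Set (E d))) :
    ∃ ρ ε ν, IsConePatch D x ρ ε ν := by
  by_cases hxD : x ∈ D
  · obtain ⟨ρ, hρ, hball⟩ := Metric.isOpen_iff.1 D.isOpen x hxD
    exact ⟨ρ, 1 / 2, EuclideanSpace.single ⟨0, hd⟩ 1, hρ, by norm_num, by norm_num, by simp,
      fun v _ y _ _ t _ h => hball h⟩
  · have hfr : x ∈ frontier (D : Set (E d)) := by
      rw [D.isOpen.frontier_eq]; exact ⟨hx, hxD⟩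
    obtain ⟨ν, ζ, K, ρ, hν, hζ, hρ, h⟩ := hD.lipschitz x hfr
    refine ⟨ρ, 1 / (2 * (K + 1)), ν, hρ, by positivity, ?_, hν, ?_⟩
    · rw [div_lt_one (by positivity)]
      linarith [K.2, (NNReal.coe_nonneg K)]
    · intro v hv y hy hyb t ht htb
      set proj : E d → E d := fun z => z - ⟪ν, z⟫_ℝ • ν with hproj
      have hcont : Continuous proj := by fun_prop
      have hyle : ⟪ν, y⟫_ℝ ≤ ζ (proj y) := by
        have hy' : y ∈ closure ((D : Set (E d)) ∩ Metric.ball x ρ) :=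
          Metric.isOpen_ball.closure_inter ⟨hy, hyb⟩
        have hcl : IsClosed {z : E d | ⟪ν, z⟫_ℝ ≤ ζ (proj z)} :=
          isClosed_le (by fun_prop) (hζ.continuous.comp hcont)
        refine hcl.closure_subset_iff.2 ?_ hy'
        rintro z ⟨hz, hzb⟩
        exact ((h z hzb).1 hz).le
      rw [h _ htb]
      have hdiff : ζ (proj y) - ζ (proj (y - t • v)) ≤ K * (t * ‖proj v‖) := by
        have h1 := hζ.dist_le_mul (proj y) (proj (y - t • v))
        have h2 : proj y - proj (y - t • v) = t • proj v := by
          simp only [hproj, inner_sub_right, inner_smul_right, smul_sub, sub_smul, smul_smul]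
          abel
        rw [dist_eq_norm (proj y), h2, norm_smul, Real.norm_of_nonneg ht.le, Real.dist_eq] at h1
        exact (le_abs_self _).trans h1
      have hv' : ‖v - ν‖ < 1 / (2 * (K + 1)) := by rwa [← dist_eq_norm]
      have hνν : ⟪ν, ν⟫_ℝ = 1 := by rw [real_inner_self_eq_norm_sq, hν]; norm_num
      have hin : ⟪ν, v - ν⟫_ℝ = ⟪ν, v⟫_ℝ - 1 := by rw [inner_sub_right, hνν]
      have hlow : 1 - ‖v - ν‖ ≤ ⟪ν, v⟫_ℝ := by
        have := abs_real_inner_le_norm ν (v - ν)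
        rw [hν, one_mul, hin] at this
        linarith [neg_abs_le (⟪ν, v⟫_ℝ - 1)]
      have hpv : ‖proj v‖ ≤ ‖v - ν‖ := by
        have e : proj v = (v - ν) - ⟪ν, v - ν⟫_ℝ • ν := by
          simp only [hproj, hin, sub_smul, one_smul]; abel
        have h2 : ‖(v - ν) - ⟪ν, v - ν⟫_ℝ • ν‖ ^ 2 = ‖v - ν‖ ^ 2 - ⟪ν, v - ν⟫_ℝ ^ 2 := by
          rw [norm_sub_sq_real, inner_smul_right, real_inner_comm, norm_smul, hν]
          simp only [Real.norm_eq_abs, mul_one, sq_abs]; ring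
        rw [e]
        refine abs_le_of_sq_le_sq' ?_ (norm_nonneg _) |>.2
        rw [h2]; nlinarith [sq_nonneg ⟪ν, v - ν⟫_ℝ]
      have hK := NNReal.coe_nonneg K
      -- The aperture `1 / (2 (K + 1))` is chosen for this: `(K + 1) ‖v - ν‖ < 1/2`, hence `K ‖v -
      -- ν‖ < 1 - ‖v - ν‖`.
      have hlt : (K : ℝ) * ‖proj v‖ < ⟪ν, v⟫_ℝ := by
        rw [lt_div_iff₀ (by positivity)] at hv'
        nlinarith [mul_le_mul_of_nonneg_left hpv hK, norm_nonneg (v - ν)]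
      change ⟪ν, y - t • v⟫_ℝ < ζ (proj (y - t • v))
      rw [inner_sub_right, inner_smul_right]
      nlinarith

lemma IsConePatch.ne_zero {D : Opens (E d)} {x : E d} {ρ ε : ℝ} {ν : E d}
    (h : IsConePatch D x ρ ε ν) {v : E d} (hv : v ∈ Metric.ball ν ε) : v ≠ 0 := by
  rintro rfl
  rw [Metric.mem_ball, dist_zero_left, h.norm_axis] at hv
  linarith [h.aperture_lt]

/-- A bounded Lipschitz domain has a finite smooth partition of unity subordinate to cone
patches. -/
lemma IsBoundedLipschitzDomain.exists_partition {D : Opens (E d)}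
    (hD : IsBoundedLipschitzDomain D) (hd : 0 < d) :
    ∃ (ι : Type) (_ : Fintype ι) (χ : ι → Smooth d) (x : ι → E d) (ρ ε : ι → ℝ) (ν : ι → E d),
      (∀ i, IsConePatch D (x i) (ρ i) (ε i) (ν i)) ∧
      (∀ i, tsupport (χ i) ⊆ Metric.ball (x i) (ρ i / 2)) ∧
      ∀ y ∈ closure (D : Set (E d)), ∑ i, χ i y = 1 := by
  classical
  have hcomp : IsCompact (closure (D : Set (E d))) := hD.bounded.isCompact_closure
  choose! ρ ε ν hp using fun (x : E d) (hx : x ∈ closure (D : Set (E d))) =>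
    hD.exists_isConePatch hd hx
  -- Covering by balls of half the radius leaves room to translate inside the patches when
  -- mollifying.
  obtain ⟨t, htD, ht⟩ := hcomp.elim_nhds_subcover (fun x => Metric.ball x (ρ x / 2))
    (fun x hx => Metric.ball_mem_nhds x (by linarith [(hp x hx).radius_pos]))
  let n := t.card
  let e : Fin n ≃ t := t.equivFin.symm
  obtain ⟨f, hf⟩ := SmoothPartitionOfUnity.exists_isSubordinate (modelWithCornersSelf ℝ (E d))
    (isClosed_closure (s := (D : Set (E d))))
    (fun i : Fin n => Metric.ball (e i : E d) (ρ (e i) / 2)) (fun _ => Metric.isOpen_ball) (by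
      intro y hy
      obtain ⟨z, hz, hyz⟩ := Set.mem_iUnion₂.1 (ht hy)
      exact Set.mem_iUnion.2 ⟨e.symm ⟨z, hz⟩, by simpa using hyz⟩)
  refine ⟨Fin n, inferInstance, fun i => ⟨f i, (f i).contMDiff.contDiff, ?_, Set.subset_univ _⟩,
    fun i => e i, fun i => ρ (e i), fun i => ε (e i), fun i => ν (e i),
    fun i => hp _ (htD _ (e i).2), fun i => hf i, fun y hy => ?_⟩
  · exact HasCompactSupport.of_support_subset_isCompact
      (isCompact_closedBall (e i : E d) (ρ (e i) / 2))
      ((subset_tsupport _).trans ((hf i).trans Metric.ball_subset_closedBall))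
  · have := f.sum_eq_one hy
    rw [finsum_eq_sum_of_fintype] at this
    exact this

/-! ### Integration along lines -/

/-- The crossing point is the supremum of `U ∩ J`. Openness of `U` keeps it out of `U`, since
otherwise slightly larger points of `J` would belong to `U`. -/
lemma exists_crossing {U J : Set ℝ} (hU : IsOpen U) (hJ : J.OrdConnected)
    (h : ∀ s ∈ U ∩ J, ∀ t ∈ J, t < s → t ∈ U) :
    J ⊆ U ∨ U ∩ J = ∅ ∨ ∃ s ∈ J ∩ frontier U, U ∩ J = J ∩ Set.Iio s := by
  by_cases h1 : J ⊆ U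
  · exact .inl h1
  by_cases h2 : U ∩ J = ∅
  · exact .inr (.inl h2)
  right; right
  obtain ⟨b, hbJ, hbU⟩ := Set.not_subset.1 h1
  obtain ⟨a, haU, haJ⟩ := Set.nonempty_iff_ne_empty.2 h2
  have hbd : ∀ s ∈ U ∩ J, s < b := fun s hs => by
    by_contra hlt
    rcases (not_lt.1 hlt).eq_or_lt with rfl | hlt
    · exact hbU hs.1
    · exact hbU (h s hs b hbJ hlt)
  have hlub := isLUB_csSup (s := U ∩ J) ⟨a, haU, haJ⟩ ⟨b, fun s hs => (hbd s hs).le⟩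
  set σ := sSup (U ∩ J)
  have hσJ : σ ∈ J := hJ.out haJ hbJ ⟨hlub.1 ⟨haU, haJ⟩, hlub.2 fun s hs => (hbd s hs).le⟩
  have hlow : ∀ t ∈ J, t < σ → t ∈ U := fun t ht hlt => by
    obtain ⟨s, hs, hts⟩ := (lt_isLUB_iff hlub).1 hlt
    exact h s hs t ht hts
  have hσU : σ ∉ U := fun hσ => by
    have hσb : σ < b := hbd σ ⟨hσ, hσJ⟩
    obtain ⟨r, hr, hball⟩ := Metric.isOpen_iff.1 hU σ hσ
    set s := min (σ + r / 2) b
    have hs1 : σ < s := lt_min (by linarith) hσb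
    have hsU : s ∈ U := hball (by
      rw [Metric.mem_ball, Real.dist_eq, abs_of_pos (by linarith)]
      linarith [min_le_left (σ + r / 2) b])
    have hsJ : s ∈ J := hJ.out hσJ hbJ ⟨hs1.le, min_le_right _ _⟩
    exact absurd (hlub.1 ⟨hsU, hsJ⟩) (not_le.2 hs1)
  refine ⟨σ, ⟨hσJ, ?_⟩, ?_⟩
  · rw [hU.frontier_eq]
    exact ⟨closure_mono Set.inter_subset_left (hlub.mem_closure ⟨a, haU, haJ⟩), hσU⟩
  · ext t
    refine ⟨fun ht => ⟨ht.2, lt_of_le_of_ne (hlub.1 ht) ?_⟩, fun ht => ⟨hlow t ht.1 ht.2, ht.1⟩⟩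
    rintro rfl
    exact hσU ht.1

lemma setIntegral_eq_of_inter_eq {U V J : Set ℝ} (hU : MeasurableSet U) (hV : MeasurableSet V)
    (h : U ∩ J = V ∩ J) {g : ℝ → ℝ} (hg : ∀ s ∉ J, g s = 0) :
    ∫ s in U, g s = ∫ s in V, g s := by
  rw [← integral_indicator hU, ← integral_indicator hV]
  congr 1
  ext s
  by_cases hs : s ∈ J
  · have : s ∈ U ↔ s ∈ V := by
      have := Set.ext_iff.1 h s
      simpa [hs] using this
    by_cases hsU : s ∈ U
    · rw [Set.indicator_of_mem hsU, Set.indicator_of_mem (this.1 hsU)]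
    · rw [Set.indicator_of_notMem hsU, Set.indicator_of_notMem fun h => hsU (this.2 h)]
  · simp [Set.indicator, hg s hs]

/-- The fundamental theorem of calculus on a set which is a lower part of the interval `J`. -/
lemma setIntegral_deriv_crossing {U J : Set ℝ} (hU : IsOpen U) (hJ : J.OrdConnected)
    (h : ∀ s ∈ U ∩ J, ∀ t ∈ J, t < s → t ∈ U) :
    (∀ η : ℝ → ℝ, ContDiff ℝ 1 η → HasCompactSupport η → tsupport η ⊆ J →
      ∫ s in U, deriv η s = 0) ∨
    ∃ s ∈ frontier U, ∀ η : ℝ → ℝ, ContDiff ℝ 1 η → HasCompactSupport η → tsupport η ⊆ J →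
      ∫ s in U, deriv η s = η s ∧ |η s| ≤ ∫ s in U, |deriv η s| := by
  have hz : ∀ η : ℝ → ℝ, tsupport η ⊆ J → ∀ s ∉ J, deriv η s = 0 := fun η hη s hs =>
    image_eq_zero_of_notMem_tsupport fun h => hs (hη (tsupport_deriv_subset (𝕜 := ℝ) h))
  -- The case distinction and the crossing point depend on `U` and `J` only, not on `η`; this is
  -- what later allows two functions to be compared at the same point.
  rcases exists_crossing hU hJ h with h1 | h1 | ⟨s, hs, h1⟩
  · left
    intro η hη hc hs
    rw [setIntegral_eq_of_inter_eq hU.measurableSet MeasurableSet.univ (J := J) (by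
      rw [Set.univ_inter, Set.inter_eq_right.2 h1]) (hz η hs), setIntegral_univ]
    refine integral_eq_zero_of_hasDerivAt_of_integrable
      (fun s => (hη.differentiable (by simp) s).hasDerivAt) ?_
      (hη.continuous.integrable_of_hasCompactSupport hc)
    exact (hη.continuous_deriv le_rfl).integrable_of_hasCompactSupport hc.deriv
  · left
    intro η hη hc hs
    rw [setIntegral_eq_of_inter_eq hU.measurableSet MeasurableSet.empty (J := J) (by
      rw [h1, Set.empty_inter]) (hz η hs), setIntegral_empty]
  · right
    refine ⟨s, hs.2, fun η hη hc hsupp => ?_⟩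
    have e1 : ∫ s in U, deriv η s = η s := by
      rw [setIntegral_eq_of_inter_eq hU.measurableSet measurableSet_Iio (J := J) (by
        rw [h1, Set.inter_comm]) (hz η hsupp), ← integral_Iic_eq_integral_Iio]
      exact hc.integral_Iic_deriv_eq hη s
    exact ⟨e1, by rw [← e1]; exact abs_integral_le_integral_abs⟩

/-- The coordinates along and orthogonal to a unit vector. -/
def lineEquiv {w : E d} (hw : ‖w‖ = 1) : ℝ × (ℝ ∙ w)ᗮ ≃ᵐ E d :=
  (MeasurableEquiv.prodCongr
    (LinearIsometryEquiv.toSpanUnitSingleton w hw).toHomeomorph.toMeasurableEquiv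
    (MeasurableEquiv.refl _)).trans ((ℝ ∙ w).measurableEquivProd (0 : E d)).symm

lemma lineEquiv_apply {w : E d} (hw : ‖w‖ = 1) (s : ℝ) (y : (ℝ ∙ w)ᗮ) :
    lineEquiv hw (s, y) = s • w + y := by
  simp [lineEquiv, MeasurableEquiv.prodCongr]

lemma measurePreserving_lineEquiv {w : E d} (hw : ‖w‖ = 1) :
    MeasurePreserving (lineEquiv hw) (volume.prod volume) volume := by
  have h1 : MeasurePreserving ((ℝ ∙ w).measurableEquivProd (0 : E d)) volume
      (volume : Measure ((ℝ ∙ w) × (ℝ ∙ w)ᗮ)) := by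
    have := (ℝ ∙ w).measurePreserving_measurableEquivProd (0 : E d)
    rwa [InnerProductSpace.euclideanHausdorffMeasure_eq_volume] at this
  have h2 : MeasurePreserving (LinearIsometryEquiv.toSpanUnitSingleton (𝕜 := ℝ) w hw) :=
    (LinearIsometryEquiv.toSpanUnitSingleton (𝕜 := ℝ) w hw).measurePreserving
  exact (h2.prod (MeasurePreserving.id _)).trans h1.symm

lemma integrable_comp_lineEquiv {w : E d} (hw : ‖w‖ = 1) {F : E d → ℝ} (hF : Integrable F) :
    Integrable (fun p : ℝ × (ℝ ∙ w)ᗮ => F (p.1 • w + p.2)) (volume.prod volume) := by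
  have := (measurePreserving_lineEquiv hw).integrable_comp_of_integrable hF
  exact this.congr (.of_forall fun p => by
    obtain ⟨s, y⟩ := p; exact congrArg F (lineEquiv_apply hw s y))

lemma integral_lines {w : E d} (hw : ‖w‖ = 1) {F : E d → ℝ} (hF : Integrable F) :
    ∫ x, F x = ∫ y : (ℝ ∙ w)ᗮ, ∫ s : ℝ, F (s • w + y) := by
  rw [← (measurePreserving_lineEquiv hw).integral_comp', ← integral_prod_symm
    (fun p : ℝ × (ℝ ∙ w)ᗮ => F (p.1 • w + p.2)) (integrable_comp_lineEquiv hw hF)]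
  refine integral_congr_ae (.of_forall fun p => ?_)
  obtain ⟨s, y⟩ := p; exact congrArg F (lineEquiv_apply hw s y)

/-- The restriction of a smooth function to a line. -/
lemma contDiff_line (η : Smooth d) (w y : E d) : ContDiff ℝ 1 fun s : ℝ => η (s • w + y) :=
  (contDiff_testFunction η |>.of_le (by simp)).comp
    ((contDiff_id.smul contDiff_const).add contDiff_const)

lemma deriv_line (η : Smooth d) (w y : E d) (s : ℝ) :
    deriv (fun s : ℝ => η (s • w + y)) s = fderiv ℝ η (s • w + y) w := by
  have h1 : HasDerivAt (fun s : ℝ => s • w + y) w s := by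
    simpa using ((hasDerivAt_id s).smul_const w).add_const y
  exact ((differentiable_testFunction η _).hasFDerivAt.comp_hasDerivAt s h1).deriv

lemma isClosedEmbedding_line {w : E d} (hw : ‖w‖ = 1) (y : E d) :
    IsClosedEmbedding fun s : ℝ => s • w + y := by
  refine Isometry.isClosedEmbedding (Isometry.of_dist_eq fun s t => ?_)
  rw [dist_eq_norm, add_sub_add_right_eq_sub, ← sub_smul, norm_smul, hw, mul_one, Real.dist_eq]
  rfl

lemma hasCompactSupport_line (η : Smooth d) {w : E d} (hw : ‖w‖ = 1) (y : E d) :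
    HasCompactSupport fun s : ℝ => η (s • w + y) :=
  η.hasCompactSupport.comp_isClosedEmbedding (isClosedEmbedding_line hw y)

lemma tsupport_line (η : Smooth d) (w y : E d) :
    tsupport (fun s : ℝ => η (s • w + y)) ⊆ (fun s : ℝ => s • w + y) ⁻¹' tsupport η :=
  tsupport_comp_subset_preimage η (by fun_prop)

/-- The integral of a directional derivative over `D`, along the lines in that direction. -/
lemma line_crossing {D : Opens (E d)} {x : E d} {ρ ε : ℝ} {ν : E d} (hp : IsConePatch D x ρ ε ν)
    {w : E d} {c : ℝ} (hc : 0 < c) (hcw : c • w ∈ Metric.ball ν ε) (y : E d) :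
    (∀ η : Smooth d, tsupport η ⊆ Metric.ball x ρ → ‖w‖ = 1 →
      ∫ s in (fun s : ℝ => s • w + y) ⁻¹' D, fderiv ℝ η (s • w + y) w = 0) ∨
    ∃ s : ℝ, s • w + y ∈ frontier (D : Set (E d)) ∧
      ∀ η : Smooth d, tsupport η ⊆ Metric.ball x ρ → ‖w‖ = 1 →
      ∫ s in (fun s : ℝ => s • w + y) ⁻¹' D, fderiv ℝ η (s • w + y) w = η (s • w + y) ∧
      |η (s • w + y)| ≤
        ∫ s in (fun s : ℝ => s • w + y) ⁻¹' D, |fderiv ℝ η (s • w + y) w| := by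
  have hcont : Continuous fun s : ℝ => s • w + y := by fun_prop
  set U := (fun s : ℝ => s • w + y) ⁻¹' D with hUdef
  set J := (fun s : ℝ => s • w + y) ⁻¹' Metric.ball x ρ with hJdef
  have hU : IsOpen U := D.isOpen.preimage hcont
  have hJ : J.OrdConnected := by
    have : Convex ℝ J := by
      have e : J = AffineMap.lineMap (k := ℝ) y (w + y) ⁻¹' Metric.ball x ρ := by
        ext s; simp [hJdef, AffineMap.lineMap_apply]
      rw [e]
      exact (convex_ball x ρ).affine_preimage _
    exact this.ordConnected
  -- Decreasing the parameter from `s` to `t` is a step of length `(s - t) / c` along `-(c • w)`, an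
  -- admissible direction of the cone.
  have hlow : ∀ s ∈ U ∩ J, ∀ t ∈ J, t < s → t ∈ U := by
    intro s hs t ht hts
    have e : s • w + y - ((s - t) / c) • (c • w) = t • w + y := by
      rw [smul_smul, div_mul_cancel₀ _ hc.ne', sub_smul]; abel
    have := hp.sub_smul_mem (c • w) hcw (s • w + y) (subset_closure hs.1) hs.2 ((s - t) / c)
      (div_pos (by linarith) hc)
    rw [e] at this
    exact this ht
  rcases setIntegral_deriv_crossing hU hJ hlow with h | ⟨s, hs, h⟩
  · left
    intro η hη hw
    have := h _ (contDiff_line η w y) (hasCompactSupport_line η hw y)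
      ((tsupport_line η w y).trans (Set.preimage_mono hη))
    simpa only [deriv_line] using this
  · right
    refine ⟨s, hcont.frontier_preimage_subset _ hs, fun η hη hw => ?_⟩
    have := h _ (contDiff_line η w y) (hasCompactSupport_line η hw y)
      ((tsupport_line η w y).trans (Set.preimage_mono hη))
    simpa only [deriv_line] using this


/-! ### Boundary integrals of directional derivatives -/

lemma integrable_fderiv_apply (η : Smooth d) (v : E d) :
    Integrable (fun x => fderiv ℝ η x v) (volume : Measure (E d)) :=
  (continuous_fderiv_testFunction η v).integrable_of_hasCompactSupport
    (η.hasCompactSupport.fderiv_apply (𝕜 := ℝ) v)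

lemma integral_line_indicator {D : Opens (E d)} (F : E d → ℝ) (w y : E d) :
    ∫ s : ℝ, (D : Set (E d)).indicator F (s • w + y) =
      ∫ s in (fun s : ℝ => s • w + y) ⁻¹' D, F (s • w + y) := by
  rw [← integral_indicator (D.isOpen.preimage (by fun_prop)).measurableSet]
  rfl

lemma setIntegral_eq_integral_lines {D : Opens (E d)} {w : E d} (hw : ‖w‖ = 1) {F : E d → ℝ}
    (hF : Integrable F) : ∫ x in (D : Set (E d)), F x =
      ∫ y : (ℝ ∙ w)ᗮ, ∫ s in (fun s : ℝ => s • w + (y : E d)) ⁻¹' D, F (s • w + y) := by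
  rw [← integral_indicator D.isOpen.measurableSet,
    integral_lines hw (hF.indicator D.isOpen.measurableSet)]
  simp_rw [integral_line_indicator]

lemma integrable_integral_lines {D : Opens (E d)} {w : E d} (hw : ‖w‖ = 1) {F : E d → ℝ}
    (hF : Integrable F) : Integrable fun y : (ℝ ∙ w)ᗮ =>
      ∫ s in (fun s : ℝ => s • w + (y : E d)) ⁻¹' D, F (s • w + y) := by
  have := (integrable_comp_lineEquiv hw (hF.indicator D.isOpen.measurableSet)).integral_prod_right
  exact this.congr (.of_forall fun y => integral_line_indicator F w y)

lemma IsConePatch.exists_unit {D : Opens (E d)} {x : E d} {ρ ε : ℝ} {ν : E d}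
    (hp : IsConePatch D x ρ ε ν) {v : E d} (hv : v ∈ Metric.ball ν ε) :
    ∃ (c : ℝ) (w : E d), 0 < c ∧ ‖w‖ = 1 ∧ v = c • w := by
  have h0 : ‖v‖ ≠ 0 := norm_ne_zero_iff.2 (hp.ne_zero hv)
  refine ⟨‖v‖, ‖v‖⁻¹ • v, (norm_nonneg v).lt_of_ne h0.symm, ?_, ?_⟩
  · rw [norm_smul, norm_inv, norm_norm, inv_mul_cancel₀ h0]
  · rw [smul_smul, mul_inv_cancel₀ h0, one_smul]

/-- Comparison of the boundary term `∫_D ∂_v η₁` with an interior integral. -/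
lemma IsConePatch.abs_setIntegral_fderiv_le {D : Opens (E d)} {x : E d} {ρ ε : ℝ} {ν : E d}
    (hp : IsConePatch D x ρ ε ν) {v : E d} (hv : v ∈ Metric.ball ν ε) {η₁ η₂ : Smooth d}
    (h₁ : tsupport η₁ ⊆ Metric.ball x ρ) (h₂ : tsupport η₂ ⊆ Metric.ball x ρ)
    (h : ∀ y, |η₁ y| ≤ |η₂ y|) :
    |∫ y in (D : Set (E d)), fderiv ℝ η₁ y v| ≤ ∫ y in (D : Set (E d)), |fderiv ℝ η₂ y v| := by
  obtain ⟨c, w, hc, hw, rfl⟩ := hp.exists_unit hv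
  simp only [map_smul, smul_eq_mul, abs_mul, integral_const_mul, abs_of_pos hc]
  refine mul_le_mul_of_nonneg_left ?_ hc.le
  rw [setIntegral_eq_integral_lines hw (integrable_fderiv_apply η₁ w),
    setIntegral_eq_integral_lines hw (integrable_fderiv_apply η₂ w).abs]
  refine norm_integral_le_of_norm_le (f := fun y : (ℝ ∙ w)ᗮ =>
    ∫ s in (fun s : ℝ => s • w + (y : E d)) ⁻¹' D, fderiv ℝ η₁ (s • w + y) w)
    (integrable_integral_lines hw (integrable_fderiv_apply η₂ w).abs) (.of_forall fun y => ?_)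
  rw [Real.norm_eq_abs]
  -- On one line, the integral for `η₁` is its value at the exit point, which is dominated by `|η₂|`
  -- there, and so by the integral of `|∂η₂|` over the same line.
  rcases line_crossing hp hc hv (y : E d) with h' | ⟨s, -, h'⟩
  · rw [h' η₁ h₁ hw, abs_zero]
    exact integral_nonneg fun _ => abs_nonneg _
  · rw [(h' η₁ h₁ hw).1]
    exact (h _).trans (h' η₂ h₂ hw).2

/-- The measure is a fixed multiple of Hausdorff measure, which a nonexpansive map does not
increase. It is applied to the orthogonal projection of `∂D` onto a hyperplane. -/
lemma euclideanHausdorffMeasure_image_le {X Y : Type*} [EMetricSpace X] [MeasurableSpace X]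
    [BorelSpace X] [EMetricSpace Y] [MeasurableSpace Y] [BorelSpace Y] {f : X → Y}
    (hf : LipschitzWith 1 f) (n : ℕ) (s : Set X) :
    (μHE[n] : Measure Y) (f '' s) ≤ (μHE[n] : Measure X) s := by
  rw [Measure.euclideanHausdorffMeasure_def, Measure.euclideanHausdorffMeasure_def,
    Measure.smul_apply, Measure.smul_apply]
  have := hf.hausdorffMeasure_image_le (d := n) (by positivity) s
  rw [ENNReal.coe_one, ENNReal.one_rpow, one_mul] at this
  exact smul_le_smul_of_nonneg_left this (by positivity)

lemma finrank_orthogonal_unit {w : E d} (hw : ‖w‖ = 1) :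
    Module.finrank ℝ (ℝ ∙ w)ᗮ = d - 1 := by
  have h1 := (ℝ ∙ w).finrank_add_finrank_orthogonal
  rw [finrank_span_singleton (by rintro rfl; simp at hw), finrank_euclideanSpace_fin] at h1
  omega

lemma volume_orthogonal_unit {w : E d} (hw : ‖w‖ = 1) :
    (volume : Measure (ℝ ∙ w)ᗮ) = μHE[d - 1] := by
  rw [← InnerProductSpace.euclideanHausdorffMeasure_eq_volume, finrank_orthogonal_unit hw]

/-- The boundary term `∫_D ∂_v η` is bounded by the surface integral of `η`. -/
lemma IsConePatch.ofReal_abs_setIntegral_fderiv_le {D : Opens (E d)} {x : E d} {ρ ε : ℝ}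
    {ν : E d} (hp : IsConePatch D x ρ ε ν) {v : E d} (hv : v ∈ Metric.ball ν ε) {η : Smooth d}
    (hη : tsupport η ⊆ Metric.ball x ρ) :
    ENNReal.ofReal |∫ y in (D : Set (E d)), fderiv ℝ η y v| ≤
      ENNReal.ofReal ‖v‖ * ∫⁻ y, ENNReal.ofReal |η y| ∂(surfaceMeasure D) := by
  obtain ⟨c, w, hc, hw, rfl⟩ := hp.exists_unit hv
  rw [norm_smul, hw, mul_one, Real.norm_of_nonneg hc.le]
  simp only [map_smul, smul_eq_mul, abs_mul, integral_const_mul, abs_of_pos hc]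
  rw [ENNReal.ofReal_mul hc.le]
  refine mul_le_mul_right ?_ _
  rw [setIntegral_eq_integral_lines hw (integrable_fderiv_apply η w)]
  set G : (ℝ ∙ w)ᗮ → ℝ := fun y =>
    ∫ s in (fun s : ℝ => s • w + (y : E d)) ⁻¹' D, fderiv ℝ η (s • w + y) w
  have hG : Integrable G := integrable_integral_lines hw (integrable_fderiv_apply η w)
  have h1 : ENNReal.ofReal |∫ y, G y| ≤ ∫⁻ y, ENNReal.ofReal |G y| := by
    rw [← ofReal_integral_eq_lintegral_ofReal hG.abs (.of_forall fun _ => abs_nonneg _)]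
    exact ENNReal.ofReal_le_ofReal abs_integral_le_integral_abs
  refine h1.trans ?_
  -- Layer-cake comparison: the lines on which the boundary value exceeds `t` are contained in the
  -- projection of the part of `∂D` where `|η| > t`. This needs neither a parametrization of the
  -- surface nor its normal.
  rw [lintegral_eq_lintegral_meas_lt _ (.of_forall fun _ => abs_nonneg _)
    hG.abs.aestronglyMeasurable.aemeasurable,
    lintegral_eq_lintegral_meas_lt _ (.of_forall fun _ => abs_nonneg _)
    η.continuous.abs.measurable.aemeasurable]
  refine setLIntegral_mono_ae' measurableSet_Ioi (.of_forall fun t ht => ?_)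
  have hsub : {y | t < |G y|} ⊆ (ℝ ∙ w)ᗮ.orthogonalProjectionOnto ''
      ({y | t < |η y|} ∩ frontier (D : Set (E d))) := by
    intro y hy
    rcases line_crossing hp hc hv (y : E d) with h' | ⟨s, hs, h'⟩
    · have h0 : G y = 0 := h' η hη hw
      rw [Set.mem_ofPred_eq, h0, abs_zero] at hy
      exact absurd ht (not_lt.2 hy.le)
    · have h0 : G y = η (s • w + y) := (h' η hη hw).1
      refine ⟨s • w + y, ⟨by rw [Set.mem_ofPred_eq, ← h0]; exact hy, hs⟩, ?_⟩
      rw [map_add, map_smul, Submodule.orthogonalProjectionOnto_orthogonalComplement_singleton_eq_zero,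
        smul_zero, zero_add, Submodule.orthogonalProjectionOnto_mem_subspace_eq_self]
  refine (measure_mono hsub).trans ?_
  rw [volume_orthogonal_unit hw, surfaceMeasure,
    Measure.restrict_apply (measurableSet_lt measurable_const η.continuous.abs.measurable)]
  exact euclideanHausdorffMeasure_image_le (Submodule.lipschitzWith_orthogonalProjectionOnto _) _ _

/-- Otherwise `y` would be reached from `z` by a step in a cone direction and would belong to the
open set `D`, which is disjoint from its frontier. Thus the boundary is a Lipschitz graph over the
hyperplane orthogonal to `ν`. -/
lemma IsConePatch.norm_le_of_mem_frontier {D : Opens (E d)} {x : E d} {ρ ε : ℝ} {ν : E d}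
    (hp : IsConePatch D x ρ ε ν) {y z : E d} (hy : y ∈ frontier (D : Set (E d)))
    (hz : z ∈ frontier (D : Set (E d))) (hyb : y ∈ Metric.ball x ρ) (hzb : z ∈ Metric.ball x ρ) :
    ε * ⟪ν, z - y⟫_ℝ ≤ ‖(z - y) - ⟪ν, z - y⟫_ℝ • ν‖ := by
  by_contra! hlt
  set h := ⟪ν, z - y⟫_ℝ
  set p := (z - y) - h • ν
  have hh : 0 < h := by
    by_contra! h0
    nlinarith [norm_nonneg p, hp.aperture_pos]
  have e : z - h • (ν + h⁻¹ • p) = y := by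
    rw [smul_add, smul_smul, mul_inv_cancel₀ hh.ne', one_smul]
    simp only [p]; abel
  have := hp.sub_smul_mem (ν + h⁻¹ • p) (by
    rw [Metric.mem_ball, dist_eq_norm, add_sub_cancel_left, norm_smul, norm_inv,
      Real.norm_of_nonneg hh.le, inv_mul_lt_iff₀ hh, mul_comm]
    exact hlt) z (frontier_subset_closure hz) hzb h hh (by rwa [e])
  rw [e] at this
  rw [D.isOpen.frontier_eq] at hy
  exact hy.2 this

lemma coe_orthogonalProjectionOnto_unit {ν : E d} (hν : ‖ν‖ = 1) (u : E d) :
    ((ℝ ∙ ν)ᗮ.orthogonalProjectionOnto u : E d) = u - ⟪ν, u⟫_ℝ • ν := by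
  rw [Submodule.orthogonalProjectionOnto_orthogonal]
  simp [Submodule.starProjection_unit_singleton ℝ hν]

/-- Locally the projection along `ν` has a Lipschitz inverse on `∂D`, defined on a bounded subset of
a `(d-1)`-dimensional space, so the measure is locally finite; the boundary is compact. -/
lemma IsBoundedLipschitzDomain.isFiniteMeasure {D : Opens (E d)}
    (hD : IsBoundedLipschitzDomain D) (hd : 0 < d) : IsFiniteMeasure (surfaceMeasure D) := by
  refine ⟨?_⟩
  rw [surfaceMeasure, Measure.restrict_apply_univ]
  have hcomp : IsCompact (frontier (D : Set (E d))) :=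
    hD.bounded.isCompact_closure.of_isClosed_subset isClosed_frontier frontier_subset_closure
  refine hcomp.measure_lt_top_of_nhdsWithin fun x hx => ?_
  obtain ⟨ρ, ε, ν, hp⟩ := hD.exists_isConePatch hd (frontier_subset_closure hx)
  set A := frontier (D : Set (E d)) ∩ Metric.ball x ρ
  refine ⟨A, inter_mem_nhdsWithin _ (Metric.ball_mem_nhds x hp.radius_pos), ?_⟩
  set π := (ℝ ∙ ν)ᗮ.orthogonalProjectionOnto
  -- The constant comes from `‖u‖ ≤ horizontal + vertical`, the vertical part being at most `1/ε`
  -- times the horizontal one by the cone condition.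
  have hanti : AntilipschitzWith (1 / ε + 1).toNNReal (fun a : A => π a) := by
    refine AntilipschitzWith.of_le_mul_dist fun y z => ?_
    rw [Real.coe_toNNReal _ (by have := hp.aperture_pos; positivity), dist_eq_norm,
      ← map_sub, Subtype.dist_eq, dist_eq_norm, Submodule.coe_norm,
      coe_orthogonalProjectionOnto_unit hp.norm_axis]
    set u := (y : E d) - z
    have h1 := hp.norm_le_of_mem_frontier z.2.1 y.2.1 z.2.2 y.2.2
    have h2 := hp.norm_le_of_mem_frontier y.2.1 z.2.1 y.2.2 z.2.2
    have e : (z : E d) - y = -u := by simp [u]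
    rw [e, inner_neg_right, neg_smul, sub_neg_eq_add] at h2
    have h3 : ε * |⟪ν, u⟫_ℝ| ≤ ‖u - ⟪ν, u⟫_ℝ • ν‖ := by
      rcases abs_cases ⟪ν, u⟫_ℝ with ⟨h, -⟩ | ⟨h, -⟩ <;> rw [h]
      · exact h1
      · refine h2.trans_eq ?_
        rw [← norm_neg]; congr 1; abel
    have h4 : ‖u‖ ≤ ‖u - ⟪ν, u⟫_ℝ • ν‖ + |⟪ν, u⟫_ℝ| := by
      have := norm_add_le (u - ⟪ν, u⟫_ℝ • ν) (⟪ν, u⟫_ℝ • ν)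
      rwa [sub_add_cancel, norm_smul, hp.norm_axis, mul_one, Real.norm_eq_abs] at this
    have h5 : |⟪ν, u⟫_ℝ| ≤ 1 / ε * ‖u - ⟪ν, u⟫_ℝ • ν‖ := by
      rw [one_div, le_inv_mul_iff₀ hp.aperture_pos]; exact h3
    linarith
  have h1 := hanti.le_hausdorffMeasure_image (d := (d - 1 : ℕ)) (by positivity) Set.univ
  have h2 : μH[(d - 1 : ℕ)] ((fun a : A => π a) '' Set.univ) < ∞ := by
    rw [← finrank_orthogonal_unit hp.norm_axis]
    refine Bornology.IsBounded.measure_lt_top ?_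
    have hA : Bornology.IsBounded A := Metric.isBounded_ball.subset Set.inter_subset_right
    refine ((Submodule.lipschitzWith_orthogonalProjectionOnto (ℝ ∙ ν)ᗮ).isBounded_image hA).subset ?_
    rintro _ ⟨a, -, rfl⟩
    exact ⟨a, a.2, rfl⟩
  have h3 : μH[(d - 1 : ℕ)] A = μH[(d - 1 : ℕ)] (Set.univ : Set A) := by
    have hiso : Isometry (Subtype.val : A → E d) := isometry_subtype_coe
    rw [← hiso.hausdorffMeasure_image (.inl (by positivity)), Set.image_univ, Subtype.range_coe]
  rw [Measure.euclideanHausdorffMeasure_def, Measure.smul_apply, h3]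
  refine ENNReal.mul_lt_top (by simp) (h1.trans_lt (ENNReal.mul_lt_top ?_ h2))
  exact ENNReal.rpow_lt_top_of_nonneg (by positivity) (by simp)


/-! ### Mollification -/

lemma tendsto_eLpNorm_translation {F : Type*} [NormedAddCommGroup F] {f : E d → F}
    (hf : MemLp f 2 volume) :
    Tendsto (fun z : E d => eLpNorm (fun x => f (x - z) - f x) 2 volume) (𝓝 0) (𝓝 0) := by
  let g : E d → C(E d, E d) := fun z =>
    (ContinuousMap.mk (fun p : E d × E d => p.2 - p.1) (by fun_prop)).curry z
  have hg : Continuous g := ContinuousMap.continuous _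
  have hgm : ∀ z, MeasurePreserving (g z) volume volume := fun z =>
    measurePreserving_sub_right volume z
  have h0 := (continuousAt_const (y := hf.toLp f)).compMeasurePreservingLp hg.continuousAt
    (z := (0 : E d)) hgm (by norm_num : (2 : ℝ≥0∞) ≠ ∞)
  have h1 := tendsto_iff_edist_tendsto_0.1 h0.tendsto
  refine h1.congr fun z => ?_
  rw [Lp.toLp_compMeasurePreserving, Lp.toLp_compMeasurePreserving, Lp.edist_toLp_toLp]
  congr 1
  ext x
  simp [g]

lemma sq_eLpNorm_two {α F : Type*} [MeasurableSpace α] [NormedAddCommGroup F] (f : α → F)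
    (μ : Measure α) : eLpNorm f 2 μ ^ 2 = ∫⁻ x, ‖f x‖ₑ ^ 2 ∂μ := by
  have := eLpNorm_nnreal_pow_eq_lintegral (f := f) (μ := μ) (p := 2) (by norm_num)
  simpa using this

/-- Jensen's inequality for the probability measure `k dz`, applied to the square of the norm,
followed by Tonelli: the error is an average of translation errors. -/
lemma eLpNorm_mollify_sub_le {F : Type*} [NormedAddCommGroup F] [NormedSpace ℝ F]
    [CompleteSpace F] {f : E d → F} (hf : MemLp f 2 volume)
    (hfm : StronglyMeasurable f) {k : E d → ℝ} (hk : Continuous k) (hkc : HasCompactSupport k)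
    (hk0 : ∀ z, 0 ≤ k z) (hk1 : ∫ z, k z = 1) {ε : ℝ≥0∞}
    (h : ∀ z, k z ≠ 0 → eLpNorm (fun x => f (x - z) - f x) 2 volume ≤ ε) :
    eLpNorm (fun x => (∫ z, k z • f (x - z)) - f x) 2 volume ≤ ε := by
  have hkm : Measurable fun z => ENNReal.ofReal (k z) := hk.measurable.ennreal_ofReal
  have hki : Integrable k := hk.integrable_of_hasCompactSupport hkc
  have hk1' : ∫⁻ z, ENNReal.ofReal (k z) = 1 := by
    rw [← ofReal_integral_eq_lintegral_ofReal hki (.of_forall hk0), hk1, ENNReal.ofReal_one]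
  set κ := (volume : Measure (E d)).withDensity (fun z => ENNReal.ofReal (k z))
  have : IsProbabilityMeasure κ := ⟨by
    rw [withDensity_apply _ MeasurableSet.univ, Measure.restrict_univ, hk1']⟩
  have hm2 : StronglyMeasurable fun p : E d × E d => f (p.1 - p.2) - f p.1 :=
    (hfm.comp_measurable (measurable_fst.sub measurable_snd)).sub
      (hfm.comp_measurable measurable_fst)
  have hpt : ∀ x, ‖(∫ z, k z • f (x - z)) - f x‖ₑ ^ 2 ≤ ∫⁻ z, ‖f (x - z) - f x‖ₑ ^ 2 ∂κ := by
    intro x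
    have i1 : Integrable fun z => k z • f (x - z) :=
      (hkc.convolutionExists_left (ContinuousLinearMap.lsmul ℝ ℝ) hk
        (hf.locallyIntegrable (by norm_num)) x)
    have i2 : Integrable fun z => k z • f x := hki.smul_const _
    have e : (∫ z, k z • f (x - z)) - f x = ∫ z, k z • (f (x - z) - f x) := by
      simp_rw [smul_sub]
      rw [integral_sub i1 i2, integral_smul_const, hk1, one_smul]
    have hmz : StronglyMeasurable fun z => f (x - z) - f x :=
      hm2.comp_measurable measurable_prodMk_left
    rw [e, ← sq_eLpNorm_two]
    gcongr
    refine le_trans ?_ (eLpNorm_le_eLpNorm_of_exponent_le (p := 1) (by norm_num)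
      hmz.aestronglyMeasurable)
    rw [eLpNorm_one_eq_lintegral_enorm]
    refine (enorm_integral_le_lintegral_enorm _).trans_eq ?_
    rw [lintegral_withDensity_eq_lintegral_mul₀ hkm.aemeasurable
      hmz.enorm.aemeasurable]
    refine lintegral_congr fun z => ?_
    rw [Pi.mul_apply, enorm_smul, Real.enorm_of_nonneg (hk0 z)]
  have hsq : eLpNorm (fun x => (∫ z, k z • f (x - z)) - f x) 2 volume ^ 2 ≤ ε ^ 2 := by
    rw [sq_eLpNorm_two]
    refine (lintegral_mono hpt).trans ?_
    rw [lintegral_lintegral_swap (by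
      exact ((hm2.enorm.pow_const 2)).aemeasurable)]
    calc ∫⁻ z, (∫⁻ x, ‖f (x - z) - f x‖ₑ ^ 2) ∂κ ≤ ∫⁻ z, ε ^ 2 ∂κ := by
          refine lintegral_mono_ae ?_
          have : ∀ᵐ z ∂κ, ENNReal.ofReal (k z) ≠ 0 := by
            rw [ae_withDensity_iff hkm]; exact .of_forall fun z h => h
          filter_upwards [this] with z hz
          rw [← sq_eLpNorm_two]
          gcongr
          exact h z fun h0 => hz (by simp [h0])
      _ = ε ^ 2 := by simp
  by_contra! hlt
  exact absurd hsq (not_le.2 (by gcongr))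

/-- The function `y ↦ k (x - y)`. -/
def reflect (k : Smooth d) (x : E d) : Smooth d where
  toFun y := k (x - y)
  contDiff' := (contDiff_testFunction k).comp (contDiff_const.sub contDiff_id)
  hasCompactSupport' := k.hasCompactSupport.comp_homeomorph (Homeomorph.subLeft x)
  tsupport_subset' := Set.subset_univ _

lemma reflect_apply (k : Smooth d) (x y : E d) : reflect k x y = k (x - y) := rfl

lemma fderiv_reflect (k : Smooth d) (x y v : E d) :
    fderiv ℝ (reflect k x) y v = - fderiv ℝ k (x - y) v := by
  have h1 : HasFDerivAt (fun y : E d => x - y) (-ContinuousLinearMap.id ℝ (E d)) y :=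
    (hasFDerivAt_id y).const_sub x
  have h2 := (differentiable_testFunction k (x - y)).hasFDerivAt.comp y h1
  rw [show ⇑(reflect k x) = k ∘ fun y => x - y from rfl, h2.fderiv]
  simp

/-- The zero extension of `χ u`. -/
def cutFn {D : Opens (E d)} (χ : Smooth d) (u : H1 D) : E d → ℝ :=
  (D : Set (E d)).indicator fun x => χ x * u.fn x

/-- The zero extension of `∇(χ u)`. -/
def cutGrad {D : Opens (E d)} (χ : Smooth d) (u : H1 D) : E d → E d :=
  (D : Set (E d)).indicator fun x => χ x • u.grad x + u.fn x • gradient χ x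

lemma stronglyMeasurable_cutFn {D : Opens (E d)} (χ : Smooth d) (u : H1 D) :
    StronglyMeasurable (cutFn χ u) :=
  (χ.continuous.stronglyMeasurable.mul (Lp.stronglyMeasurable u.fn)).indicator
    D.isOpen.measurableSet

lemma stronglyMeasurable_cutGrad {D : Opens (E d)} (χ : Smooth d) (u : H1 D) :
    StronglyMeasurable (cutGrad χ u) :=
  ((χ.continuous.stronglyMeasurable.smul (Lp.stronglyMeasurable u.grad)).add
    ((Lp.stronglyMeasurable u.fn).smul
      (continuous_gradient_testFunction χ).stronglyMeasurable)).indicator D.isOpen.measurableSet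

lemma memLp_cutFn {D : Opens (E d)} (χ : Smooth d) (u : H1 D) : MemLp (cutFn χ u) 2 volume :=
  (memLp_indicator_iff_restrict D.isOpen.measurableSet).2 (memLp_smooth_smul χ (Lp.memLp u.fn))

lemma memLp_cutGrad {D : Opens (E d)} (χ : Smooth d) (u : H1 D) :
    MemLp (cutGrad χ u) 2 volume :=
  (memLp_indicator_iff_restrict D.isOpen.measurableSet).2
    ((memLp_smooth_smul χ (Lp.memLp u.grad)).add (memLp_smul_gradient χ (Lp.memLp u.fn)))

/-- The weak gradient of `u` can be tested against `ψ`. -/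
def WeakTest {D : Opens (E d)} (u : H1 D) (ψ : Smooth d) : Prop :=
  ∀ v : E d, ∫ x in (D : Set (E d)), u.fn x * fderiv ℝ ψ x v =
    - ∫ x in (D : Set (E d)), ⟪u.grad x, v⟫_ℝ * ψ x

lemma weakTest_of_tsupport_subset {D : Opens (E d)} (u : H1 D) {ψ : Smooth d}
    (h : tsupport ψ ⊆ D) : WeakTest u ψ := by
  intro v
  have := u.isWeakGradient ⟨ψ, ψ.contDiff, ψ.hasCompactSupport, h⟩ v
  simp_rw [lineDerivOp_testFunction_apply] at this
  exact this

/-- Product rule: testing `u` against `χψ` produces the extra term `u ψ ∂χ`, which is the second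
part of `cutGrad`. Boundary regularity of `u` enters only through the hypothesis. -/
lemma WeakTest.cut {D : Opens (E d)} {u : H1 D} {χ ψ : Smooth d}
    (h : WeakTest u (mulTest χ (contDiff_testFunction χ) ψ)) (v : E d) :
    ∫ x, cutFn χ u x * fderiv ℝ ψ x v = - ∫ x, ⟪cutGrad χ u x, v⟫_ℝ * ψ x := by
  set μ := volume.restrict (D : Set (E d))
  have hχ := contDiff_testFunction χ
  have e1 : ∫ x, cutFn χ u x * fderiv ℝ ψ x v = ∫ x in (D : Set (E d)),
      (u.fn x * fderiv ℝ (mulTest χ hχ ψ) x v - u.fn x * (fderiv ℝ χ x v * ψ x)) := by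
    rw [← integral_indicator D.isOpen.measurableSet]
    congr 1
    ext x
    by_cases hx : x ∈ (D : Set (E d))
    · rw [cutFn, Set.indicator_of_mem hx, Set.indicator_of_mem hx,
        show ⇑(mulTest χ hχ ψ) = fun y => χ y * ψ y from rfl, fderiv_mul_testFunction hχ]
      ring
    · rw [cutFn, Set.indicator_of_notMem hx, Set.indicator_of_notMem hx, zero_mul]
  have e2 : ∫ x, ⟪cutGrad χ u x, v⟫_ℝ * ψ x = ∫ x in (D : Set (E d)),
      (⟪u.grad x, v⟫_ℝ * mulTest χ hχ ψ x + u.fn x * (fderiv ℝ χ x v * ψ x)) := by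
    rw [← integral_indicator D.isOpen.measurableSet]
    congr 1
    ext x
    by_cases hx : x ∈ (D : Set (E d))
    · rw [cutGrad, Set.indicator_of_mem hx, Set.indicator_of_mem hx]
      simp only [inner_add_left, inner_smul_left, inner_gradient, mulTest_apply, conj_trivial]
      ring
    · rw [cutGrad, Set.indicator_of_notMem hx, Set.indicator_of_notMem hx, inner_zero_left,
        zero_mul]
  have hb : MemLp (fun x => fderiv ℝ χ x v * ψ x) 2 μ :=
    memLp_smooth (mulTest (fun x => fderiv ℝ χ x v)
      ((hχ.fderiv_right (m := (⊤ : ℕ∞)) (by simp)).clm_apply contDiff_const) ψ) μ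
  have i1 : Integrable (fun x => u.fn x * (fderiv ℝ χ x v * ψ x)) μ :=
    (Lp.memLp u.fn).integrable_mul hb
  have i2 : Integrable (fun x => u.fn x * fderiv ℝ (mulTest χ hχ ψ) x v) μ :=
    (Lp.memLp u.fn).integrable_mul (memLp_fderiv_apply _ v μ)
  have i3 : Integrable (fun x => ⟪u.grad x, v⟫_ℝ * mulTest χ hχ ψ x) μ :=
    ((Lp.memLp u.grad).inner_const v).integrable_mul (memLp_smooth _ μ)
  rw [e1, e2, integral_sub i2 i1, integral_add i3 i1, h v]
  ring

/-- The mollification of the zero extension of `χ u`. -/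
def mollify {D : Opens (E d)} (k χ : Smooth d) (u : H1 D) : Smooth d where
  toFun x := ∫ t, k t • cutFn χ u (x - t)
  contDiff' := k.hasCompactSupport.contDiff_convolution_left (ContinuousLinearMap.lsmul ℝ ℝ)
    k.contDiff ((memLp_cutFn χ u).locallyIntegrable (by norm_num))
  hasCompactSupport' := by
    refine HasCompactSupport.convolution (ContinuousLinearMap.lsmul ℝ ℝ) k.hasCompactSupport ?_
    refine χ.hasCompactSupport.mono fun x hx => ?_
    rw [Function.mem_support] at hx ⊢
    rintro h0
    exact hx (by simp [cutFn, Set.indicator, h0])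
  tsupport_subset' := Set.subset_univ _

lemma mollify_apply {D : Opens (E d)} (k χ : Smooth d) (u : H1 D) (x : E d) :
    mollify k χ u x = ∫ t, k t • cutFn χ u (x - t) := rfl

/-- The derivative of the convolution falls on the kernel, hence, up to sign, on `y ↦ k (x - y)`;
the weak identity for that one test function moves it onto `u`. The point `x` is thus treated in
isolation. -/
lemma gradient_mollify {D : Opens (E d)} {k χ : Smooth d} {u : H1 D} {x : E d}
    (h : WeakTest u (mulTest χ (contDiff_testFunction χ) (reflect k x))) :
    gradient (mollify k χ u) x = ∫ t, k t • cutGrad χ u (x - t) := by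
  have hloc : LocallyIntegrable (cutFn χ u) := (memLp_cutFn χ u).locallyIntegrable (by norm_num)
  have hlocg : LocallyIntegrable (cutGrad χ u) :=
    (memLp_cutGrad χ u).locallyIntegrable (by norm_num)
  refine ext_inner_right ℝ fun v => ?_
  rw [inner_gradient]
  have h1 := k.hasCompactSupport.hasFDerivAt_convolution_left (𝕜 := ℝ)
    (ContinuousLinearMap.lsmul ℝ ℝ) ((contDiff_testFunction k).of_le (by simp)) hloc x
  have hex : ConvolutionExistsAt (fderiv ℝ k) (cutFn χ u) x
      ((ContinuousLinearMap.lsmul ℝ ℝ).precompL (E d)) :=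
    (k.hasCompactSupport.fderiv ℝ).convolutionExists_left _
      ((contDiff_testFunction k).continuous_fderiv (by simp)) hloc x
  have h2 : fderiv ℝ (mollify k χ u) x v = ∫ t, fderiv ℝ k t v * cutFn χ u (x - t) := by
    rw [show ⇑(mollify k χ u) = convolution k (cutFn χ u) (ContinuousLinearMap.lsmul ℝ ℝ) volume
      from rfl, h1.fderiv, convolution_def, ContinuousLinearMap.integral_apply hex]
    rfl
  have i2 : Integrable fun t => k t • cutGrad χ u (x - t) :=
    k.hasCompactSupport.convolutionExists_left (ContinuousLinearMap.lsmul ℝ ℝ) k.continuous hlocg x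
  rw [h2, real_inner_comm, ← integral_inner i2]
  have h3 := h.cut v
  rw [← integral_sub_left_eq_self (fun t => fderiv ℝ k t v * cutFn χ u (x - t)) _ x,
    ← integral_sub_left_eq_self (fun t => ⟪v, k t • cutGrad χ u (x - t)⟫_ℝ) _ x]
  simp only [sub_sub_cancel, inner_smul_right]
  simp only [fderiv_reflect, reflect_apply, mul_neg, integral_neg, neg_inj] at h3
  rw [show (∫ y, fderiv ℝ k (x - y) v * cutFn χ u y) = ∫ y, cutFn χ u y * fderiv ℝ k (x - y) v by
    simp_rw [mul_comm], h3]
  refine integral_congr_ae (.of_forall fun y => ?_)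
  simp only [real_inner_comm v, mul_comm]

/-- Mollifications with shrinking kernels converge in `H¹(D)`. -/
lemma tendsto_mollify {D : Opens (E d)} (χ : Smooth d) (u : H1 D) {k : ℕ → Smooth d} {δ : ℕ → ℝ}
    (hδ : Tendsto δ atTop (𝓝 0)) (hk0 : ∀ n z, 0 ≤ k n z) (hk1 : ∀ n, ∫ z, k n z = 1)
    (hks : ∀ n z, k n z ≠ 0 → ‖z‖ ≤ δ n)
    (ht : ∀ n, ∀ x ∈ D, WeakTest u (mulTest χ (contDiff_testFunction χ) (reflect (k n) x))) :
    Tendsto (fun n => smoothH1 D (mollify (k n) χ u)) atTop (𝓝 (mulH1 χ u)) := by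
  have key : ∀ {F : Type} [NormedAddCommGroup F] [NormedSpace ℝ F] [CompleteSpace F]
      (f : E d → F), MemLp f 2 volume → StronglyMeasurable f →
      Tendsto (fun n => eLpNorm (fun x => (∫ z, k n z • f (x - z)) - f x) 2 volume) atTop
        (𝓝 0) := by
    intro F _ _ _ f hf hfm
    rw [ENNReal.tendsto_nhds_zero]
    intro ε hε
    have h1 := ENNReal.tendsto_nhds_zero.1 (tendsto_eLpNorm_translation hf) ε hε
    obtain ⟨r, hr, hball⟩ := Metric.eventually_nhds_iff_ball.1 h1
    filter_upwards [hδ.eventually (gt_mem_nhds hr)] with n hn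
    refine eLpNorm_mollify_sub_le hf hfm (k n).continuous (k n).hasCompactSupport (hk0 n) (hk1 n)
      fun z hz => hball z ?_
    rw [mem_ball_zero_iff]
    exact (hks n z hz).trans_lt hn
  have hf := key _ (memLp_cutFn χ u) (stronglyMeasurable_cutFn χ u)
  have hg := key _ (memLp_cutGrad χ u) (stronglyMeasurable_cutGrad χ u)
  rw [tendsto_iff_norm_sub_tendsto_zero]
  have hf' := (ENNReal.tendsto_toReal (by simp)).comp hf
  have hg' := (ENNReal.tendsto_toReal (by simp)).comp hg
  refine squeeze_zero' (.of_forall fun _ => norm_nonneg _) ?_ (by simpa using hf'.add hg')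
  filter_upwards [(ENNReal.tendsto_nhds_zero.1 hf 1 one_pos),
    (ENNReal.tendsto_nhds_zero.1 hg 1 one_pos)] with n hn1 hn2
  refine (H1.norm_le _).trans (add_le_add ?_ ?_)
  · rw [← H1.fnL_apply, map_sub, H1.fnL_apply, H1.fnL_apply, Lp.norm_def]
    refine ENNReal.toReal_mono (hn1.trans_lt ENNReal.one_lt_top).ne ?_
    refine le_trans (le_of_eq (eLpNorm_congr_ae ?_)) (eLpNorm_mono_measure _ Measure.restrict_le_self)
    filter_upwards [Lp.coeFn_sub (smoothH1 D (mollify (k n) χ u)).fn (mulH1 χ u).fn,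
      coeFn_smoothH1_fn D (mollify (k n) χ u), coeFn_mulH1_fn χ u,
      ae_restrict_mem D.isOpen.measurableSet] with x h1 h2 h3 hx
    rw [h1, Pi.sub_apply, h2, h3, mollify_apply, cutFn, Set.indicator_of_mem hx]
    rfl
  · rw [← H1.gradL_apply, map_sub, H1.gradL_apply, H1.gradL_apply, Lp.norm_def]
    refine ENNReal.toReal_mono (hn2.trans_lt ENNReal.one_lt_top).ne ?_
    refine le_trans (le_of_eq (eLpNorm_congr_ae ?_)) (eLpNorm_mono_measure _ Measure.restrict_le_self)
    filter_upwards [Lp.coeFn_sub (smoothH1 D (mollify (k n) χ u)).grad (mulH1 χ u).grad,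
      coeFn_smoothH1_grad D (mollify (k n) χ u), coeFn_mulH1_grad χ u,
      ae_restrict_mem D.isOpen.measurableSet] with x h1 h2 h3 hx
    rw [h1, Pi.sub_apply, h2, h3, gradient_mollify (ht n x hx), cutGrad, Set.indicator_of_mem hx]


/-! ### Density of smooth functions -/

/-- A smooth kernel of integral one, supported in a ball. -/
def bumpKernel (c : E d) {r : ℝ} (hr : 0 < r) : Smooth d where
  toFun := (⟨r / 2, r, by positivity, by linarith⟩ : ContDiffBump c).normed volume
  contDiff' := ContDiffBump.contDiff_normed _
  hasCompactSupport' := ContDiffBump.hasCompactSupport_normed _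
  tsupport_subset' := Set.subset_univ _

lemma bumpKernel_nonneg (c : E d) {r : ℝ} (hr : 0 < r) (z : E d) : 0 ≤ bumpKernel c hr z :=
  ContDiffBump.nonneg_normed _ _

lemma integral_bumpKernel (c : E d) {r : ℝ} (hr : 0 < r) : ∫ z, bumpKernel c hr z = 1 :=
  ContDiffBump.integral_normed _

lemma tsupport_bumpKernel (c : E d) {r : ℝ} (hr : 0 < r) :
    tsupport (bumpKernel c hr) = Metric.closedBall c r :=
  ContDiffBump.tsupport_normed_eq _

lemma exists_smul_of_mem_closedBall {ν z : E d} {δ ε : ℝ} (hδ : 0 < δ) (hε : 0 < ε)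
    (hz : z ∈ Metric.closedBall (δ • ν) (δ * (ε / 2))) : ∃ v ∈ Metric.ball ν ε, z = δ • v := by
  refine ⟨δ⁻¹ • z, ?_, by rw [smul_smul, mul_inv_cancel₀ hδ.ne', one_smul]⟩
  rw [mem_closedBall_iff_norm] at hz
  rw [mem_ball_iff_norm]
  have e : δ⁻¹ • z - ν = δ⁻¹ • (z - δ • ν) := by
    rw [smul_sub, smul_smul, inv_mul_cancel₀ hδ.ne', one_smul]
  rw [e, norm_smul, norm_inv, Real.norm_of_nonneg hδ.le, inv_mul_lt_iff₀ hδ]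
  nlinarith

lemma norm_le_of_mem_closedBall {ν z : E d} {δ ε : ℝ} (hδ : 0 < δ) (hε : ε < 1) (hν : ‖ν‖ = 1)
    (hz : z ∈ Metric.closedBall (δ • ν) (δ * (ε / 2))) : ‖z‖ ≤ 2 * δ := by
  rw [mem_closedBall_iff_norm] at hz
  have := norm_add_le (z - δ • ν) (δ • ν)
  rw [sub_add_cancel, norm_smul, hν, mul_one, Real.norm_of_nonneg hδ.le] at this
  nlinarith

lemma shrink_pos {ρ : ℝ} (hρ : 0 < ρ) (n : ℕ) : 0 < ρ / (8 * (n + 1)) := by positivity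

lemma four_mul_shrink_lt {ρ : ℝ} (hρ : 0 < ρ) (n : ℕ) : 4 * (ρ / (8 * (n + 1))) < ρ := by
  rw [← mul_div_assoc, div_lt_iff₀ (by positivity)]
  nlinarith [(Nat.cast_nonneg n : (0 : ℝ) ≤ n)]

lemma tendsto_shrink (ρ : ℝ) : Tendsto (fun n : ℕ => 2 * (ρ / (8 * ((n : ℝ) + 1)))) atTop (𝓝 0) := by
  have h := (tendsto_one_div_add_atTop_nhds_zero_nat (𝕜 := ℝ)).const_mul (ρ / 4)
  rw [mul_zero] at h
  refine h.congr fun n => ?_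
  field_simp
  ring

/-- With kernels concentrated near `δν`, the mollification at `y ∈ D` only sees values near `y -
δν`, which lie in `D` by the cone property. The shifted kernel times `χ` is therefore supported in
`D`, where the weak gradient may be tested. -/
lemma IsConePatch.mulH1_mem_closure_smooth {D : Opens (E d)} {x : E d} {ρ ε : ℝ} {ν : E d}
    (hp : IsConePatch D x ρ ε ν) {χ : Smooth d} (hχ : tsupport χ ⊆ Metric.ball x (ρ / 2))
    (u : H1 D) : mulH1 χ u ∈ (LinearMap.range (smoothH1ₗ D)).topologicalClosure := by
  have hδ := shrink_pos hp.radius_pos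
  -- Shifts have norm at most `2δ < ρ/2`, so they carry the half ball containing the support of `χ`
  -- into the full ball of the patch.
  set δ : ℕ → ℝ := fun n => ρ / (8 * (n + 1))
  have hr : ∀ n, 0 < δ n * (ε / 2) := fun n => mul_pos (hδ n) (by linarith [hp.aperture_pos])
  refine mem_closure_of_tendsto (tendsto_mollify χ u (k := fun n => bumpKernel (δ n • ν) (hr n))
    (tendsto_shrink ρ) (fun n => bumpKernel_nonneg _ _) (fun n => integral_bumpKernel _ _)
    (fun n z hz => ?_) (fun n y hy => ?_)) (.of_forall fun n => ⟨_, rfl⟩)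
  · refine norm_le_of_mem_closedBall (hδ n) hp.aperture_lt hp.norm_axis ?_
    rw [← tsupport_bumpKernel _ (hr n)]
    exact subset_tsupport _ hz
  · refine weakTest_of_tsupport_subset u fun z hz => ?_
    have hz1 : z ∈ tsupport χ := tsupport_mul_subset_left hz
    have hz2 : z ∈ tsupport (reflect (bumpKernel (δ n • ν) (hr n)) y) :=
      tsupport_mul_subset_right hz
    have hz3 : y - z ∈ tsupport (bumpKernel (δ n • ν) (hr n)) :=
      tsupport_comp_subset_preimage (bumpKernel (δ n • ν) (hr n))
        (f := fun z => y - z) (by fun_prop) hz2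
    rw [tsupport_bumpKernel] at hz3
    have hnorm := norm_le_of_mem_closedBall (hδ n) hp.aperture_lt hp.norm_axis hz3
    obtain ⟨v, hv, hyz⟩ := exists_smul_of_mem_closedBall (hδ n) hp.aperture_pos hz3
    have e : z = y - δ n • v := by rw [← hyz]; abel
    have hzx := mem_ball_iff_norm.1 (hχ hz1)
    have h4 := four_mul_shrink_lt hp.radius_pos n
    have hyb : y ∈ Metric.ball x ρ := by
      rw [mem_ball_iff_norm]
      have : y - x = (y - z) + (z - x) := by abel
      rw [this]
      refine (norm_add_le _ _).trans_lt ?_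
      have : 4 * δ n < ρ := h4
      linarith
    have hzb : z ∈ Metric.ball x ρ := by
      rw [mem_ball_iff_norm]; linarith [hp.radius_pos]
    rw [e] at hzb ⊢
    exact hp.sub_smul_mem v hv y (subset_closure hy) hyb _ (hδ n) hzb

/-- The restriction of test functions to `D`, in `H¹(D)`. -/
def testH1ₗ (D : Opens (E d)) : 𝓓(D, ℝ) →ₗ[ℝ] H1 D where
  toFun φ := smoothH1 D (toSmooth φ)
  map_add' φ ψ := smoothH1_add D (toSmooth φ) (toSmooth ψ)
  map_smul' c φ := smoothH1_smul D c (toSmooth φ)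

/-- `H¹₀(D)`, the closure of the test functions in `H¹(D)`. -/
def H10 (D : Opens (E d)) : Submodule ℝ (H1 D) := (LinearMap.range (testH1ₗ D)).topologicalClosure

-- The shift is opposite to that of `mulH1_mem_closure_smooth`: kernels near `-δν` push the support
-- of `χu` strictly into `D`, so the mollifications are test functions. They now sample outside `D`,
-- and convergence holds because the zero extension of `u` has a weak gradient on the whole space.
open scoped Pointwise in
lemma IsConePatch.mulH1_mem_H10 {D : Opens (E d)} {x : E d} {ρ ε : ℝ} {ν : E d}
    (hp : IsConePatch D x ρ ε ν) {χ : Smooth d} (hχ : tsupport χ ⊆ Metric.ball x (ρ / 2))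
    {u : H1 D} (hu : ∀ ψ : Smooth d, WeakTest u ψ) : mulH1 χ u ∈ H10 D := by
  have hδ := shrink_pos hp.radius_pos
  set δ : ℕ → ℝ := fun n => ρ / (8 * (n + 1))
  have hr : ∀ n, 0 < δ n * (ε / 2) := fun n => mul_pos (hδ n) (by linarith [hp.aperture_pos])
  set k : ℕ → Smooth d := fun n => bumpKernel (-(δ n • ν)) (hr n)
  have hneg : ∀ n z, z ∈ tsupport (k n) → -z ∈ Metric.closedBall (δ n • ν) (δ n * (ε / 2)) := by
    intro n z hz
    rw [tsupport_bumpKernel, mem_closedBall_iff_norm] at hz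
    rw [mem_closedBall_iff_norm, ← norm_neg]
    rwa [neg_sub, sub_neg_eq_add, add_comm, ← sub_neg_eq_add]
  refine mem_closure_of_tendsto (tendsto_mollify χ u (k := k)
    (tendsto_shrink ρ) (fun n => bumpKernel_nonneg _ _) (fun n => integral_bumpKernel _ _)
    (fun n z hz => ?_) (fun n y hy => hu _)) (.of_forall fun n => ?_)
  · rw [← norm_neg]
    exact norm_le_of_mem_closedBall (hδ n) hp.aperture_lt hp.norm_axis
      (hneg n z (subset_tsupport _ hz))
  · have hK : IsCompact (tsupport (k n) + (closure (D : Set (E d)) ∩ tsupport χ)) :=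
      (k n).hasCompactSupport.isCompact.add (χ.hasCompactSupport.isCompact.inter_left isClosed_closure)
    have hsub : tsupport (mollify (k n) χ u) ⊆ D := by
      refine (closure_minimal ?_ hK.isClosed).trans ?_
      · refine (support_convolution_subset (ContinuousLinearMap.lsmul ℝ ℝ)).trans
          (Set.add_subset_add (subset_tsupport _) fun y hy => ?_)
        have hyD : y ∈ (D : Set (E d)) := Set.mem_of_indicator_ne_zero hy
        refine ⟨subset_closure hyD, subset_tsupport _ fun h0 => hy ?_⟩
        simp [cutFn, Set.indicator, h0]
      · rintro _ ⟨z, hz, y, ⟨hyD, hyχ⟩, rfl⟩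
        obtain ⟨v, hv, hzv⟩ := exists_smul_of_mem_closedBall (hδ n) hp.aperture_pos (hneg n z hz)
        have hnorm := norm_le_of_mem_closedBall (hδ n) hp.aperture_lt hp.norm_axis (hneg n z hz)
        rw [norm_neg] at hnorm
        have e : z + y = y - δ n • v := by rw [← hzv]; abel
        have hyx := mem_ball_iff_norm.1 (hχ hyχ)
        have h4 : 4 * δ n < ρ := four_mul_shrink_lt hp.radius_pos n
        have hyb : y ∈ Metric.ball x ρ := by
          rw [mem_ball_iff_norm]; linarith [hp.radius_pos]
        have hzb : z + y ∈ Metric.ball x ρ := by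
          rw [mem_ball_iff_norm, add_sub_assoc]
          refine (norm_add_le _ _).trans_lt ?_
          linarith
        change z + y ∈ (D : Set (E d))
        rw [e] at hzb ⊢
        exact hp.sub_smul_mem v hv y hyD hyb _ (hδ n) hzb
    exact ⟨⟨mollify (k n) χ u, (mollify (k n) χ u).contDiff, (mollify (k n) χ u).hasCompactSupport,
      hsub⟩, rfl⟩

lemma sum_mulH1 {D : Opens (E d)} {ι : Type} [Fintype ι] (χ : ι → Smooth d)
    (h : ∀ y ∈ closure (D : Set (E d)), ∑ i, χ i y = 1) (u : H1 D) : ∑ i, mulH1 (χ i) u = u := by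
  refine H1.ext ?_
  rw [← H1.fnL_apply, map_sum]
  refine Lp.ext ?_
  have h1 : ∀ i, ∀ᵐ x ∂(volume.restrict (D : Set (E d))),
      H1.fnL D (mulH1 (χ i) u) x = χ i x * u.fn x := fun i => coeFn_mulH1_fn (χ i) u
  filter_upwards [Lp.coeFn_finsetSum (p := 2) (μ := volume.restrict (D : Set (E d)))
    (f := fun i => H1.fnL D (mulH1 (χ i) u)) (s := Finset.univ), ae_all_iff.2 h1,
    ae_restrict_mem D.isOpen.measurableSet] with x hx h1x hxD
  rw [hx, Finset.sum_apply]
  simp_rw [h1x]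
  rw [← Finset.sum_mul, h x (subset_closure hxD), one_mul]

/-- Smooth functions on the whole space are dense in `H¹(D)`. -/
lemma IsBoundedLipschitzDomain.mem_closure_smooth {D : Opens (E d)}
    (hD : IsBoundedLipschitzDomain D) (hd : 0 < d) (u : H1 D) :
    u ∈ (LinearMap.range (smoothH1ₗ D)).topologicalClosure := by
  obtain ⟨ι, _, χ, x, ρ, ε, ν, hp, hs, h1⟩ := hD.exists_partition hd
  rw [← sum_mulH1 χ h1 u]
  exact Submodule.sum_mem _ fun i _ => (hp i).mulH1_mem_closure_smooth (hs i) u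

lemma IsBoundedLipschitzDomain.mem_H10_of_weakTest {D : Opens (E d)}
    (hD : IsBoundedLipschitzDomain D) (hd : 0 < d) {u : H1 D}
    (hu : ∀ ψ : Smooth d, WeakTest u ψ) : u ∈ H10 D := by
  obtain ⟨ι, _, χ, x, ρ, ε, ν, hp, hs, h1⟩ := hD.exists_partition hd
  rw [← sum_mulH1 χ h1 u]
  exact Submodule.sum_mem _ fun i _ => (hp i).mulH1_mem_H10 (hs i) hu


/-! ### Functions with zero trace -/

/-- The gradient bound of `IsConePatch.ofReal_abs_setIntegral_fderiv_le`, for all directions. -/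
lemma IsConePatch.exists_surface_bound {D : Opens (E d)} {x : E d} {ρ ε : ℝ} {ν : E d}
    (hp : IsConePatch D x ρ ε ν) (v : E d) :
    ∃ C : ℝ≥0∞, C ≠ ∞ ∧ ∀ η : Smooth d, tsupport η ⊆ Metric.ball x ρ →
      ENNReal.ofReal |∫ y in (D : Set (E d)), fderiv ℝ η y v| ≤
        C * ∫⁻ y, ENNReal.ofReal |η y| ∂(surfaceMeasure D) := by
  have hε := hp.aperture_pos
  -- An arbitrary direction is a difference of two cone directions, `s • v = (ν + s • v) - ν`; this
  -- `s` keeps the first one in the cone.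
  set s : ℝ := ε / (2 * (‖v‖ + 1))
  have hs : 0 < s := by positivity
  have hv : ν + s • v ∈ Metric.ball ν ε := by
    rw [mem_ball_iff_norm, add_sub_cancel_left, norm_smul, Real.norm_of_nonneg hs.le,
      div_mul_eq_mul_div, div_lt_iff₀ (by positivity)]
    nlinarith [norm_nonneg v]
  have hν : ν ∈ Metric.ball ν ε := Metric.mem_ball_self hε
  refine ⟨ENNReal.ofReal s⁻¹ * (ENNReal.ofReal ‖ν + s • v‖ + ENNReal.ofReal ‖ν‖), by finiteness,
    fun η hη => ?_⟩
  have h1 := hp.ofReal_abs_setIntegral_fderiv_le hv hη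
  have h2 := hp.ofReal_abs_setIntegral_fderiv_le hν hη
  have i1 := (integrable_fderiv_apply η (ν + s • v)).integrableOn (s := (D : Set (E d)))
  have i2 := (integrable_fderiv_apply η ν).integrableOn (s := (D : Set (E d)))
  have e : ∫ y in (D : Set (E d)), fderiv ℝ η y v =
      s⁻¹ * ((∫ y in (D : Set (E d)), fderiv ℝ η y (ν + s • v)) -
        ∫ y in (D : Set (E d)), fderiv ℝ η y ν) := by
    rw [← integral_sub i1 i2, ← integral_const_mul]
    refine integral_congr_ae (.of_forall fun y => ?_)
    simp only [map_add, map_smul, smul_eq_mul, add_sub_cancel_left]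
    rw [← mul_assoc, inv_mul_cancel₀ hs.ne', one_mul]
  rw [e, abs_mul, abs_of_pos (inv_pos.2 hs), ENNReal.ofReal_mul (inv_pos.2 hs).le, mul_assoc]
  refine mul_le_mul_right ?_ _
  rw [add_mul]
  refine le_trans ?_ (add_le_add h1 h2)
  rw [← ENNReal.ofReal_add (abs_nonneg _) (abs_nonneg _)]
  exact ENNReal.ofReal_le_ofReal (abs_sub _ _)

lemma fderiv_sum_mul_eq {D : Opens (E d)} {ι : Type} [Fintype ι] {χ : ι → Smooth d}
    (h : ∀ y ∈ closure (D : Set (E d)), ∑ i, χ i y = 1) (η : Smooth d) {x : E d} (hx : x ∈ D)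
    (v : E d) : fderiv ℝ η x v =
      ∑ i, fderiv ℝ (mulTest (χ i) (contDiff_testFunction (χ i)) η) x v := by
  have h1 : (fun y => ∑ i, mulTest (χ i) (contDiff_testFunction (χ i)) η y) =ᶠ[𝓝 x] η := by
    filter_upwards [D.isOpen.mem_nhds hx] with y hy
    simp_rw [mulTest_apply]
    rw [← Finset.sum_mul, h y (subset_closure hy), one_mul]
  rw [← h1.fderiv_eq, fderiv_fun_sum fun i _ => differentiable_testFunction _ _,
    sum_apply]

/-- This takes the place of the divergence theorem: only an upper bound of `∫_D ∂_v(φψ)` by the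
`L²(∂D)` norm of `φ` is needed. It comes from the patchwise bounds by a partition of unity and
Cauchy–Schwarz on the finite surface measure. -/
lemma IsBoundedLipschitzDomain.exists_surface_bound {D : Opens (E d)}
    (hD : IsBoundedLipschitzDomain D) (hd : 0 < d) (v : E d) (ψ : Smooth d) :
    ∃ C : ℝ, ∀ φ : Smooth d, ∀ g : L2bdry D, g =ᵐ[surfaceMeasure D] φ →
      |∫ y in (D : Set (E d)), fderiv ℝ (mulTest φ (contDiff_testFunction φ) ψ) y v| ≤ C * ‖g‖ := by
  obtain ⟨ι, _, χ, x, ρ, ε, ν, hp, hs, h1⟩ := hD.exists_partition hd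
  have := hD.isFiniteMeasure hd
  choose C hC hCle using fun i => (hp i).exists_surface_bound v
  choose M hM0 hM using fun i => norm_smooth_le (mulTest (χ i) (contDiff_testFunction (χ i)) ψ)
  set S := surfaceMeasure D Set.univ ^ (1 / (1 : ℝ≥0∞).toReal - 1 / (2 : ℝ≥0∞).toReal)
  have hS : S ≠ ∞ := ENNReal.rpow_ne_top_of_nonneg (by norm_num) (measure_ne_top _ _)
  refine ⟨(∑ i, C i * ENNReal.ofReal (M i) * S).toReal, fun φ g hg => ?_⟩
  have hfin : ∑ i, C i * ENNReal.ofReal (M i) * S ≠ ∞ :=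
    ENNReal.sum_ne_top.2 fun i _ => by have := hC i; finiteness
  have key : ENNReal.ofReal
      |∫ y in (D : Set (E d)), fderiv ℝ (mulTest φ (contDiff_testFunction φ) ψ) y v| ≤
      (∑ i, C i * ENNReal.ofReal (M i) * S) * eLpNorm g 2 (surfaceMeasure D) := by
    have e : ∫ y in (D : Set (E d)), fderiv ℝ (mulTest φ (contDiff_testFunction φ) ψ) y v =
        ∑ i, ∫ y in (D : Set (E d)), fderiv ℝ (mulTest (χ i) (contDiff_testFunction (χ i))
          (mulTest φ (contDiff_testFunction φ) ψ)) y v := by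
      rw [← integral_finsetSum _ fun i _ => (integrable_fderiv_apply _ v).integrableOn]
      refine setIntegral_congr_fun D.isOpen.measurableSet fun y hy => ?_
      exact fderiv_sum_mul_eq h1 _ hy v
    rw [e, Finset.sum_mul]
    refine (ENNReal.ofReal_le_ofReal (Finset.abs_sum_le_sum_abs _ _)).trans ?_
    rw [ENNReal.ofReal_sum_of_nonneg fun i _ => abs_nonneg _]
    refine Finset.sum_le_sum fun i _ => ?_
    refine (hCle i _ ?_).trans ?_
    · refine (tsupport_mul_subset_left.trans (hs i)).trans (Metric.ball_subset_ball ?_)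
      linarith [(hp i).radius_pos]
    · rw [mul_assoc, mul_assoc]
      refine mul_le_mul_right ?_ _
      calc ∫⁻ y, ENNReal.ofReal |mulTest (χ i) (contDiff_testFunction (χ i))
            (mulTest φ (contDiff_testFunction φ) ψ) y| ∂(surfaceMeasure D)
          ≤ ∫⁻ y, ENNReal.ofReal (M i) * ‖g y‖ₑ ∂(surfaceMeasure D) := by
            refine lintegral_mono_ae ?_
            filter_upwards [hg] with y hy
            rw [hy, Real.enorm_eq_ofReal_abs, ← ENNReal.ofReal_mul (hM0 i)]
            refine ENNReal.ofReal_le_ofReal ?_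
            have := mul_le_mul_of_nonneg_right (hM i y) (abs_nonneg (φ y))
            refine le_trans (le_of_eq ?_) this
            rw [← abs_mul]
            congr 1
            simp only [mulTest_apply]; ring
        _ = ENNReal.ofReal (M i) * eLpNorm g 1 (surfaceMeasure D) := by
            rw [lintegral_const_mul' _ _ ENNReal.ofReal_ne_top, eLpNorm_one_eq_lintegral_enorm]
        _ ≤ ENNReal.ofReal (M i) * (S * eLpNorm g 2 (surfaceMeasure D)) := by
            refine mul_le_mul_right ?_ _
            rw [mul_comm]
            exact eLpNorm_le_eLpNorm_mul_rpow_measure_univ (by norm_num) (Lp.aestronglyMeasurable g)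
  have hk := ENNReal.toReal_mono (ENNReal.mul_ne_top hfin (Lp.eLpNorm_ne_top g)) key
  rwa [ENNReal.toReal_ofReal (abs_nonneg _), ENNReal.toReal_mul, ← Lp.norm_def] at hk

/-- The zero extension of a function with zero trace is weakly differentiable. -/
lemma IsBoundedLipschitzDomain.weakTest_of_trace_eq_zero {D : Opens (E d)}
    (hD : IsBoundedLipschitzDomain D) (hd : 0 < d) {u : H1 D}
    (hu : WithLp.toLp 2 (u, (0 : L2bdry D)) ∈ traceGraph D) (ψ : Smooth d) : WeakTest u ψ := by
  intro v
  set μ := volume.restrict (D : Set (E d))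
  set a : L2 D := (memLp_fderiv_apply ψ v μ).toLp _
  set b : L2vec D := (show MemLp (fun x => ψ x • v) 2 μ from
    ((ψ.continuous.smul continuous_const).memLp_of_hasCompactSupport
      ψ.hasCompactSupport.smul_right)).toLp _ with hb
  have e1 : ∀ w : L2 D, ∫ x in (D : Set (E d)), w x * fderiv ℝ ψ x v = ⟪a, w⟫_ℝ := fun w => by
    rw [L2.inner_def]
    refine integral_congr_ae ?_
    filter_upwards [(memLp_fderiv_apply ψ v μ).coeFn_toLp] with x hx
    rw [hx]; simp
  have e2 : ∀ g : L2vec D, ∫ x in (D : Set (E d)), ⟪g x, v⟫_ℝ * ψ x = ⟪b, g⟫_ℝ := fun g => by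
    rw [L2.inner_def]
    refine integral_congr_ae ?_
    filter_upwards [MemLp.coeFn_toLp (show MemLp (fun x => ψ x • v) 2 μ from
      ((ψ.continuous.smul continuous_const).memLp_of_hasCompactSupport
        ψ.hasCompactSupport.smul_right))] with x hx
    rw [hb, hx, real_inner_smul_left, real_inner_comm]; ring
  obtain ⟨C, hC⟩ := hD.exists_surface_bound hd v ψ
  -- For a smooth pair the left side is `|∫_D ∂_v(φψ)|`. The inequality is closed in the pair, so it
  -- holds on the whole trace graph, and a zero boundary component yields the exact identity.
  have hclosed : IsClosed {p : WithLp 2 (H1 D × L2bdry D) |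
      |⟪a, p.fst.fn⟫_ℝ + ⟪b, p.fst.grad⟫_ℝ| ≤ C * ‖p.snd‖} := by
    refine isClosed_le (Continuous.abs (Continuous.add ?_ ?_)) ?_
    · exact continuous_const.inner
        (((H1.fnL D).comp (WithLp.fstL 2 ℝ (H1 D) (L2bdry D))).continuous)
    · exact continuous_const.inner
        (((H1.gradL D).comp (WithLp.fstL 2 ℝ (H1 D) (L2bdry D))).continuous)
    · exact continuous_const.mul (WithLp.sndL 2 ℝ (H1 D) (L2bdry D)).continuous.norm
  have hsub : (smoothTraceGraph D : Set (WithLp 2 (H1 D × L2bdry D))) ⊆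
      {p | |⟪a, p.fst.fn⟫_ℝ + ⟪b, p.fst.grad⟫_ℝ| ≤ C * ‖p.snd‖} := by
    rintro p ⟨φ, h1, h2⟩
    have hp : p.fst = smoothH1 D φ := H1.ext (Lp.ext
      (EventuallyEq.trans (g := fun x => φ x) h1 (coeFn_smoothH1_fn D φ).symm))
    have h3 := hC φ p.snd h2
    rw [Set.mem_ofPred_eq, ← e1, ← e2]
    refine le_trans (le_of_eq ?_) h3
    have i1 : Integrable (fun x => p.fst.fn x * fderiv ℝ ψ x v) μ :=
      (Lp.memLp _).integrable_mul (memLp_fderiv_apply ψ v μ)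
    have i2 : Integrable (fun x => ⟪p.fst.grad x, v⟫_ℝ * ψ x) μ :=
      ((Lp.memLp _).inner_const v).integrable_mul (memLp_smooth ψ μ)
    rw [← integral_add i1 i2, hp]
    congr 1
    refine integral_congr_ae ?_
    filter_upwards [coeFn_smoothH1_fn D φ, coeFn_smoothH1_grad D φ] with x hx1 hx2
    rw [hx1, hx2, inner_gradient]
    exact (fderiv_mul_testFunction (contDiff_testFunction φ) ψ x v).symm
  have h0 : |⟪a, u.fn⟫_ℝ + ⟪b, u.grad⟫_ℝ| ≤ C * ‖(0 : L2bdry D)‖ :=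
    (closure_minimal hsub hclosed) hu
  rw [norm_zero, mul_zero] at h0
  have h1 := abs_eq_zero.1 (le_antisymm h0 (abs_nonneg _))
  rw [e1, e2]
  linarith

lemma IsBoundedLipschitzDomain.mem_H10_of_trace_eq_zero {D : Opens (E d)}
    (hD : IsBoundedLipschitzDomain D) (hd : 0 < d) {u : H1 D}
    (hu : WithLp.toLp 2 (u, (0 : L2bdry D)) ∈ traceGraph D) : u ∈ H10 D :=
  hD.mem_H10_of_weakTest hd fun ψ => hD.weakTest_of_trace_eq_zero hd hu ψ

/-! ### Oscillating functions -/

lemma exists_integral_norm_le {α F : Type*} [MeasurableSpace α] [NormedAddCommGroup F]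
    (μ : Measure α) [IsFiniteMeasure μ] : ∃ A : ℝ, 0 ≤ A ∧ ∀ g : Lp F 2 μ, ∫ x, ‖g x‖ ∂μ ≤ A * ‖g‖ := by
  set S := μ Set.univ ^ (1 / (1 : ℝ≥0∞).toReal - 1 / (2 : ℝ≥0∞).toReal)
  have hS : S ≠ ∞ := ENNReal.rpow_ne_top_of_nonneg (by norm_num) (measure_ne_top _ _)
  refine ⟨S.toReal, ENNReal.toReal_nonneg, fun g => ?_⟩
  rw [integral_norm_eq_lintegral_enorm (Lp.aestronglyMeasurable g), ← eLpNorm_one_eq_lintegral_enorm,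
    mul_comm, Lp.norm_def, ← ENNReal.toReal_mul]
  exact ENNReal.toReal_mono (ENNReal.mul_ne_top (Lp.eLpNorm_ne_top g) hS)
    (eLpNorm_le_eLpNorm_mul_rpow_measure_univ (by norm_num) (Lp.aestronglyMeasurable g))

/-- The plane wave `x ↦ cos (2π⟨ξ, x⟩ + θ)`. -/
def wave (ξ : E d) (θ : ℝ) (x : E d) : ℝ := Real.cos (2 * Real.pi * ⟪ξ, x⟫_ℝ + θ)

lemma continuous_wave (ξ : E d) (θ : ℝ) : Continuous (wave ξ θ) := by unfold wave; fun_prop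

lemma contDiff_wave (ξ : E d) (θ : ℝ) : ContDiff ℝ (⊤ : ℕ∞) (wave ξ θ) := by
  unfold wave
  exact Real.contDiff_cos.comp ((contDiff_const.mul (contDiff_const.inner ℝ contDiff_id)).add
    contDiff_const)

lemma abs_wave_le (ξ : E d) (θ : ℝ) (x : E d) : |wave ξ θ x| ≤ 1 := Real.abs_cos_le_one _

/-- A phase shift by `-π/2` gives, up to the factor `2π⟪ξ, v⟫`, a primitive of the wave in the
direction `v`; it is again bounded by one. -/
lemma fderiv_wave (ξ : E d) (θ : ℝ) (x v : E d) : fderiv ℝ (wave ξ (θ - Real.pi / 2)) x v =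
    2 * Real.pi * ⟪ξ, v⟫_ℝ * wave ξ θ x := by
  have h1 : HasFDerivAt (fun x : E d => 2 * Real.pi * ⟪ξ, x⟫_ℝ + (θ - Real.pi / 2))
      ((2 * Real.pi) • innerSL ℝ ξ) x :=
    ((innerSL ℝ ξ).hasFDerivAt.const_mul (2 * Real.pi)).add_const _
  have h2 := h1.cos
  rw [show wave ξ (θ - Real.pi / 2) = fun x => Real.cos (2 * Real.pi * ⟪ξ, x⟫_ℝ +
    (θ - Real.pi / 2)) from rfl, h2.fderiv]
  have e : Real.sin (2 * Real.pi * ⟪ξ, x⟫_ℝ + (θ - Real.pi / 2)) = - wave ξ θ x := by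
    rw [← add_sub_assoc, Real.sin_sub_pi_div_two]; rfl
  rw [e]
  simp only [neg_neg, smul_apply, innerSL_apply_apply, smul_eq_mul]
  ring

/-- The axis `ν` may be orthogonal to `ξ`. Tilting it by `ε/2` towards `±ξ`, with the sign of `⟪ξ,
ν⟫`, stays in the cone and makes the wave oscillate along `v` at a rate comparable to `‖ξ‖`. -/
lemma IsConePatch.exists_direction {D : Opens (E d)} {x : E d} {ρ ε : ℝ} {ν : E d}
    (hp : IsConePatch D x ρ ε ν) (ξ : E d) :
    ∃ v ∈ Metric.ball ν ε, ε / 2 * ‖ξ‖ ≤ |⟪ξ, v⟫_ℝ| ∧ ‖v‖ ≤ 2 := by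
  have hε := hp.aperture_pos
  have hle := hp.aperture_lt
  by_cases hξ : ξ = 0
  · exact ⟨ν, Metric.mem_ball_self hε, by simp [hξ], by rw [hp.norm_axis]; norm_num⟩
  have hξ' : ‖ξ‖ ≠ 0 := norm_ne_zero_iff.2 hξ
  have hpos : 0 < ‖ξ‖ := norm_pos_iff.2 hξ
  have key : ∀ s : ℝ, |s| = 1 → ν + (s * (ε / 2) * ‖ξ‖⁻¹) • ξ ∈ Metric.ball ν ε ∧
      ⟪ξ, ν + (s * (ε / 2) * ‖ξ‖⁻¹) • ξ⟫_ℝ = ⟪ξ, ν⟫_ℝ + s * (ε / 2 * ‖ξ‖) ∧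
      ‖ν + (s * (ε / 2) * ‖ξ‖⁻¹) • ξ‖ ≤ 2 := by
    intro s hs
    have hn : ‖(s * (ε / 2) * ‖ξ‖⁻¹) • ξ‖ = ε / 2 := by
      rw [norm_smul, Real.norm_eq_abs, abs_mul, abs_mul, hs, abs_of_pos (by positivity : 0 < ε / 2),
        abs_of_pos (inv_pos.2 hpos), one_mul, mul_assoc, inv_mul_cancel₀ hξ', mul_one]
    refine ⟨?_, ?_, ?_⟩
    · rw [mem_ball_iff_norm, add_sub_cancel_left, hn]; linarith
    · rw [inner_add_right, inner_smul_right, real_inner_self_eq_norm_sq]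
      field_simp
    · refine (norm_add_le _ _).trans ?_
      rw [hn, hp.norm_axis]; linarith
  rcases le_total 0 ⟪ξ, ν⟫_ℝ with h | h
  · obtain ⟨h1, h2, h3⟩ := key 1 (by simp)
    refine ⟨_, h1, ?_, h3⟩
    rw [h2, one_mul, abs_of_nonneg (by positivity)]
    linarith
  · obtain ⟨h1, h2, h3⟩ := key (-1) (by simp)
    refine ⟨_, h1, ?_, h3⟩
    rw [h2, neg_one_mul, abs_of_nonpos (by nlinarith)]
    linarith

/-- One integration by parts along `v` gains the factor `⟪ξ, v⟫`. Since waves are bounded by one,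
the boundary term is dominated by `∫ |∂_v η|` through `abs_setIntegral_fderiv_le`, just like the
interior term; `‖v‖ ≤ 2` makes the total constant `4`. -/
lemma IsConePatch.wave_bound {D : Opens (E d)} {x : E d} {ρ ε : ℝ} {ν : E d}
    (hp : IsConePatch D x ρ ε ν) {η : Smooth d} (hη : tsupport η ⊆ Metric.ball x ρ) (ξ : E d)
    (θ : ℝ) : ε * ‖ξ‖ * |∫ y in (D : Set (E d)), wave ξ θ y * η y| ≤
      4 * ∫ y in (D : Set (E d)), ‖gradient η y‖ := by
  obtain ⟨v, hv, hξv, hv2⟩ := hp.exists_direction ξ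
  set η₁ := mulTest (wave ξ (θ - Real.pi / 2)) (contDiff_wave _ _) η
  have h1 := hp.abs_setIntegral_fderiv_le hv (η₁ := η₁) (η₂ := η)
    (tsupport_mul_subset_right.trans hη) hη (fun y => by
      rw [mulTest_apply, abs_mul]
      exact mul_le_of_le_one_left (abs_nonneg _) (abs_wave_le _ _ _))
  have hgi : Integrable (fun y => ‖gradient η y‖) (volume.restrict (D : Set (E d))) :=
    ((continuous_gradient_testFunction η).integrable_of_hasCompactSupport
      (hasCompactSupport_gradient η)).norm.integrableOn
  have hfi := (integrable_fderiv_apply η v).integrableOn (s := (D : Set (E d)))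
  have h2 : ∫ y in (D : Set (E d)), |fderiv ℝ η y v| ≤
      2 * ∫ y in (D : Set (E d)), ‖gradient η y‖ := by
    rw [← integral_const_mul]
    refine integral_mono hfi.abs (hgi.const_mul 2) fun y => ?_
    simp only
    rw [← inner_gradient]
    refine (abs_real_inner_le_norm _ _).trans ?_
    rw [mul_comm]
    exact mul_le_mul_of_nonneg_right hv2 (norm_nonneg _)
  have i1 : Integrable (fun y => wave ξ θ y * η y) (volume.restrict (D : Set (E d))) :=
    (((continuous_wave ξ θ).mul η.continuous).integrable_of_hasCompactSupport
      η.hasCompactSupport.mul_left).integrableOn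
  have i2 : Integrable (fun y => wave ξ (θ - Real.pi / 2) y * fderiv ℝ η y v)
      (volume.restrict (D : Set (E d))) :=
    (((continuous_wave ξ _).mul (continuous_fderiv_testFunction η v)).integrable_of_hasCompactSupport
      (η.hasCompactSupport.fderiv_apply (𝕜 := ℝ) v).mul_left).integrableOn
  have e : ∫ y in (D : Set (E d)), fderiv ℝ η₁ y v =
      2 * Real.pi * ⟪ξ, v⟫_ℝ * (∫ y in (D : Set (E d)), wave ξ θ y * η y) +
      ∫ y in (D : Set (E d)), wave ξ (θ - Real.pi / 2) y * fderiv ℝ η y v := by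
    rw [← integral_const_mul, ← integral_add (i1.const_mul _) i2]
    refine integral_congr_ae (.of_forall fun y => ?_)
    simp only
    rw [show ⇑η₁ = fun y => wave ξ (θ - Real.pi / 2) y * η y from rfl,
      fderiv_mul_testFunction (contDiff_wave _ _), fderiv_wave]
    ring
  have h3 : |∫ y in (D : Set (E d)), wave ξ (θ - Real.pi / 2) y * fderiv ℝ η y v| ≤
      ∫ y in (D : Set (E d)), |fderiv ℝ η y v| := by
    refine norm_integral_le_of_norm_le (f := fun y => wave ξ (θ - Real.pi / 2) y * fderiv ℝ η y v)
      hfi.abs (.of_forall fun y => ?_)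
    rw [Real.norm_eq_abs, abs_mul]
    exact mul_le_of_le_one_left (abs_nonneg _) (abs_wave_le _ _ _)
  set I := ∫ y in (D : Set (E d)), wave ξ θ y * η y
  have h4 : |2 * Real.pi * ⟪ξ, v⟫_ℝ * I| ≤ 4 * ∫ y in (D : Set (E d)), ‖gradient η y‖ := by
    have : 2 * Real.pi * ⟪ξ, v⟫_ℝ * I = (∫ y in (D : Set (E d)), fderiv ℝ η₁ y v) -
      ∫ y in (D : Set (E d)), wave ξ (θ - Real.pi / 2) y * fderiv ℝ η y v := by rw [e]; ring
    rw [this]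
    refine (abs_sub _ _).trans ?_
    linarith
  rw [abs_mul, abs_mul, abs_of_pos Real.two_pi_pos] at h4
  refine le_trans ?_ h4
  refine mul_le_mul_of_nonneg_right ?_ (abs_nonneg I)
  nlinarith [Real.pi_gt_three, abs_nonneg ⟪ξ, v⟫_ℝ]

lemma memLp_wave {D : Opens (E d)} (hD : Bornology.IsBounded (D : Set (E d))) (ξ : E d) (θ : ℝ) :
    MemLp (wave ξ θ) 2 (volume.restrict (D : Set (E d))) := by
  have : IsFiniteMeasure (volume.restrict (D : Set (E d))) :=
    ⟨by rw [Measure.restrict_apply_univ]; exact hD.measure_lt_top⟩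
  exact MemLp.of_bound (continuous_wave ξ θ).aestronglyMeasurable 1
    (.of_forall fun x => abs_wave_le ξ θ x)

/-- Plane waves are small in the dual of `H¹(D)`. -/
lemma IsBoundedLipschitzDomain.exists_wave_bound {D : Opens (E d)}
    (hD : IsBoundedLipschitzDomain D) (hd : 0 < d) :
    ∃ C : ℝ, 0 ≤ C ∧ ∀ (ξ : E d) (θ : ℝ) (w : H1 D),
      ‖ξ‖ * |⟪(memLp_wave hD.bounded ξ θ).toLp _, w.fn⟫_ℝ| ≤ C * ‖w‖ := by
  obtain ⟨ι, _, χ, x, ρ, ε, ν, hp, hs, h1⟩ := hD.exists_partition hd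
  have : IsFiniteMeasure (volume.restrict (D : Set (E d))) :=
    ⟨by rw [Measure.restrict_apply_univ]; exact hD.bounded.measure_lt_top⟩
  obtain ⟨A, hA0, hA⟩ := exists_integral_norm_le (F := E d) (volume.restrict (D : Set (E d)))
  choose M hM0 hM using fun i => norm_smooth_le (χ i)
  choose N hN0 hN using fun i => norm_gradient_smooth_le (χ i)
  obtain ⟨A', hA0', hA'⟩ := exists_integral_norm_le (F := ℝ) (volume.restrict (D : Set (E d)))
  refine ⟨∑ i, (ε i)⁻¹ * (4 * (M i * A + N i * A')), Finset.sum_nonneg fun i _ => ?_, ?_⟩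
  · have := (hp i).aperture_pos; have := hM0 i; have := hN0 i
    positivity
  intro ξ θ w
  set W : L2 D := (memLp_wave hD.bounded ξ θ).toLp _
  set C := ∑ i, (ε i)⁻¹ * (4 * (M i * A + N i * A'))
  -- By density of smooth functions in `H¹(D)`, the estimate reduces to smooth `w`, which a
  -- partition of unity splits into pieces supported in patches.
  have hclosed : IsClosed {w : H1 D | ‖ξ‖ * |⟪W, w.fn⟫_ℝ| ≤ C * ‖w‖} :=
    isClosed_le (continuous_const.mul (continuous_const.inner (H1.fnL D).continuous).abs)
      (continuous_const.mul continuous_norm)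
  refine (closure_minimal ?_ hclosed) (hD.mem_closure_smooth hd w)
  rintro _ ⟨φ, rfl⟩
  change ‖ξ‖ * |⟪W, (smoothH1 D φ).fn⟫_ℝ| ≤ C * ‖smoothH1 D φ‖
  set μ := volume.restrict (D : Set (E d))
  set η : ι → Smooth d := fun i => mulTest (χ i) (contDiff_testFunction (χ i)) φ
  have e : ⟪W, (smoothH1 D φ).fn⟫_ℝ = ∑ i, ∫ y in (D : Set (E d)), wave ξ θ y * η i y := by
    have hi : ∀ i, Integrable (fun y => wave ξ θ y * η i y) μ := fun i =>
      (((continuous_wave ξ θ).mul (η i).continuous).integrable_of_hasCompactSupport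
        (η i).hasCompactSupport.mul_left).integrableOn
    rw [← integral_finsetSum _ fun i _ => hi i, L2.inner_def]
    refine integral_congr_ae ?_
    filter_upwards [(memLp_wave hD.bounded ξ θ).coeFn_toLp, coeFn_smoothH1_fn D φ,
      ae_restrict_mem D.isOpen.measurableSet] with y hy1 hy2 hy
    rw [hy1, hy2, ← Finset.mul_sum]
    simp only [η, mulTest_apply]
    rw [← Finset.sum_mul, h1 y (subset_closure hy), one_mul]
    simp [mul_comm]
  have hgrad : ∀ i, ∫ y in (D : Set (E d)), ‖gradient (η i) y‖ ≤
      (M i * A + N i * A') * ‖smoothH1 D φ‖ := by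
    intro i
    have g1 : Integrable (fun y => ‖(smoothH1 D φ).grad y‖) μ :=
      ((Lp.memLp (smoothH1 D φ).grad).integrable (by norm_num)).norm
    have g2 : Integrable (fun y => ‖(smoothH1 D φ).fn y‖) μ :=
      ((Lp.memLp (smoothH1 D φ).fn).integrable (by norm_num)).norm
    have hle : ∫ y in (D : Set (E d)), ‖gradient (η i) y‖ ≤
        ∫ y, (M i * ‖(smoothH1 D φ).grad y‖ + N i * ‖(smoothH1 D φ).fn y‖) ∂μ := by
      refine integral_mono_ae ((continuous_gradient_testFunction _).integrable_of_hasCompactSupport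
        (hasCompactSupport_gradient _)).norm.integrableOn ((g1.const_mul _).add (g2.const_mul _)) ?_
      filter_upwards [coeFn_smoothH1_fn D φ, coeFn_smoothH1_grad D φ] with y hy1 hy2
      rw [hy1, hy2]
      have eg : gradient (η i) y = χ i y • gradient φ y + φ y • gradient (χ i) y := by
        refine ext_inner_right ℝ fun v => ?_
        rw [inner_gradient, inner_add_left, inner_smul_left, inner_smul_left, inner_gradient,
          inner_gradient]
        refine (fderiv_mul_testFunction (contDiff_testFunction (χ i)) φ y v).trans ?_
        simp only [conj_trivial]; ring
      rw [eg]
      refine (norm_add_le _ _).trans (add_le_add ?_ ?_)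
      · rw [norm_smul]
        exact mul_le_mul_of_nonneg_right (hM i y) (norm_nonneg _)
      · rw [norm_smul, mul_comm]
        exact mul_le_mul_of_nonneg_right (hN i y) (norm_nonneg _)
    rw [integral_add (g1.const_mul _) (g2.const_mul _), integral_const_mul, integral_const_mul] at hle
    refine hle.trans ?_
    have k1 := (hA (smoothH1 D φ).grad).trans
      (mul_le_mul_of_nonneg_left (H1.norm_grad_le (smoothH1 D φ)) hA0)
    have k2 := (hA' (smoothH1 D φ).fn).trans
      (mul_le_mul_of_nonneg_left (H1.norm_fn_le (smoothH1 D φ)) hA0')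
    have := mul_le_mul_of_nonneg_left k1 (hM0 i)
    have := mul_le_mul_of_nonneg_left k2 (hN0 i)
    linarith
  rw [e]
  refine (mul_le_mul_of_nonneg_left (Finset.abs_sum_le_sum_abs _ _) (norm_nonneg ξ)).trans ?_
  rw [Finset.mul_sum, Finset.sum_mul]
  refine Finset.sum_le_sum fun i _ => ?_
  have hw := (hp i).wave_bound (η := η i) ((tsupport_mul_subset_left.trans (hs i)).trans
    (Metric.ball_subset_ball (by linarith [(hp i).radius_pos]))) ξ θ
  rw [mul_assoc, mul_assoc, le_inv_mul_iff₀ (hp i).aperture_pos, ← mul_assoc]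
  refine hw.trans ?_
  exact mul_le_mul_of_nonneg_left (hgrad i) (by norm_num)


/-! ### The deterministic boundary value problem -/

@[simp] lemma testH1ₗ_fn {D : Opens (E d)} (φ : 𝓓(D, ℝ)) : (testH1ₗ D φ).fn = testL2 φ := rfl

lemma inner_grad_testH1 {D : Opens (E d)} (u : H1 D) (φ : 𝓓(D, ℝ)) :
    ⟪u.grad, (testH1ₗ D φ).grad⟫_ℝ = -⟪u.fn, testL2 (testLaplacian φ)⟫_ℝ := by
  set e : Fin d → E d := fun i => EuclideanSpace.single i (1 : ℝ)
  have h1 : ∀ i, ⟪u.fn, testL2 (∂_{e i} (∂_{e i} φ) : 𝓓(D, ℝ))⟫_ℝ =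
      -∫ x in (D : Set (E d)), ⟪u.grad x, e i⟫_ℝ * (∂_{e i} φ : 𝓓(D, ℝ)) x := fun i => by
    rw [← integral_eq_inner_testL2]
    exact u.isWeakGradient (∂_{e i} φ) (e i)
  have h2 : testL2 (testLaplacian φ) = ∑ i, testL2 (∂_{e i} (∂_{e i} φ) : 𝓓(D, ℝ)) :=
    map_sum (testL2ₗ D) _ _
  have hi : ∀ i, Integrable (fun x => ⟪u.grad x, e i⟫_ℝ * (∂_{e i} φ : 𝓓(D, ℝ)) x)
      (volume.restrict (D : Set (E d))) := fun i =>
    ((Lp.memLp _).inner_const (e i)).integrable_mul (memLp_testFunction _)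
  rw [h2, inner_sum, Finset.sum_congr rfl fun i _ => h1 i, Finset.sum_neg_distrib, neg_neg,
    ← integral_finsetSum _ fun i _ => hi i, L2.inner_def]
  refine integral_congr_ae ?_
  filter_upwards [coeFn_smoothH1_grad D (toSmooth φ)] with x hx
  change ⟪u.grad x, (smoothH1 D (toSmooth φ)).grad x⟫_ℝ = _
  rw [hx, ← (EuclideanSpace.basisFun (Fin d) ℝ).sum_inner_mul_inner]
  refine Finset.sum_congr rfl fun i _ => ?_
  rw [EuclideanSpace.basisFun_apply, real_inner_comm (gradient _ x), inner_gradient,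
    lineDerivOp_testFunction_apply]
  rfl

lemma isWeakLaplacian_iff {D : Opens (E d)} (u : H1 D) (f : L2 D) :
    IsWeakLaplacian D u.fn f ↔
      ∀ φ : 𝓓(D, ℝ), ⟪u.grad, (testH1ₗ D φ).grad⟫_ℝ + ⟪f, testL2 φ⟫_ℝ = 0 := by
  refine forall_congr' fun φ => ?_
  rw [integral_eq_inner_testL2, integral_eq_inner_testL2, inner_grad_testH1]
  constructor <;> intro h <;> linarith

lemma IsWeakLaplacian.unique {D : Opens (E d)} {u f f' : L2 D} (h : IsWeakLaplacian D u f)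
    (h' : IsWeakLaplacian D u f') : f = f' :=
  L2_ext_of_testFunction fun φ => (h φ).symm.trans (h' φ)

lemma isConormalDerivative_iff {D : Opens (E d)} (u : H1 D) (t : HnegHalf D) :
    IsConormalDerivative D u t ↔ ∃ f : L2 D, IsWeakLaplacian D u.fn f ∧
      ∀ w : TraceSpace D, t.functional ((traceKer D).mkQ w) =
        ⟪u.grad, w.fn.grad⟫_ℝ + ⟪f, w.fn.fn⟫_ℝ := by
  refine exists_congr fun f => and_congr_right fun _ => forall_congr' fun w => ?_
  rw [L2.inner_def, L2.inner_def, ← integral_add (L2.integrable_inner _ _) (L2.integrable_inner _ _)]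
  simp [mul_comm]

/-- `bdryFunctional` as a continuous linear map. -/
def bdryFunctionalL (D : Opens (E d)) : L2bdry D →L[ℝ] HnegHalf D :=
  (((ContinuousLinearMap.compL ℝ (HHalf D) (L2bdry D) ℝ).flip (HHalf.toL2 D)).comp
    (innerSL ℝ : L2bdry D →L[ℝ] L2bdry D →L[ℝ] ℝ) : L2bdry D →L[ℝ] StrongDual ℝ (HHalf D))

lemma functional_bdryFunctional {D : Opens (E d)} (g : L2bdry D) (w : TraceSpace D) :
    (bdryFunctional g).functional ((traceKer D).mkQ w) = ⟪g, TraceSpace.trace D w⟫_ℝ := rfl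

/-- The `H¹(D)` component, as a continuous linear map. -/
def TraceSpace.fnL (D : Opens (E d)) : TraceSpace D →L[ℝ] H1 D :=
  (WithLp.fstL 2 ℝ (H1 D) (L2bdry D)).comp (traceGraph D).subtypeL

@[simp] lemma TraceSpace.fnL_apply {D : Opens (E d)} (w : TraceSpace D) :
    TraceSpace.fnL D w = w.fn := rfl

lemma TraceSpace.norm_sq {D : Opens (E d)} (w : TraceSpace D) :
    ‖w‖ ^ 2 = ‖w.fn‖ ^ 2 + ‖TraceSpace.trace D w‖ ^ 2 :=
  WithLp.prod_norm_sq_eq_of_L2 w.1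

/-- The point of the graph of the trace with given components. -/
def TraceSpace.mk {D : Opens (E d)} (u : H1 D) (g : L2bdry D)
    (h : WithLp.toLp 2 (u, g) ∈ traceGraph D) : TraceSpace D := ⟨WithLp.toLp 2 (u, g), h⟩

@[simp] lemma TraceSpace.mk_fn {D : Opens (E d)} (u : H1 D) (g : L2bdry D)
    (h : WithLp.toLp 2 (u, g) ∈ traceGraph D) : (TraceSpace.mk u g h).fn = u := rfl

@[simp] lemma TraceSpace.trace_mk {D : Opens (E d)} (u : H1 D) (g : L2bdry D)
    (h : WithLp.toLp 2 (u, g) ∈ traceGraph D) : TraceSpace.trace D (TraceSpace.mk u g h) = g := rfl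

lemma testH1_mem_traceGraph {D : Opens (E d)} (φ : 𝓓(D, ℝ)) :
    WithLp.toLp 2 (testH1ₗ D φ, (0 : L2bdry D)) ∈ traceGraph D := by
  refine Submodule.le_topologicalClosure _ ⟨toSmooth φ, coeFn_smoothH1_fn D _, ?_⟩
  filter_upwards [Lp.coeFn_zero ℝ 2 (surfaceMeasure D),
    ae_restrict_mem isClosed_frontier.measurableSet] with x hx hx'
  refine hx.trans ?_
  have : x ∉ (D : Set (E d)) := fun h => by
    rw [D.isOpen.frontier_eq] at hx'
    exact hx'.2 h
  exact (image_eq_zero_of_notMem_tsupport fun h => this (φ.tsupport_subset h)).symm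

lemma H10.mem_traceGraph {D : Opens (E d)} {u : H1 D} (hu : u ∈ H10 D) :
    WithLp.toLp 2 (u, (0 : L2bdry D)) ∈ traceGraph D := by
  have hc : Continuous fun u : H1 D => WithLp.toLp 2 (u, (0 : L2bdry D)) :=
    (WithLp.prod_continuous_toLp 2 (H1 D) (L2bdry D)).comp (continuous_id.prodMk continuous_const)
  have hcl : IsClosed {u : H1 D | WithLp.toLp 2 (u, (0 : L2bdry D)) ∈ traceGraph D} :=
    (Submodule.isClosed_topologicalClosure (smoothTraceGraph D)).preimage hc
  refine closure_minimal ?_ hcl hu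
  rintro _ ⟨φ, rfl⟩
  exact testH1_mem_traceGraph φ

/-- Finiteness of the surface measure makes the boundary values of a smooth function square
integrable. -/
lemma IsBoundedLipschitzDomain.smoothH1_mem_traceGraph {D : Opens (E d)}
    (hD : IsBoundedLipschitzDomain D) (hd : 0 < d) (φ : Smooth d) :
    ∃ g : L2bdry D, WithLp.toLp 2 (smoothH1 D φ, g) ∈ traceGraph D := by
  have := hD.isFiniteMeasure hd
  exact ⟨(memLp_smooth φ (surfaceMeasure D)).toLp _, Submodule.le_topologicalClosure _
    ⟨φ, coeFn_smoothH1_fn D _, (memLp_smooth φ (surfaceMeasure D)).coeFn_toLp⟩⟩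

section LaxMilgram

variable {V T : Type*} [NormedAddCommGroup V] [InnerProductSpace ℝ V]
  [NormedAddCommGroup T] [InnerProductSpace ℝ T] {D : Opens (E d)}

/-- The energy form `∫ ∇v·∇w + lam v w + β ∫_∂ v w`. -/
def energy (lam β : ℝ) (ι : V →L[ℝ] H1 D) (τ : V →L[ℝ] T) : V →L[ℝ] V →L[ℝ] ℝ :=
  (innerSL ℝ : L2vec D →L[ℝ] L2vec D →L[ℝ] ℝ).bilinearComp ((H1.gradL D).comp ι) ((H1.gradL D).comp ι)
  + lam • (innerSL ℝ : L2 D →L[ℝ] L2 D →L[ℝ] ℝ).bilinearComp ((H1.fnL D).comp ι) ((H1.fnL D).comp ι)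
  + β • (innerSL ℝ : T →L[ℝ] T →L[ℝ] ℝ).bilinearComp τ τ

lemma energy_apply (lam β : ℝ) (ι : V →L[ℝ] H1 D) (τ : V →L[ℝ] T) (v w : V) :
    energy lam β ι τ v w = ⟪(ι v).grad, (ι w).grad⟫_ℝ + lam * ⟪(ι v).fn, (ι w).fn⟫_ℝ
      + β * ⟪τ v, τ w⟫_ℝ := rfl

/-- The norm hypothesis matches the three terms of the energy. One abstract form thus serves all
cases: `V = H10 D` or `V = H1 D` with `τ = 0`, and `V = TraceSpace D` with `τ` the trace for the
Robin condition. -/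
lemma isCoercive_energy {lam β : ℝ} (hlam : 0 < lam) (hβ : 0 < β) {ι : V →L[ℝ] H1 D}
    {τ : V →L[ℝ] T} (hn : ∀ v, ‖v‖ ^ 2 = ‖ι v‖ ^ 2 + ‖τ v‖ ^ 2) :
    IsCoercive (energy lam β ι τ) := by
  refine ⟨min 1 (min lam β), by positivity, fun v => ?_⟩
  rw [energy_apply, mul_assoc, ← sq, hn, H1.norm_sq, real_inner_self_eq_norm_sq,
    real_inner_self_eq_norm_sq, real_inner_self_eq_norm_sq]
  set m := min 1 (min lam β)
  have h1 : m ≤ 1 := min_le_left _ _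
  have h2 : m ≤ lam := (min_le_right _ _).trans (min_le_left _ _)
  have h3 : m ≤ β := (min_le_right _ _).trans (min_le_right _ _)
  have k1 := mul_le_mul_of_nonneg_right h1 (sq_nonneg ‖(ι v).grad‖)
  have k2 := mul_le_mul_of_nonneg_right h2 (sq_nonneg ‖(ι v).fn‖)
  have k3 := mul_le_mul_of_nonneg_right h3 (sq_nonneg ‖τ v‖)
  linarith

/-- Solvability of the variational problem, with the properties of the solution operator. -/
lemma exists_energy_solution [CompleteSpace V] {lam β : ℝ} (hlam : 0 < lam) (hβ : 0 < β) (ι : V →L[ℝ] H1 D)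
    (τ : V →L[ℝ] T) (hn : ∀ v, ‖v‖ ^ 2 = ‖ι v‖ ^ 2 + ‖τ v‖ ^ 2)
    (he : ∀ φ : 𝓓(D, ℝ), ∃ v, ι v = testH1ₗ D φ ∧ τ v = 0) :
    ∃ S : L2 D →L[ℝ] V,
      (∀ g w, energy lam β ι τ (S g) w = ⟪g, (ι w).fn⟫_ℝ) ∧
      (∀ v g, (∀ w, energy lam β ι τ v w = ⟪g, (ι w).fn⟫_ℝ) → v = S g) ∧
      (∀ g h, ⟪(ι (S g)).fn, h⟫_ℝ = ⟪g, (ι (S h)).fn⟫_ℝ) ∧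
      (∀ g, IsWeakLaplacian D (ι (S g)).fn (lam • (ι (S g)).fn - g)) ∧
      (∀ φ : 𝓓(D, ℝ), ι (S (testL2 (-testLaplacian φ + lam • φ))) = testH1ₗ D φ) := by
  have hc := isCoercive_energy hlam hβ hn
  set j : V →L[ℝ] L2 D := (H1.fnL D).comp ι
  -- The adjoint of `V → L²(D)` turns `g` into the Riesz representative of the right-hand side; the
  -- inverse of the operator of the form then solves the problem.
  set S : L2 D →L[ℝ] V := (hc.continuousLinearEquivOfBilin.symm : V →L[ℝ] V).comp
    (ContinuousLinearMap.adjoint j)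
  have h1 : ∀ g w, energy lam β ι τ (S g) w = ⟪g, (ι w).fn⟫_ℝ := fun g w => by
    rw [← hc.continuousLinearEquivOfBilin_apply]
    simp only [S, ContinuousLinearMap.comp_apply, ContinuousLinearEquiv.coe_coe,
      ContinuousLinearEquiv.apply_symm_apply, ContinuousLinearMap.adjoint_inner_left]
    rfl
  have h2 : ∀ v g, (∀ w, energy lam β ι τ v w = ⟪g, (ι w).fn⟫_ℝ) → v = S g := fun v g h => by
    have : ContinuousLinearMap.adjoint j g = hc.continuousLinearEquivOfBilin v :=
      hc.unique_continuousLinearEquivOfBilin fun w => by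
        rw [ContinuousLinearMap.adjoint_inner_left, h]; rfl
    simp [S, this]
  refine ⟨S, h1, h2, fun g h => ?_, fun g => ?_, fun φ => ?_⟩
  · rw [← h1 g (S h), real_inner_comm, ← h1 h (S g), energy_apply, energy_apply,
      real_inner_comm (ι (S g)).grad, real_inner_comm (ι (S g)).fn, real_inner_comm (τ (S g))]
  · rw [isWeakLaplacian_iff]
    intro φ
    obtain ⟨v, hv, hv'⟩ := he φ
    have := h1 g v
    rw [energy_apply, hv, hv', inner_zero_right, testH1ₗ_fn] at this
    rw [inner_sub_left, real_inner_smul_left]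
    linarith
  -- The lift of `φ` has no boundary contribution, hence it solves the variational problem with
  -- datum `-Δφ + lam φ` whatever the boundary condition.
  · obtain ⟨v, hv, hv'⟩ := he φ
    rw [← h2 v, hv]
    intro w
    have e : testL2 (-testLaplacian φ + lam • φ) = -testL2 (testLaplacian φ) + lam • testL2 φ := by
      change testL2ₗ D _ = -testL2ₗ D _ + lam • testL2ₗ D _
      rw [map_add, map_neg, map_smul]
    rw [energy_apply, hv, hv', inner_zero_left, e, inner_add_left, inner_neg_left,
      real_inner_smul_left, real_inner_comm, inner_grad_testH1, testH1ₗ_fn, real_inner_comm (ι w).fn,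
      real_inner_comm (ι w).fn]
    rw [real_inner_comm]
    ring

end LaxMilgram

/-- The homogeneous boundary condition for functions. -/
def HomogeneousBC (D : Opens (E d)) (β : ℝ) (u : H1 D) : BoundaryCondition → Prop
  | .dirichlet => IsTrace D u 0
  | .neumann => IsConormalDerivative D u 0
  | .robin => ∃ t, IsTrace D u t ∧ IsConormalDerivative D u (-(β • t))

/-- The range of `S` satisfies the boundary condition; in the Robin case, with boundary values
depending continuously on the data. -/
def BoundaryOperator (D : Opens (E d)) (β : ℝ) (S : L2 D →L[ℝ] H1 D) : BoundaryCondition → Prop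
  | .dirichlet => ∀ g, IsTrace D (S g) 0
  | .neumann => ∀ g, IsConormalDerivative D (S g) 0
  | .robin => ∃ B : L2 D →L[ℝ] HnegHalf D, ∀ g, IsTrace D (S g) (B g) ∧
      IsConormalDerivative D (S g) (-(β • B g))

/-- `S` is the solution operator of `-Δu + lam u = g` with homogeneous boundary condition. -/
structure IsSolutionOperator (D : Opens (E d)) (lam β : ℝ) (bc : BoundaryCondition)
    (S : L2 D →L[ℝ] H1 D) : Prop where
  symm : ∀ g h, ⟪(S g).fn, h⟫_ℝ = ⟪g, (S h).fn⟫_ℝ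
  isWeakLaplacian : ∀ g, IsWeakLaplacian D (S g).fn (lam • (S g).fn - g)
  apply_test : ∀ φ : 𝓓(D, ℝ), S (testL2 (-testLaplacian φ + lam • φ)) = testH1ₗ D φ
  boundary : BoundaryOperator D β S bc
  unique : ∀ (u : H1 D) (f : L2 D), IsWeakLaplacian D u.fn f → HomogeneousBC D β u bc →
    u = S (lam • u.fn - f)

lemma bdryFunctional_zero (D : Opens (E d)) : bdryFunctional (0 : L2bdry D) = 0 :=
  map_zero (bdryFunctionalL D)

instance (D : Opens (E d)) : CompleteSpace (H10 D) :=
  (Submodule.isClosed_topologicalClosure (LinearMap.range (testH1ₗ D))).completeSpace_coe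

/-- The form is taken on `H10 D`, with `τ = 0` and a dummy coefficient `1`. Uniqueness rests on the
fact that a function with zero trace belongs to `H10 D`, where the distributional equation extends
to all competitors by density. -/
lemma IsBoundedLipschitzDomain.exists_isSolutionOperator_dirichlet {D : Opens (E d)}
    (hD : IsBoundedLipschitzDomain D) (hd : 0 < d) {lam : ℝ} (hlam : 0 < lam) (β : ℝ) :
    ∃ S, IsSolutionOperator D lam β .dirichlet S := by
  obtain ⟨S, h1, h2, h3, h4, h5⟩ := exists_energy_solution (β := 1) hlam one_pos (H10 D).subtypeL
    (0 : H10 D →L[ℝ] ℝ) (fun v => by simp) fun φ =>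
      ⟨⟨testH1ₗ D φ, Submodule.le_topologicalClosure _ ⟨φ, rfl⟩⟩, rfl, rfl⟩
  refine ⟨(H10 D).subtypeL.comp S, h3, h4, h5, fun g => ⟨0, H10.mem_traceGraph (S g).2,
    (bdryFunctional_zero D).symm⟩, fun u f hf ht => ?_⟩
  obtain ⟨g, hg, hg0⟩ := ht
  -- Testing the vanishing functional of `g` on the point `(u, g)` of the trace graph gives `‖g‖² =
  -- 0`.
  have h0 : g = 0 := by
    have := congrArg (fun t => HnegHalf.functional t ((traceKer D).mkQ (TraceSpace.mk u g hg))) hg0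
    simp only [functional_bdryFunctional, TraceSpace.trace_mk] at this
    exact inner_self_eq_zero.1 this.symm
  rw [h0] at hg
  have hu := hD.mem_H10_of_trace_eq_zero hd hg
  refine congrArg (H10 D).subtypeL (h2 ⟨u, hu⟩ (lam • u.fn - f) fun w => ?_)
  rw [energy_apply]
  have hcl : IsClosed {w : H1 D | ⟪u.grad, w.grad⟫_ℝ + ⟪f, w.fn⟫_ℝ = 0} :=
    isClosed_eq ((continuous_const.inner (H1.gradL D).continuous).add
      (continuous_const.inner (H1.fnL D).continuous)) continuous_const
  have hw : ⟪u.grad, w.1.grad⟫_ℝ + ⟪f, w.1.fn⟫_ℝ = 0 := by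
    refine closure_minimal ?_ hcl w.2
    rintro _ ⟨φ, rfl⟩
    exact (isWeakLaplacian_iff u f).1 hf φ
  rw [inner_sub_left, real_inner_smul_left]
  simp only [Submodule.subtypeL_apply, zero_apply, inner_zero_left]
  linarith

/-- The form is taken on all of `H1 D`, whereas the conormal derivative is only tested on functions
having a trace; density of smooth functions bridges the gap. -/
lemma IsBoundedLipschitzDomain.exists_isSolutionOperator_neumann {D : Opens (E d)}
    (hD : IsBoundedLipschitzDomain D) (hd : 0 < d) {lam : ℝ} (hlam : 0 < lam) (β : ℝ) :
    ∃ S, IsSolutionOperator D lam β .neumann S := by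
  obtain ⟨S, h1, h2, h3, h4, h5⟩ := exists_energy_solution (β := 1) hlam one_pos
    (ContinuousLinearMap.id ℝ (H1 D)) (0 : H1 D →L[ℝ] ℝ) (fun v => by simp) fun φ =>
      ⟨testH1ₗ D φ, rfl, rfl⟩
  refine ⟨S, h3, h4, h5, fun g => ?_, fun u f hf ht => ?_⟩
  · rw [isConormalDerivative_iff]
    refine ⟨_, h4 g, fun w => ?_⟩
    have := h1 g w.fn
    rw [energy_apply] at this
    simp only [ContinuousLinearMap.id_apply, zero_apply, inner_zero_left] at this ⊢
    rw [inner_sub_left, real_inner_smul_left]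
    change (0 : ℝ) = _
    linarith
  · obtain ⟨f', hf', h⟩ := (isConormalDerivative_iff u 0).1 ht
    obtain rfl := hf.unique hf'
    refine h2 u (lam • u.fn - f) fun w => ?_
    have hcl : IsClosed {w : H1 D | ⟪u.grad, w.grad⟫_ℝ + ⟪f, w.fn⟫_ℝ = 0} :=
      isClosed_eq ((continuous_const.inner (H1.gradL D).continuous).add
        (continuous_const.inner (H1.fnL D).continuous)) continuous_const
    have hw : ⟪u.grad, w.grad⟫_ℝ + ⟪f, w.fn⟫_ℝ = 0 := by
      refine closure_minimal ?_ hcl (hD.mem_closure_smooth hd w)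
      rintro _ ⟨φ, rfl⟩
      obtain ⟨g, hg⟩ := hD.smoothH1_mem_traceGraph hd φ
      exact (h (TraceSpace.mk _ g hg)).symm
    rw [energy_apply, inner_sub_left, real_inner_smul_left]
    simp only [ContinuousLinearMap.id_apply, zero_apply, inner_zero_left]
    linarith

/-- The energy space is the trace graph itself, the very space on which conormal derivatives are
tested, so the variational equation and the boundary condition match without a density argument. -/
lemma exists_isSolutionOperator_robin (D : Opens (E d)) {lam β : ℝ} (hlam : 0 < lam) (hβ : 0 < β) :
    ∃ S, IsSolutionOperator D lam β .robin S := by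
  obtain ⟨S, h1, h2, h3, h4, h5⟩ := exists_energy_solution hlam hβ (TraceSpace.fnL D)
    (TraceSpace.trace D) TraceSpace.norm_sq fun φ =>
      ⟨TraceSpace.mk (testH1ₗ D φ) 0 (testH1_mem_traceGraph φ), rfl, rfl⟩
  refine ⟨(TraceSpace.fnL D).comp S, h3, h4, h5,
    ⟨(bdryFunctionalL D).comp ((TraceSpace.trace D).comp S), fun g => ⟨⟨TraceSpace.trace D (S g),
      (S g).2, rfl⟩, ?_⟩⟩, fun u f hf ht => ?_⟩
  · rw [isConormalDerivative_iff]
    refine ⟨_, h4 g, fun w => ?_⟩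
    have := h1 g w
    rw [energy_apply] at this
    have e : HnegHalf.functional (-(β • bdryFunctional (TraceSpace.trace D (S g))))
        ((traceKer D).mkQ w) = -(β * ⟪TraceSpace.trace D (S g), TraceSpace.trace D w⟫_ℝ) := rfl
    refine e.trans ?_
    rw [inner_sub_left, real_inner_smul_left]
    simp only [ContinuousLinearMap.comp_apply, TraceSpace.fnL_apply] at this ⊢
    linarith
  · obtain ⟨t, ⟨g, hg, rfl⟩, ht⟩ := ht
    obtain ⟨f', hf', h⟩ := (isConormalDerivative_iff u _).1 ht
    obtain rfl := hf.unique hf'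
    refine congrArg (TraceSpace.fnL D) (h2 (TraceSpace.mk u g hg) (lam • u.fn - f) fun w => ?_)
    have e : HnegHalf.functional (-(β • bdryFunctional g))
        ((traceKer D).mkQ w) = -(β * ⟪g, TraceSpace.trace D w⟫_ℝ) := rfl
    have := h w
    rw [e] at this
    rw [energy_apply, inner_sub_left, real_inner_smul_left]
    simp only [TraceSpace.fnL_apply, TraceSpace.mk_fn, TraceSpace.trace_mk]
    linarith

lemma IsBoundedLipschitzDomain.exists_isSolutionOperator {D : Opens (E d)}
    (hD : IsBoundedLipschitzDomain D) (hd : 0 < d) {lam β : ℝ} (hlam : 0 < lam) (hβ : 0 < β)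
    (bc : BoundaryCondition) : ∃ S, IsSolutionOperator D lam β bc S := by
  cases bc
  · exact hD.exists_isSolutionOperator_dirichlet hd hlam β
  · exact hD.exists_isSolutionOperator_neumann hd hlam β
  · exact exists_isSolutionOperator_robin D hlam hβ

/-- Solutions with oscillating right-hand side are small. -/
lemma IsBoundedLipschitzDomain.exists_solution_wave_bound {D : Opens (E d)}
    (hD : IsBoundedLipschitzDomain D) (hd : 0 < d) {S : L2 D →L[ℝ] H1 D}
    (hS : ∀ g h, ⟪(S g).fn, h⟫_ℝ = ⟪g, (S h).fn⟫_ℝ) :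
    ∃ C : ℝ, ∀ (ξ : E d) (θ : ℝ),
      (1 + ‖ξ‖ ^ 2) * ‖(S ((memLp_wave hD.bounded ξ θ).toLp _)).fn‖ ^ 2 ≤ C := by
  obtain ⟨C, hC0, hC⟩ := hD.exists_wave_bound hd
  have : IsFiniteMeasure (volume.restrict (D : Set (E d))) :=
    ⟨by rw [Measure.restrict_apply_univ]; exact hD.bounded.measure_lt_top⟩
  set A := (volume.restrict (D : Set (E d))).real Set.univ ^ (2 : ℝ≥0∞).toReal⁻¹ * 1
  refine ⟨(‖S‖ * A) ^ 2 + (C * ‖S‖) ^ 2, fun ξ θ => ?_⟩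
  set c : L2 D := (memLp_wave hD.bounded ξ θ).toLp _
  have hc : ‖c‖ ≤ A := by
    refine Lp.norm_le_of_ae_bound zero_le_one ?_
    filter_upwards [(memLp_wave hD.bounded ξ θ).coeFn_toLp] with x hx
    rw [hx]
    exact abs_wave_le ξ θ x
  have h1 : ‖(S c).fn‖ ≤ ‖S‖ * A := (H1.norm_fn_le _).trans
    ((S.le_opNorm c).trans (mul_le_mul_of_nonneg_left hc (norm_nonneg _)))
  -- Duality: `‖S c‖² = ⟪c, S (S c)⟫` by symmetry; the wave bound for `w = S (S c)` and `‖w‖ ≤ ‖S‖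
  -- ‖S c‖` then allow division by `‖S c‖`.
  have h2 : ‖ξ‖ * ‖(S c).fn‖ ≤ C * ‖S‖ := by
    rcases (norm_nonneg (S c).fn).eq_or_lt with h0 | h0
    · rw [← h0, mul_zero]; positivity
    have e : ‖(S c).fn‖ ^ 2 = ⟪c, (S (S c).fn).fn⟫_ℝ := by
      rw [← hS, real_inner_self_eq_norm_sq]
    have := hC ξ θ (S (S c).fn)
    rw [← e, abs_of_nonneg (sq_nonneg _)] at this
    have h3 := mul_le_mul_of_nonneg_left (S.le_opNorm (S c).fn) hC0
    refine le_of_mul_le_mul_right ?_ h0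
    nlinarith
  have k1 := pow_le_pow_left₀ (norm_nonneg _) h1 2
  have k2 := pow_le_pow_left₀ (by positivity) h2 2
  rw [mul_pow] at k2
  linarith

/-! ### Negative Sobolev spaces -/

section Sobolev

open scoped FourierTransform

instance (D : Opens (E d)) (s : ℝ) : CompleteSpace (Htilde D s) :=
  (Submodule.isClosed_topologicalClosure (LinearMap.range (bessel D s))).completeSpace_coe

lemma norm_sq_toLp_schwartz (f : 𝓢(E d, ℂ)) : ‖f.toLp 2‖ ^ 2 = ∫ x, ‖f x‖ ^ 2 := by
  rw [← real_inner_self_eq_norm_sq, L2.inner_def]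
  refine integral_congr_ae ?_
  filter_upwards [f.coeFn_toLp 2 volume] with x hx
  rw [hx, real_inner_self_eq_norm_sq]

lemma hasTemperateGrowth_bessel (s : ℝ) :
    (fun ξ : E d => (1 + ‖ξ‖ ^ 2) ^ (s / 2)).HasTemperateGrowth :=
  Function.hasTemperateGrowth_one_add_norm_sq_rpow (E d) (s / 2)

lemma norm_sq_bessel {D : Opens (E d)} (s : ℝ) (φ : 𝓓(D, ℝ)) :
    ‖bessel D s φ‖ ^ 2 = ∫ ξ : E d, ((1 + ‖ξ‖ ^ 2) ^ (s / 2) * ‖𝓕 (toSchwartz φ) ξ‖) ^ 2 := by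
  have h : ‖bessel D s φ‖ = ‖(SchwartzMap.smulLeftCLM ℂ
      (fun ξ : E d => (1 + ‖ξ‖ ^ 2) ^ (s / 2)) (𝓕 (toSchwartz φ))).toLp 2‖ := by
    rw [bessel, LinearMap.coe_mk, AddHom.coe_mk, SchwartzMap.fourierMultiplierCLM_apply, ← SchwartzMap.norm_fourier_toL2_eq,
      FourierTransform.fourier_fourierInv_eq]
  rw [h, norm_sq_toLp_schwartz]
  refine integral_congr_ae (.of_forall fun ξ => ?_)
  simp only [SchwartzMap.smulLeftCLM_apply_apply (hasTemperateGrowth_bessel s), norm_smul]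
  rw [Real.norm_of_nonneg (by positivity)]

/-- Plancherel, with a weight at least one for `s ≥ 0`. This bound is what allows the inclusion of
test functions to extend from the `H^s` norm to `L²(D)`. -/
lemma norm_testL2_le {D : Opens (E d)} {s : ℝ} (hs : 0 ≤ s) (φ : 𝓓(D, ℝ)) :
    ‖testL2 φ‖ ≤ ‖bessel D s φ‖ := by
  refine abs_le_of_sq_le_sq' ?_ (norm_nonneg _) |>.2
  have h1 : ‖testL2 φ‖ ^ 2 = ∫ x, ‖toSchwartz φ x‖ ^ 2 := by
    rw [← real_inner_self_eq_norm_sq, ← integral_eq_inner_testL2]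
    have : ∫ x in (D : Set (E d)), testL2 φ x * φ x = ∫ x in (D : Set (E d)), φ x * φ x := by
      refine integral_congr_ae ?_
      filter_upwards [coeFn_testL2 φ] with x hx
      rw [hx]
    rw [this, setIntegral_mul_testFunction]
    refine integral_congr_ae (.of_forall fun x => ?_)
    change φ x * φ x = ‖((φ x : ℝ) : ℂ)‖ ^ 2
    rw [Complex.norm_real, Real.norm_eq_abs, sq_abs, sq]
  rw [h1, ← SchwartzMap.integral_norm_sq_fourier, norm_sq_bessel]
  have hi : ∀ f : 𝓢(E d, ℂ), Integrable fun x => ‖f x‖ ^ 2 := fun f =>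
    (memLp_two_iff_integrable_sq_norm (f.continuous.aestronglyMeasurable)).1 (f.memLp 2 volume)
  refine integral_mono (hi _) ?_ fun ξ => ?_
  · refine (hi (SchwartzMap.smulLeftCLM ℂ (fun ξ : E d => (1 + ‖ξ‖ ^ 2) ^ (s / 2))
      (𝓕 (toSchwartz φ)))).congr (.of_forall fun ξ => ?_)
    simp only [SchwartzMap.smulLeftCLM_apply_apply (hasTemperateGrowth_bessel s), norm_smul]
    rw [Real.norm_of_nonneg (by positivity)]
  · refine pow_le_pow_left₀ (norm_nonneg _) (le_mul_of_one_le_left (norm_nonneg _) ?_) 2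
    exact Real.one_le_rpow (by nlinarith [sq_nonneg ‖ξ‖]) (by linarith)

/-- `testEmbed` as a linear map. -/
def testEmbedₗ (D : Opens (E d)) (s : ℝ) : 𝓓(D, ℝ) →ₗ[ℝ] Htilde D s where
  toFun := testEmbed D s
  map_add' φ ψ := Subtype.ext (map_add (bessel D s) φ ψ)
  map_smul' c φ := Subtype.ext (map_smul (bessel D s) c φ)

lemma denseRange_testEmbed (D : Opens (E d)) (s : ℝ) : DenseRange (testEmbedₗ D s) := by
  intro x
  rw [closure_subtype, ← Set.range_comp]
  exact x.2

lemma norm_testEmbed {D : Opens (E d)} (s : ℝ) (φ : 𝓓(D, ℝ)) :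
    ‖testEmbed D s φ‖ = ‖bessel D s φ‖ := rfl

/-- The inclusion of `Htilde D s` in `L²(D)` for `0 ≤ s`. -/
def htildeToL2 (D : Opens (E d)) (s : ℝ) : Htilde D s →L[ℝ] L2 D :=
  (testL2ₗ D).extendOfNorm (testEmbedₗ D s)

lemma htildeToL2_testEmbed {D : Opens (E d)} {s : ℝ} (hs : 0 ≤ s) (φ : 𝓓(D, ℝ)) :
    htildeToL2 D s (testEmbed D s φ) = testL2 φ :=
  LinearMap.extendOfNorm_eq (f := testL2ₗ D) (denseRange_testEmbed D s)
    ⟨1, fun φ => (norm_testL2_le hs φ).trans_eq (one_mul _).symm⟩ φ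

/-- The inclusion of `L²(D)` in the dual of `Htilde D s`, followed by the Riesz isomorphism. -/
def l2ToHtilde (D : Opens (E d)) (s : ℝ) : L2 D →L[ℝ] Htilde D s :=
  ContinuousLinearMap.adjoint (htildeToL2 D s)

lemma inner_l2ToHtilde {D : Opens (E d)} {s : ℝ} (hs : 0 ≤ s) (h : L2 D) (φ : 𝓓(D, ℝ)) :
    ⟪l2ToHtilde D s h, testEmbed D s φ⟫_ℝ = ⟪h, testL2 φ⟫_ℝ := by
  rw [l2ToHtilde, ContinuousLinearMap.adjoint_inner_left, htildeToL2_testEmbed hs]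

/-- The square of the modulus of the Fourier transform of `h ∈ L²(D)` at `ξ`. -/
def fourierSq {D : Opens (E d)} (h : L2 D) (ξ : E d) : ℝ :=
  (∫ x in (D : Set (E d)), wave ξ 0 x * h x) ^ 2 +
    (∫ x in (D : Set (E d)), wave ξ (-(Real.pi / 2)) x * h x) ^ 2

lemma IsBoundedLipschitzDomain.integrable_L2 {D : Opens (E d)} (hD : IsBoundedLipschitzDomain D)
    (h : L2 D) : Integrable h (volume.restrict (D : Set (E d))) := by
  have : IsFiniteMeasure (volume.restrict (D : Set (E d))) :=
    ⟨by rw [Measure.restrict_apply_univ]; exact hD.bounded.measure_lt_top⟩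
  exact (Lp.memLp h).integrable (by norm_num)

lemma integrable_wave_mul {μ : Measure (E d)} {h : E d → ℝ} (hh : Integrable h μ) (ξ : E d)
    (θ : ℝ) : Integrable (fun x => wave ξ θ x * h x) μ :=
  hh.bdd_mul (c := 1) (continuous_wave ξ θ).aestronglyMeasurable
    (.of_forall fun x => abs_wave_le ξ θ x)

lemma IsBoundedLipschitzDomain.continuous_fourierSq {D : Opens (E d)}
    (hD : IsBoundedLipschitzDomain D) (h : L2 D) : Continuous (fourierSq h) := by
  have : ∀ θ, Continuous fun ξ => ∫ x in (D : Set (E d)), wave ξ θ x * h x := fun θ => by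
    refine continuous_of_dominated (bound := fun x => ‖h x‖) (fun ξ => ?_) (fun ξ => ?_)
      (hD.integrable_L2 h).norm ?_
    · exact (integrable_wave_mul (hD.integrable_L2 h) ξ θ).aestronglyMeasurable
    · refine .of_forall fun x => ?_
      rw [norm_mul]
      exact mul_le_of_le_one_left (norm_nonneg _) (abs_wave_le ξ θ x)
    · refine .of_forall fun x => Continuous.mul ?_ continuous_const
      unfold wave
      fun_prop
  exact ((this _).pow 2).add ((this _).pow 2)

lemma fourierChar_eq_wave (ξ x : E d) : ((Real.fourierChar ⟪ξ, x⟫_ℝ : Circle) : ℂ) =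
    (wave ξ 0 x : ℂ) + (wave ξ (-(Real.pi / 2)) x : ℂ) * Complex.I := by
  rw [Real.fourierChar_apply, Complex.exp_mul_I, wave, wave, ← sub_eq_add_neg,
    Real.cos_sub_pi_div_two, add_zero, Complex.ofReal_cos, Complex.ofReal_sin]

lemma IsBoundedLipschitzDomain.norm_sq_fourierIntegral {D : Opens (E d)}
    (hD : IsBoundedLipschitzDomain D) (h : L2 D) (ξ : E d) :
    ‖∫ x in (D : Set (E d)), ((Real.fourierChar ⟪ξ, x⟫_ℝ : Circle) : ℂ) * (h x : ℂ)‖ ^ 2 =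
      fourierSq h ξ := by
  have hi := integrable_wave_mul (hD.integrable_L2 h) ξ
  have e : ∫ x in (D : Set (E d)), ((Real.fourierChar ⟪ξ, x⟫_ℝ : Circle) : ℂ) * (h x : ℂ) =
      ((∫ x in (D : Set (E d)), wave ξ 0 x * h x : ℝ) : ℂ) +
        ((∫ x in (D : Set (E d)), wave ξ (-(Real.pi / 2)) x * h x : ℝ) : ℂ) * Complex.I := by
    rw [← integral_complex_ofReal, ← integral_complex_ofReal, ← integral_mul_const,
      ← integral_add (hi _).ofReal ((hi _).ofReal.mul_const _)]
    refine integral_congr_ae (.of_forall fun x => ?_)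
    simp only [fourierChar_eq_wave, Complex.ofReal_mul]
    ring
  rw [e, ← Complex.normSq_eq_norm_sq, Complex.normSq_add_mul_I, fourierSq]

/-- Fourier inversion for `φ` and Fubini; `h` is integrable because `D` is bounded. -/
lemma IsBoundedLipschitzDomain.inner_testL2_eq {D : Opens (E d)}
    (hD : IsBoundedLipschitzDomain D) (h : L2 D) (φ : 𝓓(D, ℝ)) :
    (⟪h, testL2 φ⟫_ℝ : ℂ) = ∫ ξ : E d,
      (∫ x in (D : Set (E d)), ((Real.fourierChar ⟪ξ, x⟫_ℝ : Circle) : ℂ) * (h x : ℂ)) *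
        𝓕 (toSchwartz φ) ξ := by
  set ψ := toSchwartz φ
  have e1 : ∀ x, (φ x : ℂ) = ∫ ξ, ((Real.fourierChar ⟪ξ, x⟫_ℝ : Circle) : ℂ) * 𝓕 ψ ξ := fun x => by
    have : ψ x = 𝓕⁻ (𝓕 ψ) x := by rw [FourierTransform.fourierInv_fourier_eq]
    refine this.trans ?_
    rw [SchwartzMap.fourierInv_coe, Real.fourierInv_eq]
    refine integral_congr_ae (.of_forall fun ξ => ?_)
    simp only [Circle.smul_def, smul_eq_mul]
  have hI : Integrable (fun p : E d × E d => ((Real.fourierChar ⟪p.2, p.1⟫_ℝ : Circle) : ℂ) *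
      ((h p.1 : ℂ) * 𝓕 ψ p.2)) ((volume.restrict (D : Set (E d))).prod volume) := by
    refine Integrable.bdd_mul (c := 1) ((hD.integrable_L2 h).ofReal.mul_prod (𝓕 ψ).integrable) ?_
      (.of_forall fun p => ?_)
    · refine Continuous.aestronglyMeasurable ?_
      simp only [Real.fourierChar_apply]
      fun_prop
    · rw [Circle.norm_coe]
  rw [← integral_eq_inner_testL2, ← integral_complex_ofReal]
  calc ∫ x in (D : Set (E d)), ((h x * φ x : ℝ) : ℂ)
      = ∫ x in (D : Set (E d)), ∫ ξ, ((Real.fourierChar ⟪ξ, x⟫_ℝ : Circle) : ℂ) *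
          ((h x : ℂ) * 𝓕 ψ ξ) := by
        refine integral_congr_ae (.of_forall fun x => ?_)
        simp only [Complex.ofReal_mul, e1 x, ← integral_const_mul]
        refine integral_congr_ae (.of_forall fun ξ => ?_)
        simp only []
        ring
    _ = ∫ ξ, ∫ x in (D : Set (E d)), ((Real.fourierChar ⟪ξ, x⟫_ℝ : Circle) : ℂ) *
          ((h x : ℂ) * 𝓕 ψ ξ) := integral_integral_swap hI
    _ = _ := by
        refine integral_congr_ae (.of_forall fun ξ => ?_)
        simp only [← integral_mul_const]
        refine integral_congr_ae (.of_forall fun x => ?_)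
        simp only []
        ring

/-- Cauchy–Schwarz in frequency, with the weight split as `(1+|ξ|²)^{-s/2} (1+|ξ|²)^{s/2}`, bounds
the functional on the dense set of test functions. An infinite right-hand side makes the inequality
trivial. -/
lemma IsBoundedLipschitzDomain.ofReal_norm_sq_l2ToHtilde_le {D : Opens (E d)}
    (hD : IsBoundedLipschitzDomain D) {s : ℝ} (hs : 0 ≤ s) (h : L2 D) :
    ENNReal.ofReal (‖l2ToHtilde D s h‖ ^ 2) ≤
      ∫⁻ ξ, ENNReal.ofReal ((1 + ‖ξ‖ ^ 2) ^ (-s) * fourierSq h ξ) := by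
  set R := ∫⁻ ξ, ENNReal.ofReal ((1 + ‖ξ‖ ^ 2) ^ (-s) * fourierSq h ξ)
  by_cases hR : R = ∞
  · rw [hR]; exact le_top
  have hi : ∀ ξ : E d, 0 < 1 + ‖ξ‖ ^ 2 := fun ξ => by positivity
  have key : ∀ φ : 𝓓(D, ℝ), ⟪h, testL2 φ⟫_ℝ ^ 2 ≤ R.toReal * ‖testEmbed D s φ‖ ^ 2 := by
    intro φ
    set G : E d → ℂ := fun ξ =>
      ∫ x in (D : Set (E d)), ((Real.fourierChar ⟪ξ, x⟫_ℝ : Circle) : ℂ) * (h x : ℂ)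
    have hG : ∀ ξ, ‖G ξ‖ ^ 2 = fourierSq h ξ := hD.norm_sq_fourierIntegral h
    have hGc : Continuous fun ξ => ‖G ξ‖ := by
      have := (hD.continuous_fourierSq h).sqrt
      refine this.congr fun ξ => ?_
      rw [← hG, Real.sqrt_sq (norm_nonneg _)]
    have hw : ∀ t : ℝ, Continuous fun ξ : E d => (1 + ‖ξ‖ ^ 2) ^ t := fun t =>
      (continuous_const.add (continuous_norm.pow 2)).rpow_const fun ξ => Or.inl (hi ξ).ne'
    set F1 : E d → ℝ≥0∞ := fun ξ => ENNReal.ofReal ((1 + ‖ξ‖ ^ 2) ^ (-s / 2) * ‖G ξ‖)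
    set F2 : E d → ℝ≥0∞ := fun ξ => ENNReal.ofReal ((1 + ‖ξ‖ ^ 2) ^ (s / 2) * ‖𝓕 (toSchwartz φ) ξ‖)
    have hF1 : ∫⁻ ξ, F1 ξ ^ (2 : ℝ) = R := by
      refine lintegral_congr fun ξ => ?_
      rw [ENNReal.rpow_two, ← ENNReal.ofReal_pow (by positivity), mul_pow, hG,
        ← Real.rpow_natCast, ← Real.rpow_mul (hi ξ).le]
      congr 3
      push_cast; ring
    have hInt : Integrable fun ξ : E d =>
        ((1 + ‖ξ‖ ^ 2) ^ (s / 2) * ‖𝓕 (toSchwartz φ) ξ‖) ^ 2 := by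
      set f := SchwartzMap.smulLeftCLM ℂ (fun ξ : E d => (1 + ‖ξ‖ ^ 2) ^ (s / 2))
        (𝓕 (toSchwartz φ))
      refine ((memLp_two_iff_integrable_sq_norm (f.continuous.aestronglyMeasurable)).1
        (f.memLp 2 volume)).congr (.of_forall fun ξ => ?_)
      simp only [f, SchwartzMap.smulLeftCLM_apply_apply (hasTemperateGrowth_bessel s), norm_smul]
      rw [Real.norm_of_nonneg (by positivity)]
    have hF2 : ∫⁻ ξ, F2 ξ ^ (2 : ℝ) = ENNReal.ofReal (‖testEmbed D s φ‖ ^ 2) := by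
      rw [norm_testEmbed, norm_sq_bessel,
        ofReal_integral_eq_lintegral_ofReal hInt (.of_forall fun ξ => sq_nonneg _)]
      refine lintegral_congr fun ξ => ?_
      rw [ENNReal.rpow_two, ← ENNReal.ofReal_pow (by positivity)]
    have h1 : ENNReal.ofReal |⟪h, testL2 φ⟫_ℝ| ≤ R ^ (1 / (2 : ℝ)) *
        ENNReal.ofReal (‖testEmbed D s φ‖ ^ 2) ^ (1 / (2 : ℝ)) := by
      rw [← hF1, ← hF2]
      refine le_trans ?_ (ENNReal.lintegral_mul_le_Lp_mul_Lq volume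
        (Real.holderConjugate_iff.2 ⟨by norm_num, by norm_num⟩)
        ((hw _).mul hGc).measurable.ennreal_ofReal.aemeasurable
        ((hw _).mul (𝓕 (toSchwartz φ)).continuous.norm).measurable.ennreal_ofReal.aemeasurable)
      have e : |⟪h, testL2 φ⟫_ℝ| = ‖∫ ξ, G ξ * 𝓕 (toSchwartz φ) ξ‖ := by
        rw [← hD.inner_testL2_eq h φ, Complex.norm_real, Real.norm_eq_abs]
      rw [e, ofReal_norm]
      refine (enorm_integral_le_lintegral_enorm _).trans_eq (lintegral_congr fun ξ => ?_)
      rw [Pi.mul_apply, ← ENNReal.ofReal_mul (by positivity), ← ofReal_norm, norm_mul]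
      congr 1
      have : (1 + ‖ξ‖ ^ 2) ^ (-s / 2) * (1 + ‖ξ‖ ^ 2) ^ (s / 2) = 1 := by
        rw [← Real.rpow_add (hi ξ), neg_div, neg_add_cancel, Real.rpow_zero]
      linear_combination (-(‖G ξ‖ * ‖𝓕 (toSchwartz φ) ξ‖)) * this
    have h2 := ENNReal.rpow_le_rpow h1 (z := 2) (by norm_num)
    rw [ENNReal.mul_rpow_of_nonneg _ _ (by norm_num), ← ENNReal.rpow_mul, ← ENNReal.rpow_mul,
      one_div, inv_mul_cancel₀ (by norm_num), ENNReal.rpow_one, ENNReal.rpow_one, ENNReal.rpow_two,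
      ← ENNReal.ofReal_pow (abs_nonneg _), sq_abs, ← ENNReal.ofReal_toReal hR,
      ← ENNReal.ofReal_mul ENNReal.toReal_nonneg] at h2
    exact (ENNReal.ofReal_le_ofReal_iff (by positivity)).1 h2
  have h3 : ∀ x : Htilde D s, ⟪l2ToHtilde D s h, x⟫_ℝ ^ 2 ≤ R.toReal * ‖x‖ ^ 2 := by
    have hcl : IsClosed {x : Htilde D s | ⟪l2ToHtilde D s h, x⟫_ℝ ^ 2 ≤ R.toReal * ‖x‖ ^ 2} :=
      isClosed_le ((continuous_const.inner continuous_id).pow 2)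
        (continuous_const.mul (continuous_norm.pow 2))
    intro x
    refine closure_minimal ?_ hcl (denseRange_testEmbed D s x)
    rintro _ ⟨φ, rfl⟩
    change ⟪l2ToHtilde D s h, testEmbed D s φ⟫_ℝ ^ 2 ≤ _
    rw [inner_l2ToHtilde hs]
    exact key φ
  refine ENNReal.ofReal_le_of_le_toReal ?_
  -- Evaluated at the representing vector itself, the bound reads `‖·‖⁴ ≤ R ‖·‖²`.
  have := h3 (l2ToHtilde D s h)
  rw [real_inner_self_eq_norm_sq] at this
  rcases (sq_nonneg ‖l2ToHtilde D s h‖).eq_or_lt with h0 | h0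
  · rw [← h0]; exact ENNReal.toReal_nonneg
  · refine le_of_mul_le_mul_right ?_ h0
    rwa [← sq]

/-- The solution operator is Hilbert–Schmidt from `L²(D)` to `H^{-r}(D)`. -/
lemma IsBoundedLipschitzDomain.exists_hilbertSchmidt_bound {D : Opens (E d)}
    (hD : IsBoundedLipschitzDomain D) (hd : 0 < d) {S : L2 D →L[ℝ] H1 D}
    (hS : ∀ g h, ⟪(S g).fn, h⟫_ℝ = ⟪g, (S h).fn⟫_ℝ) {r : ℝ} (hr0 : 0 ≤ r)
    (hr : (d : ℝ) / 2 - 1 < r) :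
    ∃ M : ℝ, ∀ (b : ℕ → L2 D), Orthonormal ℝ b → ∀ s : Finset ℕ,
      ∑ i ∈ s, ‖l2ToHtilde D r (S (b i)).fn‖ ^ 2 ≤ M := by
  obtain ⟨C, hC⟩ := hD.exists_solution_wave_bound hd hS
  have hi : ∀ ξ : E d, 0 < 1 + ‖ξ‖ ^ 2 := fun ξ => by positivity
  -- The exponent is `-(r + 1)`, one power coming from the decay of the solutions with oscillating
  -- data; integrability is exactly `2 (r + 1) > d`. The factor `2` counts the cosine and the sine.
  have hInt : Integrable fun ξ : E d => (1 + ‖ξ‖ ^ 2) ^ (-(2 * (r + 1)) / 2) * (2 * C) :=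
    (integrable_rpow_neg_one_add_norm_sq (by rw [finrank_euclideanSpace_fin]; linarith)).mul_const _
  refine ⟨(∫⁻ ξ : E d, ENNReal.ofReal ((1 + ‖ξ‖ ^ 2) ^ (-(2 * (r + 1)) / 2) * (2 * C))).toReal,
    fun b hb s => ?_⟩
  refine (ENNReal.ofReal_le_iff_le_toReal hInt.lintegral_lt_top.ne).1 ?_
  rw [ENNReal.ofReal_sum_of_nonneg fun i _ => sq_nonneg _]
  refine (Finset.sum_le_sum fun i _ => hD.ofReal_norm_sq_l2ToHtilde_le hr0 _).trans ?_
  have hw : ∀ t : ℝ, Continuous fun ξ : E d => (1 + ‖ξ‖ ^ 2) ^ t := fun t =>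
    (continuous_const.add (continuous_norm.pow 2)).rpow_const fun ξ => Or.inl (hi ξ).ne'
  have hm : ∀ i, Measurable fun ξ : E d =>
      ENNReal.ofReal ((1 + ‖ξ‖ ^ 2) ^ (-r) * fourierSq (S (b i)).fn ξ) := fun i =>
    ((hw _).mul (hD.continuous_fourierSq _)).measurable.ennreal_ofReal
  rw [← lintegral_finsetSum _ fun i _ => hm i]
  refine lintegral_mono fun ξ => ?_
  rw [← ENNReal.ofReal_sum_of_nonneg fun i _ => by unfold fourierSq; positivity]
  refine ENNReal.ofReal_le_ofReal ?_
  -- Symmetry moves `S` from `b i` to the wave; Bessel's inequality then bounds the sum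
  -- independently of the orthonormal family and of its number of terms.
  have hb' : ∀ θ, ∑ i ∈ s, (∫ x in (D : Set (E d)), wave ξ θ x * (S (b i)).fn x) ^ 2 ≤
      ‖(S ((memLp_wave hD.bounded ξ θ).toLp _)).fn‖ ^ 2 := fun θ => by
    set c : L2 D := (memLp_wave hD.bounded ξ θ).toLp _
    refine le_trans (le_of_eq ?_) (hb.sum_inner_products_le (S c).fn (s := s))
    refine Finset.sum_congr rfl fun i _ => ?_
    rw [Real.norm_eq_abs, sq_abs, ← hS, real_inner_comm, L2.inner_def]
    congr 1
    refine integral_congr_ae ?_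
    filter_upwards [(memLp_wave hD.bounded ξ θ).coeFn_toLp] with x hx
    rw [hx]
    simp [mul_comm]
  rw [← Finset.mul_sum]
  simp only [fourierSq, Finset.sum_add_distrib]
  have k1 := mul_le_mul_of_nonneg_left (hb' 0) (hi ξ).le
  have k2 := mul_le_mul_of_nonneg_left (hb' (-(Real.pi / 2))) (hi ξ).le
  have e : (1 + ‖ξ‖ ^ 2) ^ (-r) = (1 + ‖ξ‖ ^ 2) ^ (-(2 * (r + 1)) / 2) * (1 + ‖ξ‖ ^ 2) := by
    rw [← Real.rpow_add_one (hi ξ).ne']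
    congr 1; ring
  rw [e, mul_assoc]
  refine mul_le_mul_of_nonneg_left ?_ (by positivity)
  rw [mul_add]
  linarith [k1.trans (hC ξ 0), k2.trans (hC ξ (-(Real.pi / 2)))]

end Sobolev

/-! ### Gaussian subspaces -/

section GaussianSubspace

variable {α : Type*} [MeasurableSpace α] {μ : Measure α}

/-- A subspace of `L²(μ)` that consists of centred Gaussian random variables. -/
def IsGaussianSubspace (G : Submodule ℝ (Lp ℝ 2 μ)) : Prop :=
  ∀ f ∈ G, ∫ x, Complex.exp (Complex.I * f x) ∂μ = Complex.exp (-(‖f‖ : ℂ) ^ 2 / 2)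

lemma norm_exp_I_mul_sub_le (x y : ℝ) :
    ‖Complex.exp (Complex.I * x) - Complex.exp (Complex.I * y)‖ ≤ ‖x - y‖ := by
  have e : Complex.exp (Complex.I * x) - Complex.exp (Complex.I * y) =
      Complex.exp (Complex.I * y) * (Complex.exp (Complex.I * (x - y : ℝ)) - 1) := by
    rw [mul_sub, ← Complex.exp_add, mul_one]
    congr 2
    push_cast; ring
  rw [e, norm_mul, mul_comm Complex.I (y : ℂ), Complex.norm_exp_ofReal_mul_I, one_mul]
  exact Real.norm_exp_I_mul_ofReal_sub_one_le

lemma integral_exp_eq_of_hasGaussianLaw {f : Lp ℝ 2 μ} (hf : HasGaussianLaw f μ)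
    (h0 : ∫ x, f x ∂μ = 0) :
    ∫ x, Complex.exp (Complex.I * f x) ∂μ = Complex.exp (-(‖f‖ : ℂ) ^ 2 / 2) := by
  have hv : Var[f; μ] = ‖f‖ ^ 2 := by
    rw [variance_of_integral_eq_zero hf.aemeasurable h0, ← real_inner_self_eq_norm_sq,
      L2.inner_def]
    refine integral_congr_ae (.of_forall fun x => ?_)
    simp
  have hc := hf.charFun_map_eq (1 : ℝ)
  rw [charFun_apply_real, integral_map hf.aemeasurable (by fun_prop)] at hc
  have e1 : (fun x => ⟪(1 : ℝ), f x⟫_ℝ) = f := by ext x; simp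
  rw [e1] at hc
  have e2 : ∫ x, (f : α → ℝ) x ∂μ = 0 := h0
  rw [e2, hv] at hc
  refine (integral_congr_ae (.of_forall fun x => ?_)).trans (hc.trans ?_)
  · simp [mul_comm]
  · congr 1
    push_cast
    ring

variable [IsProbabilityMeasure μ]

lemma integrable_exp_I_mul {f : α → ℝ} (hf : AEStronglyMeasurable f μ) :
    Integrable (fun x => Complex.exp (Complex.I * f x)) μ := by
  have hc : Continuous fun y : ℝ => Complex.exp (Complex.I * y) := by fun_prop
  refine Integrable.of_bound (hc.comp_aestronglyMeasurable hf) 1 (.of_forall fun x => ?_)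
  rw [mul_comm, Complex.norm_exp_ofReal_mul_I]

/-- The map `x ↦ e^{ix}` is 1-Lipschitz, so the characteristic functional is continuous in `L¹`,
hence in `L²`. Gaussianity therefore survives `L²` limits. -/
lemma continuous_integral_exp (μ : Measure α) [IsProbabilityMeasure μ] :
    Continuous fun f : Lp ℝ 2 μ => ∫ x, Complex.exp (Complex.I * f x) ∂μ := by
  obtain ⟨A, hA0, hA⟩ := exists_integral_norm_le (F := ℝ) μ
  refine (LipschitzWith.of_dist_le_mul (K := ⟨A, hA0⟩) fun f g => ?_).continuous
  rw [dist_eq_norm, dist_eq_norm, ← integral_sub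
    (integrable_exp_I_mul (Lp.aestronglyMeasurable f))
    (integrable_exp_I_mul (Lp.aestronglyMeasurable g))]
  refine (norm_integral_le_integral_norm _).trans (le_trans ?_ (hA (f - g)))
  refine integral_mono_ae ((integrable_exp_I_mul (Lp.aestronglyMeasurable f)).sub
    (integrable_exp_I_mul (Lp.aestronglyMeasurable g))).norm
    ((Lp.memLp (f - g)).integrable (by norm_num)).norm ?_
  filter_upwards [Lp.coeFn_sub f g] with x hx
  rw [hx]
  exact norm_exp_I_mul_sub_le _ _

lemma IsGaussianSubspace.topologicalClosure {G : Submodule ℝ (Lp ℝ 2 μ)}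
    (hG : IsGaussianSubspace G) : IsGaussianSubspace G.topologicalClosure := by
  intro f hf
  refine closure_minimal (s := (G : Set (Lp ℝ 2 μ))) (t := {f : Lp ℝ 2 μ |
    ∫ x, Complex.exp (Complex.I * f x) ∂μ = Complex.exp (-(‖f‖ : ℂ) ^ 2 / 2)})
    (fun f hf => hG f hf) (isClosed_eq (continuous_integral_exp μ) ?_) hf
  fun_prop

variable {G : Submodule ℝ (Lp ℝ 2 μ)}

/-- The definition gives the characteristic function at one point only; since `G` contains every
multiple `t • f`, this determines it everywhere. -/
lemma IsGaussianSubspace.map_eq (hG : IsGaussianSubspace G) {f : Lp ℝ 2 μ} (hf : f ∈ G) :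
    μ.map f = gaussianReal 0 (‖f‖₊ ^ 2) := by
  have hm : AEMeasurable f μ := (Lp.stronglyMeasurable f).measurable.aemeasurable
  have : IsProbabilityMeasure (μ.map f) := Measure.isProbabilityMeasure_map hm
  refine Measure.ext_of_charFun (funext fun t => ?_)
  rw [charFun_gaussianReal, charFun_apply_real, integral_map hm (by fun_prop)]
  have h := hG (t • f) (G.smul_mem t hf)
  have e : ∫ x, Complex.exp (t * f x * Complex.I) ∂μ =
      ∫ x, Complex.exp (Complex.I * (t • f : Lp ℝ 2 μ) x) ∂μ := by
    refine integral_congr_ae ?_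
    filter_upwards [Lp.coeFn_smul t f] with x hx
    rw [hx, Pi.smul_apply, smul_eq_mul, mul_comm Complex.I]
    push_cast; rfl
  rw [e, h, norm_smul]
  congr 1
  have : ((‖t‖ : ℝ) : ℂ) ^ 2 = (t : ℂ) ^ 2 := by
    rw [← Complex.ofReal_pow, ← Complex.ofReal_pow, Real.norm_eq_abs, sq_abs]
  push_cast
  rw [mul_pow, this]
  simp
  ring

lemma IsGaussianSubspace.integral_eq_zero (hG : IsGaussianSubspace G) {f : Lp ℝ 2 μ} (hf : f ∈ G) :
    ∫ x, f x ∂μ = 0 := by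
  have h := integral_map (μ := μ) (φ := f) (f := fun y : ℝ => y)
    (Lp.stronglyMeasurable f).measurable.aemeasurable aestronglyMeasurable_id
  rw [← h, hG.map_eq hf, integral_id_gaussianReal]

lemma isGaussian_of_aeeq_mem {F : Type*} [NormedAddCommGroup F] [NormedSpace ℝ F]
    [MeasurableSpace F] [BorelSpace F] (hG : IsGaussianSubspace G) {X : α → F}
    (hX : AEMeasurable X μ) (h : ∀ L : StrongDual ℝ F, ∃ f ∈ G, (fun x => L (X x)) =ᵐ[μ] f) :
    HasGaussianLaw X μ := by
  refine ⟨isGaussian_of_map_eq_gaussianReal fun L => ?_⟩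
  obtain ⟨f, hf, hfX⟩ := h L
  refine ⟨0, ‖f‖₊ ^ 2, ?_⟩
  rw [← hG.map_eq hf, AEMeasurable.map_map_of_aemeasurable (by fun_prop) hX]
  exact Measure.map_congr hfX

/-- Linear combinations stay in `G`, so finite subfamilies are jointly Gaussian, and for these
orthogonality is independence. -/
lemma IsGaussianSubspace.iIndepFun (hG : IsGaussianSubspace G) {f : ℕ → Lp ℝ 2 μ}
    (hf : ∀ k, f k ∈ G) (ho : ∀ i j, i ≠ j → ⟪f i, f j⟫_ℝ = 0) :
    iIndepFun (fun k x => f k x) μ := by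
  rw [iIndepFun_iff_finset]
  intro s
  have hm : ∀ k, Measurable (f k) := fun k => (Lp.stronglyMeasurable (f k)).measurable
  have hl : HasGaussianLaw (fun x => ((s.restrict fun k x => f k x) · x)) μ := by
    refine isGaussian_of_aeeq_mem hG
      (measurable_pi_lambda _ fun k : s => hm (k : ℕ)).aemeasurable fun L => ?_
    refine ⟨∑ k : s, L (Pi.single k 1) • f k, G.sum_mem fun k _ => G.smul_mem _ (hf k), ?_⟩
    have h1 : ∀ᵐ x ∂μ, ∀ k : s, (L (Pi.single k 1) • f k : Lp ℝ 2 μ) x =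
        L (Pi.single k 1) * f k x := by
      rw [ae_all_iff]
      intro k
      filter_upwards [Lp.coeFn_smul (L (Pi.single k 1)) (f k)] with x hx
      exact hx
    filter_upwards [Lp.coeFn_finsetSum Finset.univ fun k : s => L (Pi.single k 1) • f k, h1]
      with x hx hx1
    rw [hx, Finset.sum_apply, Finset.sum_congr rfl fun k _ => hx1 k]
    have e : (fun i => (s.restrict fun k x => f k x) i x) =
        ∑ k : s, f k x • (Pi.single k 1 : s → ℝ) := by
      ext i
      simp [Finset.sum_apply, Pi.single_apply]
    rw [e, map_sum]
    exact Finset.sum_congr rfl fun k _ => by rw [map_smul, smul_eq_mul, mul_comm]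
  refine hl.iIndepFun_of_covariance_eq_zero fun i j hij => ?_
  have hc : ∀ k : s, MemLp ((s.restrict fun k x => f k x) k) 2 μ := fun k => Lp.memLp (f k)
  rw [covariance_eq_sub (hc i) (hc j)]
  have h1 : ∫ x, ((s.restrict fun k x => f k x) i * (s.restrict fun k x => f k x) j) x ∂μ =
      ⟪f i, f j⟫_ℝ := by
    rw [L2.inner_def]
    refine integral_congr_ae (.of_forall fun x => ?_)
    simp [mul_comm]
  rw [h1, ho i j fun h => hij (Subtype.ext h)]
  have h2 : ∫ x, (s.restrict fun k x => f k x) i x ∂μ = 0 := hG.integral_eq_zero (hf i)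
  rw [h2, zero_mul, sub_zero]

end GaussianSubspace

/-! ### The Wiener integral -/

/-- Equal Gram matrices give equal norms of linear combinations. With `W A` and the indicator of `A`
as the two families, this is the Itô isometry on simple functions. -/
lemma inner_linearCombination_eq {ι F F' : Type*} [NormedAddCommGroup F] [InnerProductSpace ℝ F]
    [NormedAddCommGroup F'] [InnerProductSpace ℝ F'] {v : ι → F} {w : ι → F'}
    (h : ∀ i j, ⟪v i, v j⟫_ℝ = ⟪w i, w j⟫_ℝ) (c : ι →₀ ℝ) :
    ‖Finsupp.linearCombination ℝ v c‖ = ‖Finsupp.linearCombination ℝ w c‖ := by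
  have : ‖Finsupp.linearCombination ℝ v c‖ ^ 2 = ‖Finsupp.linearCombination ℝ w c‖ ^ 2 := by
    rw [← real_inner_self_eq_norm_sq, ← real_inner_self_eq_norm_sq, Finsupp.linearCombination_apply,
      Finsupp.linearCombination_apply, Finsupp.sum, Finsupp.sum]
    simp only [sum_inner, inner_sum, real_inner_smul_left, real_inner_smul_right, h]
  exact (pow_left_inj₀ (norm_nonneg _) (norm_nonneg _) two_ne_zero).1 this

section WienerIntegral

variable {Ω : Type*} [MeasurableSpace Ω]

lemma BorelSubset.restrict_ne_top {D : Opens (E d)} (A : BorelSubset D)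
    (hb : Bornology.IsBounded (D : Set (E d))) : volume.restrict (D : Set (E d)) A.1 ≠ ∞ :=
  ((Measure.restrict_apply_le _ _).trans_lt
    ((measure_mono A.2.2).trans_lt hb.measure_lt_top)).ne

/-- The indicator function of a Borel subset of the bounded set `D`, in `L²(D)`. -/
def indicatorL2 {D : Opens (E d)} (hb : Bornology.IsBounded (D : Set (E d))) (A : BorelSubset D) :
    L2 D :=
  indicatorConstLp 2 A.2.1 (BorelSubset.restrict_ne_top A hb) (1 : ℝ)

lemma coeFn_indicatorL2 {D : Opens (E d)} (hb : Bornology.IsBounded (D : Set (E d)))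
    (A : BorelSubset D) :
    indicatorL2 hb A =ᵐ[volume.restrict (D : Set (E d))] A.1.indicator 1 :=
  indicatorConstLp_coeFn

lemma inner_indicatorL2 {D : Opens (E d)} (hb : Bornology.IsBounded (D : Set (E d)))
    (A B : BorelSubset D) :
    ⟪indicatorL2 hb A, indicatorL2 hb B⟫_ℝ = (volume (A.1 ∩ B.1)).toReal := by
  rw [indicatorL2, indicatorL2, L2.inner_indicatorConstLp_indicatorConstLp _ _
    (BorelSubset.restrict_ne_top A hb) (BorelSubset.restrict_ne_top B hb), measureReal_def,
    Measure.restrict_apply (A.2.1.inter B.2.1),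
    Set.inter_eq_left.2 (Set.inter_subset_left.trans A.2.2)]
  simp

lemma denseRange_indicatorL2 {D : Opens (E d)} (hb : Bornology.IsBounded (D : Set (E d))) :
    DenseRange (Finsupp.linearCombination ℝ (indicatorL2 hb)) := by
  set G := (LinearMap.range (Finsupp.linearCombination ℝ (indicatorL2 hb))).topologicalClosure
  intro f
  change f ∈ G
  refine Lp.induction (by norm_num) (fun f : L2 D => f ∈ G) (fun c s hs hμs => ?_)
    (fun f g hf hg _ h1 h2 => G.add_mem h1 h2) (Submodule.isClosed_topologicalClosure _) f
  refine Submodule.le_topologicalClosure _ ⟨Finsupp.single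
    ⟨s ∩ D, hs.inter D.isOpen.measurableSet, Set.inter_subset_right⟩ c, ?_⟩
  rw [Finsupp.linearCombination_single]
  refine Lp.ext ?_
  rw [Lp.simpleFunc.coe_indicatorConst]
  filter_upwards [Lp.coeFn_smul c (indicatorL2 hb
      ⟨s ∩ D, hs.inter D.isOpen.measurableSet, Set.inter_subset_right⟩),
    coeFn_indicatorL2 hb ⟨s ∩ D, hs.inter D.isOpen.measurableSet, Set.inter_subset_right⟩,
    indicatorConstLp_coeFn (p := 2) (hs := hs) (hμs := hμs.ne) (c := c),
    ae_restrict_mem D.isOpen.measurableSet] with x h1 h2 h3 h4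
  rw [h1, Pi.smul_apply, h2, h3]
  by_cases hx : x ∈ s
  · simp [hx, h4]
  · simp [hx]

/-- `I` is the Wiener integral of the white noise `W`. -/
structure IsWienerMap (D : Opens (E d)) (P : Measure Ω) (W : BorelSubset D → Ω → ℝ)
    (I : L2 D →ₗᵢ[ℝ] Lp ℝ 2 P) : Prop where
  isGaussianSubspace : IsGaussianSubspace (LinearMap.range I.toLinearMap)
  isWienerIntegral_iff : ∀ (φ : E d → ℝ) (hφ : MemLp φ 2 (volume.restrict (D : Set (E d))))
    (Y : Ω → ℝ), IsWienerIntegral D P W φ Y ↔ Y =ᵐ[P] I (hφ.toLp φ)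

/-- The covariance identity makes `1_A ↦ W A` isometric on simple functions, which are dense; `I` is
its extension. Its range consists of `L²` limits of centred Gaussian combinations. The approximation
clause of `IsWienerIntegral` determines `Y` almost surely, because `I` transports an approximation
of `φ` into one of `I φ` with the same error. -/
lemma IsWhiteNoise.exists_isWienerMap {D : Opens (E d)} {P : Measure Ω} [IsProbabilityMeasure P]
    {W : BorelSubset D → Ω → ℝ} (hW : IsWhiteNoise D P W)
    (hb : Bornology.IsBounded (D : Set (E d))) : ∃ I, IsWienerMap D P W I := by
  have hL : ∀ A, MemLp (W A) 2 P := fun A => (hW.gaussian.hasGaussianLaw_eval A).memLp_two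
  set w : BorelSubset D → Lp ℝ 2 P := fun A => (hL A).toLp _
  have hw : ∀ A B, ⟪w A, w B⟫_ℝ = ⟪indicatorL2 hb A, indicatorL2 hb B⟫_ℝ := fun A B => by
    rw [inner_indicatorL2, ← hW.covariance, L2.inner_def]
    refine integral_congr_ae ?_
    filter_upwards [(hL A).coeFn_toLp, (hL B).coeFn_toLp] with x h1 h2
    rw [h1, h2]
    simp [mul_comm]
  set e := Finsupp.linearCombination ℝ (indicatorL2 hb)
  set f := Finsupp.linearCombination ℝ w
  have hfe : ∀ c, ‖f c‖ = ‖e c‖ := inner_linearCombination_eq hw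
  have hd := denseRange_indicatorL2 hb
  have hI : ∀ c, f.extendOfNorm e (e c) = f c :=
    LinearMap.extendOfNorm_eq hd ⟨1, fun c => by rw [one_mul, hfe]⟩
  have hn : ∀ g, ‖f.extendOfNorm e g‖ = ‖g‖ := fun g =>
    hd.induction_on (p := fun g => ‖f.extendOfNorm e g‖ = ‖g‖) g
      (isClosed_eq (f.extendOfNorm e).continuous.norm continuous_norm)
      fun c => by rw [hI, hfe]
  set I : L2 D →ₗᵢ[ℝ] Lp ℝ 2 P := ⟨(f.extendOfNorm e).toLinearMap, hn⟩
  have hIe : ∀ c, I (e c) = f c := hI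
  have hIA : ∀ A, I (indicatorL2 hb A) = w A := fun A => by
    have := hIe (Finsupp.single A 1)
    simpa [e, f] using this
  refine ⟨I, ?_, fun φ hφ Y => ⟨fun h => ?_, fun h => ?_⟩⟩
  · have hf : IsGaussianSubspace (LinearMap.range f) := by
      rintro _ ⟨c, rfl⟩
      have hae : (f c : Ω → ℝ) =ᵐ[P] fun ω => ∑ A ∈ c.support, c A • W A ω := by
        have h1 : ∀ᵐ ω ∂P, ∀ A : c.support, (c A • w A : Lp ℝ 2 P) ω = c A * W A ω := by
          rw [ae_all_iff]
          intro A
          filter_upwards [Lp.coeFn_smul (c A) (w A), (hL A).coeFn_toLp] with ω h2 h3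
          rw [h2, Pi.smul_apply, h3, smul_eq_mul]
        have h2 : f c = ∑ A ∈ c.support, c A • w A := Finsupp.linearCombination_apply ℝ c
        filter_upwards [Lp.coeFn_finsetSum c.support fun A => c A • w A, h1] with ω h3 h4
        rw [h2, h3, Finset.sum_apply]
        exact Finset.sum_congr rfl fun A hA => h4 ⟨A, hA⟩
      have hg : HasGaussianLaw (f c) P :=
        ((hW.gaussian.smul c).hasGaussianLaw_fun_sum (I := c.support)).congr hae.symm
      have h0 : ∫ ω, f c ω ∂P = 0 := by
        have hi : ∀ A, Integrable (fun ω => c A • W A ω) P := fun A =>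
          ((hL A).integrable (by norm_num)).smul (c A)
        rw [integral_congr_ae hae, integral_finsetSum _ fun A _ => hi A]
        exact Finset.sum_eq_zero fun A _ => by rw [integral_smul, hW.mean_zero, smul_zero]
      exact integral_exp_eq_of_hasGaussianLaw hg h0
    have hsub : LinearMap.range I.toLinearMap ≤ (LinearMap.range f).topologicalClosure := by
      rintro _ ⟨g, rfl⟩
      refine hd.induction_on (p := fun g => I g ∈ (LinearMap.range f).topologicalClosure) g
        ((Submodule.isClosed_topologicalClosure _).preimage I.continuous) fun c => ?_
      rw [hIe]
      exact Submodule.le_topologicalClosure _ ⟨c, rfl⟩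
    exact fun g hg => hf.topologicalClosure g (hsub hg)
  · obtain ⟨hY, h⟩ := h
    suffices hY.toLp Y = I (hφ.toLp φ) by
      rw [← this]; exact hY.coeFn_toLp.symm
    refine eq_of_forall_dist_le fun ε hε => ?_
    obtain ⟨n, c, A, h1, h2⟩ := h (ENNReal.ofReal (ε / 2)) (by simpa using hε)
    set s : L2 D := ∑ i, c i • indicatorL2 hb (A i)
    set t : Lp ℝ 2 P := ∑ i, c i • w (A i)
    have hst : I s = t := by simp only [s, t, map_sum, map_smul, hIA]
    have k1 : dist (hφ.toLp φ) s ≤ ε / 2 := by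
      rw [dist_eq_norm, Lp.norm_def]
      refine ENNReal.toReal_le_of_le_ofReal (by linarith) (le_trans (le_of_eq ?_) h1.le)
      refine eLpNorm_congr_ae ?_
      have h3 : ∀ᵐ x ∂(volume.restrict (D : Set (E d))), ∀ i,
          (c i • indicatorL2 hb (A i) : L2 D) x = c i * (A i).1.indicator 1 x := by
        rw [ae_all_iff]
        intro i
        filter_upwards [Lp.coeFn_smul (c i) (indicatorL2 hb (A i)), coeFn_indicatorL2 hb (A i)]
          with x h3 h4
        rw [h3, Pi.smul_apply, h4, smul_eq_mul]
      filter_upwards [Lp.coeFn_sub (hφ.toLp φ) s, hφ.coeFn_toLp,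
        Lp.coeFn_finsetSum Finset.univ fun i => c i • indicatorL2 hb (A i), h3] with x e1 e2 e3 e4
      rw [e1, Pi.sub_apply, e2, e3, Finset.sum_apply, Finset.sum_congr rfl fun i _ => e4 i]
    have k2 : dist (hY.toLp Y) t ≤ ε / 2 := by
      rw [dist_eq_norm, Lp.norm_def]
      refine ENNReal.toReal_le_of_le_ofReal (by linarith) (le_trans (le_of_eq ?_) h2.le)
      refine eLpNorm_congr_ae ?_
      have h3 : ∀ᵐ ω ∂P, ∀ i, (c i • w (A i) : Lp ℝ 2 P) ω = c i * W (A i) ω := by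
        rw [ae_all_iff]
        intro i
        filter_upwards [Lp.coeFn_smul (c i) (w (A i)), (hL (A i)).coeFn_toLp] with ω h3 h4
        rw [h3, Pi.smul_apply, h4, smul_eq_mul]
      filter_upwards [Lp.coeFn_sub (hY.toLp Y) t, hY.coeFn_toLp,
        Lp.coeFn_finsetSum Finset.univ fun i => c i • w (A i), h3] with ω e1 e2 e3 e4
      rw [e1, Pi.sub_apply, e2, e3, Finset.sum_apply, Finset.sum_congr rfl fun i _ => e4 i]
    have k3 : dist t (I (hφ.toLp φ)) ≤ ε / 2 := by
      rw [← hst, I.dist_map, dist_comm]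
      exact k1
    linarith [dist_triangle (hY.toLp Y) t (I (hφ.toLp φ))]
  · have hY : MemLp Y 2 P := (memLp_congr_ae h).2 (Lp.memLp _)
    refine ⟨hY, fun ε hε => ?_⟩
    obtain ⟨c, hc⟩ := EMetric.mem_closure_iff.1 (hd (hφ.toLp φ)) ε hε
    obtain ⟨⟨c, rfl⟩, hc⟩ := hc
    set κ := c.support.equivFin.symm
    have s1 : e c = ∑ i, c (κ i) • indicatorL2 hb (κ i) := by
      rw [κ.sum_comp (fun A : c.support => c A • indicatorL2 hb A),
        Finset.sum_coe_sort c.support (fun A => c A • indicatorL2 hb A)]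
      exact Finsupp.linearCombination_apply ℝ c
    have s2 : f c = ∑ i, c (κ i) • w (κ i) := by
      rw [κ.sum_comp (fun A : c.support => c A • w A),
        Finset.sum_coe_sort c.support (fun A => c A • w A)]
      exact Finsupp.linearCombination_apply ℝ c
    refine ⟨c.support.card, fun i => c (κ i), fun i => κ i, ?_, ?_⟩
    · rw [Lp.edist_def] at hc
      refine lt_of_eq_of_lt (eLpNorm_congr_ae ?_) hc
      have h3 : ∀ᵐ x ∂(volume.restrict (D : Set (E d))), ∀ i,
          (c (κ i) • indicatorL2 hb (κ i) : L2 D) x = c (κ i) * (κ i).1.1.indicator 1 x := by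
        rw [ae_all_iff]
        intro i
        filter_upwards [Lp.coeFn_smul (c (κ i)) (indicatorL2 hb (κ i)), coeFn_indicatorL2 hb (κ i)]
          with x h3 h4
        rw [h3, Pi.smul_apply, h4, smul_eq_mul]
      filter_upwards [hφ.coeFn_toLp,
        Lp.coeFn_finsetSum Finset.univ fun i => c (κ i) • indicatorL2 hb (κ i), h3] with x e2 e3 e4
      rw [Pi.sub_apply, e2, s1, e3, Finset.sum_apply, Finset.sum_congr rfl fun i _ => e4 i]
    · have hc' : edist (I (hφ.toLp φ)) (f c) < ε := by
        rw [← hIe, I.edist_map]; exact hc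
      rw [Lp.edist_def] at hc'
      refine lt_of_eq_of_lt (eLpNorm_congr_ae ?_) hc'
      have h3 : ∀ᵐ ω ∂P, ∀ i, (c (κ i) • w (κ i) : Lp ℝ 2 P) ω = c (κ i) * W (κ i) ω := by
        rw [ae_all_iff]
        intro i
        filter_upwards [Lp.coeFn_smul (c (κ i)) (w (κ i)), (hL (κ i)).coeFn_toLp] with ω h3 h4
        rw [h3, Pi.smul_apply, h4, smul_eq_mul]
      filter_upwards [h, Lp.coeFn_finsetSum Finset.univ fun i => c (κ i) • w (κ i), h3]
        with ω e2 e3 e4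
      rw [Pi.sub_apply, e2, s2, e3, Finset.sum_apply, Finset.sum_congr rfl fun i _ => e4 i]

end WienerIntegral

/-! ### Gaussian random series in Hilbert spaces -/

/-- Along the subsequence the limit of `‖x n - y m‖²` is identified as `‖z - y m‖²`, which is small
for `y m` close to `z`; then the whole sequence eventually stays near `y m`. This reduces
vector-valued convergence to countably many scalar submartingales. -/
lemma tendsto_of_tendsto_norm_sub_sq {H : Type*} [NormedAddCommGroup H] {x y : ℕ → H} {z : H}
    (hy : DenseRange y) (h : ∀ m, ∃ c, Tendsto (fun n => ‖x n - y m‖ ^ 2) atTop (𝓝 c))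
    {ns : ℕ → ℕ} (hns : StrictMono ns) (hz : Tendsto (fun i => x (ns i)) atTop (𝓝 z)) :
    Tendsto x atTop (𝓝 z) := by
  rw [Metric.tendsto_nhds]
  intro ε hε
  obtain ⟨m, hm⟩ := hy.exists_dist_lt z (half_pos hε)
  obtain ⟨c, hc⟩ := h m
  have h1 := hc.comp hns.tendsto_atTop
  have h2 : Tendsto (fun i => ‖x (ns i) - y m‖ ^ 2) atTop (𝓝 (‖z - y m‖ ^ 2)) :=
    ((hz.sub_const (y m)).norm).pow 2
  have h3 : c = ‖z - y m‖ ^ 2 := tendsto_nhds_unique h1 h2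
  rw [dist_eq_norm] at hm
  have h4 : c < (ε / 2) ^ 2 := by
    rw [h3]; exact pow_lt_pow_left₀ hm (norm_nonneg _) two_ne_zero
  filter_upwards [hc.eventually_lt_const h4] with n hn
  have h5 : ‖x n - y m‖ < ε / 2 := lt_of_pow_lt_pow_left₀ 2 (by linarith) hn
  calc dist (x n) z ≤ dist (x n) (y m) + dist (y m) z := dist_triangle _ _ _
    _ < ε := by rw [dist_eq_norm, dist_comm, dist_eq_norm]; linarith

section RandomSeries

variable {Ω : Type*} [MeasurableSpace Ω] {P : Measure Ω} {L H : Type*}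
  [NormedAddCommGroup L] [InnerProductSpace ℝ L] [NormedAddCommGroup H] [InnerProductSpace ℝ H]

/-- The square-integrable random vector `ξ a`. -/
def randomSMul (P : Measure Ω) (a : H) : Lp ℝ 2 P →L[ℝ] Lp H 2 P :=
  (ContinuousLinearMap.toSpanSingleton ℝ a).compLpL 2 P

lemma coeFn_randomSMul (a : H) (ξ : Lp ℝ 2 P) :
    randomSMul P a ξ =ᵐ[P] fun ω => ξ ω • a := by
  filter_upwards [ContinuousLinearMap.coeFn_compLpL (ContinuousLinearMap.toSpanSingleton ℝ a) ξ]
    with ω h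
  rw [randomSMul, h, ContinuousLinearMap.toSpanSingleton_apply]

lemma coeFn_sum_randomSMul (a : ℕ → H) (ξ : ℕ → Lp ℝ 2 P) (s : Finset ℕ) :
    (∑ k ∈ s, randomSMul P (a k) (ξ k) : Lp H 2 P) =ᵐ[P] fun ω => ∑ k ∈ s, ξ k ω • a k := by
  have h : ∀ᵐ ω ∂P, ∀ k, randomSMul P (a k) (ξ k) ω = ξ k ω • a k :=
    ae_all_iff.2 fun k => coeFn_randomSMul (a k) (ξ k)
  filter_upwards [Lp.coeFn_finsetSum s fun k => randomSMul P (a k) (ξ k), h] with ω h1 h2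
  rw [h1, Finset.sum_apply]
  exact Finset.sum_congr rfl fun k _ => h2 k

lemma inner_randomSMul (a b : H) (ξ η : Lp ℝ 2 P) :
    ⟪randomSMul P a ξ, randomSMul P b η⟫_ℝ = ⟪a, b⟫_ℝ * ⟪ξ, η⟫_ℝ := by
  rw [L2.inner_def, L2.inner_def, ← integral_const_mul]
  refine integral_congr_ae ?_
  filter_upwards [coeFn_randomSMul a ξ, coeFn_randomSMul b η] with ω h1 h2
  rw [h1, h2, real_inner_smul_left, real_inner_smul_right]
  simp
  ring

lemma summable_randomSMul [CompleteSpace H] {a : ℕ → H} {ξ : ℕ → Lp ℝ 2 P} (hξ : Orthonormal ℝ ξ)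
    (ha : Summable fun k => ‖a k‖ ^ 2) : Summable fun k => randomSMul P (a k) (ξ k) := by
  have ho : OrthogonalFamily ℝ
      (fun k => Submodule.span ℝ {randomSMul P (a k) (ξ k)})
      (fun k => (Submodule.span ℝ {randomSMul P (a k) (ξ k)}).subtypeₗᵢ) := by
    refine OrthogonalFamily.of_pairwise fun i j hij => ?_
    rw [Function.onFun, Submodule.isOrtho_span]
    rintro _ rfl _ rfl
    rw [inner_randomSMul, hξ.2 hij, mul_zero]
  refine (ho.summable_iff_norm_sq_summable fun k =>
    ⟨randomSMul P (a k) (ξ k), Submodule.mem_span_singleton_self _⟩).2 (ha.congr fun k => ?_)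
  rw [Submodule.coe_norm, ← real_inner_self_eq_norm_sq (randomSMul P (a k) (ξ k)),
    inner_randomSMul, real_inner_self_eq_norm_sq, real_inner_self_eq_norm_sq, hξ.1 k]
  ring

/-- Almost sure convergence of square-summable Gaussian series in a Hilbert space. -/
lemma ae_tendsto_sum_smul [IsProbabilityMeasure P] [SecondCountableTopology H] {G : Submodule ℝ (Lp ℝ 2 P)}
    (hG : IsGaussianSubspace G) {a : ℕ → H} {ξ : ℕ → Lp ℝ 2 P} (hξ : Orthonormal ℝ ξ)
    (hξG : ∀ k, ξ k ∈ G) {Z : Lp H 2 P}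
    (hZ : Tendsto (fun n => ∑ k ∈ Finset.range n, randomSMul P (a k) (ξ k)) atTop (𝓝 Z)) :
    ∀ᵐ ω ∂P, Tendsto (fun n => ∑ k ∈ Finset.range n, ξ k ω • a k) atTop (𝓝 (Z ω)) := by
  have hind := hG.iIndepFun hξG fun i j hij => hξ.2 hij
  have hm : ∀ k, StronglyMeasurable (fun ω => ξ k ω) := fun k => Lp.stronglyMeasurable (ξ k)
  set ℱ := Filtration.natural (fun k ω => ξ k ω) hm
  -- The sum runs up to `ξ n` included, so `T n` is adapted at time `n` and the next increment
  -- involves the independent variable `ξ (n + 1)`.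
  set T : ℕ → Ω → H := fun n ω => ∑ k ∈ Finset.range (n + 1), ξ k ω • a k
  set U : ℕ → Lp H 2 P := fun n => ∑ k ∈ Finset.range (n + 1), randomSMul P (a k) (ξ k)
  have hUT : ∀ n, U n =ᵐ[P] T n := fun n => coeFn_sum_randomSMul a ξ _
  have hT : ∀ n, StronglyMeasurable[ℱ n] (T n) := fun n =>
    Finset.stronglyMeasurable_fun_sum _ fun k hk => ((Filtration.stronglyAdapted_natural hm k).mono
      (ℱ.mono (Nat.lt_succ_iff.1 (Finset.mem_range.1 hk)))).smul_const (a k)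
  have hT2 : ∀ n, MemLp (T n) 2 P := fun n => (memLp_congr_ae (hUT n)).1 (Lp.memLp _)
  have hZU : Tendsto U atTop (𝓝 Z) := hZ.comp (tendsto_add_atTop_nat 1)
  obtain ⟨C, hC⟩ := (Metric.isBounded_range_of_tendsto U hZU).exists_norm_le
  have hconv : ∀ y : H, ∀ᵐ ω ∂P, ∃ c, Tendsto (fun n => ‖T n ω - y‖ ^ 2) atTop (𝓝 c) := by
    intro y
    have hTy : ∀ n, MemLp (fun ω => T n ω - y) 2 P := fun n => (hT2 n).sub (memLp_const y)
    have hInt : ∀ n, Integrable (fun ω => ‖T n ω - y‖ ^ 2) P := fun n =>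
      (memLp_two_iff_integrable_sq_norm (hTy n).1).1 (hTy n)
    have hsub : Submartingale (fun n ω => ‖T n ω - y‖ ^ 2) ℱ P := by
      refine submartingale_of_setIntegral_le_succ (fun n => ?_) hInt fun n s hs => ?_
      · exact (((hT n).sub stronglyMeasurable_const).norm.pow 2)
      set Y : Ω → ℝ := fun ω => ⟪T n ω - y, a (n + 1)⟫_ℝ
      have hYm : StronglyMeasurable[ℱ n] Y :=
        ((hT n).sub stronglyMeasurable_const).inner stronglyMeasurable_const
      have hY2 : MemLp Y 2 P := (hTy n).inner_const _
      have hX2 : MemLp (fun ω => ξ (n + 1) ω) 2 P := Lp.memLp _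
      have e : ∀ ω, ‖T (n + 1) ω - y‖ ^ 2 = ‖T n ω - y‖ ^ 2 + 2 * (ξ (n + 1) ω * Y ω) +
          ‖a (n + 1)‖ ^ 2 * ξ (n + 1) ω ^ 2 := fun ω => by
        have : T (n + 1) ω - y = (T n ω - y) + ξ (n + 1) ω • a (n + 1) := by
          simp only [T]
          rw [Finset.sum_range_succ _ (n + 1)]
          abel
        rw [this, norm_add_sq_real, real_inner_smul_right, norm_smul, mul_pow, Real.norm_eq_abs,
          sq_abs]
        ring
      have i1 : Integrable (fun ω => 2 * (ξ (n + 1) ω * Y ω)) P :=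
        (hX2.integrable_mul hY2).const_mul 2
      have i2 : Integrable (fun ω => ‖a (n + 1)‖ ^ 2 * ξ (n + 1) ω ^ 2) P :=
        hX2.integrable_sq.const_mul _
      have hs' : MeasurableSet s := ℱ.le n s hs
      -- The cross term vanishes since `ξ (n + 1)` is centred and independent of the past; what
      -- remains of the increment is nonnegative.
      have h0 : ∫ ω in s, ξ (n + 1) ω * Y ω ∂P = 0 := by
        rw [← integral_indicator hs']
        have e1 : (s.indicator fun ω => ξ (n + 1) ω * Y ω) =
            fun ω => ξ (n + 1) ω * s.indicator Y ω := by
          ext ω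
          by_cases h : ω ∈ s <;> simp [h]
        have hI : StronglyMeasurable[ℱ n] (s.indicator Y) := hYm.indicator hs
        have hindep : IndepFun (fun ω => ξ (n + 1) ω) (s.indicator Y) P := by
          rw [IndepFun_iff_Indep]
          exact indep_of_indep_of_le_right
            (hind.indep_comap_natural_of_lt hm (Nat.lt_succ_self n)) hI.measurable.comap_le
        rw [e1, hindep.integral_fun_mul_eq_mul_integral hX2.1
          (hI.mono (ℱ.le n)).aestronglyMeasurable, hG.integral_eq_zero (hξG _), zero_mul]
      simp only [e]
      have i3 : Integrable (fun ω => ‖T n ω - y‖ ^ 2 + 2 * (ξ (n + 1) ω * Y ω)) P :=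
        (hInt n).add i1
      rw [integral_add i3.integrableOn i2.integrableOn,
        integral_add (hInt n).integrableOn i1.integrableOn, integral_const_mul, h0]
      have : 0 ≤ ∫ ω in s, ‖a (n + 1)‖ ^ 2 * ξ (n + 1) ω ^ 2 ∂P :=
        integral_nonneg fun ω => by positivity
      linarith
    refine hsub.exists_ae_tendsto_of_bdd (R := Real.toNNReal ((C + ‖y‖) ^ 2)) fun n => ?_
    have hn : ‖U n - Lp.const 2 P y‖ ≤ C + ‖y‖ := by
      refine (norm_sub_le _ _).trans (add_le_add (hC _ ⟨n, rfl⟩) ?_)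
      refine (Lp.norm_const_le _ _ _).trans ?_
      simp
    have h1 : eLpNorm (fun ω => ‖T n ω - y‖ ^ 2) 1 P = ENNReal.ofReal (∫ ω, ‖T n ω - y‖ ^ 2 ∂P) := by
      rw [eLpNorm_one_eq_lintegral_enorm, ofReal_integral_eq_lintegral_ofReal (hInt n)
        (.of_forall fun ω => sq_nonneg _)]
      refine lintegral_congr fun ω => ?_
      rw [Real.enorm_of_nonneg (sq_nonneg _)]
    have h2 : ∫ ω, ‖T n ω - y‖ ^ 2 ∂P = ‖U n - Lp.const 2 P y‖ ^ 2 := by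
      rw [← real_inner_self_eq_norm_sq, L2.inner_def]
      refine integral_congr_ae ?_
      filter_upwards [hUT n, Lp.coeFn_sub (U n) (Lp.const 2 P y), Lp.coeFn_const (p := 2) (μ := P) y]
        with ω k1 k2 k3
      rw [real_inner_self_eq_norm_sq, k2, Pi.sub_apply, k1, k3]
      rfl
    rw [h1, h2]
    exact ENNReal.ofReal_le_ofReal (pow_le_pow_left₀ (norm_nonneg _) hn 2)
  -- Convergence in `L²` supplies the almost surely convergent subsequence; the submartingales
  -- centred at a dense sequence do the rest.
  obtain ⟨ns, hns, hae⟩ := (tendstoInMeasure_of_tendsto_Lp hZU).exists_seq_tendsto_ae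
  filter_upwards [ae_all_iff.2 fun m => hconv (denseSeq H m), hae, ae_all_iff.2 hUT] with ω h1 h2 h3
  refine (tendsto_add_atTop_iff_nat 1).1 ?_
  refine tendsto_of_tendsto_norm_sub_sq (denseRange_denseSeq H) h1 hns ?_
  exact h2.congr fun i => h3 _

variable [CompleteSpace L] [CompleteSpace H]

/-- Pairing with `y` is continuous from `L²(P; H)` to `L²(P)` and maps the series to the expansion
of `A† y` in the basis `g`. The result no longer involves `g`. -/
lemma inner_compLp_eq {I : L →ₗᵢ[ℝ] Lp ℝ 2 P} (A : L →L[ℝ] H) (g : HilbertBasis ℕ ℝ L)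
    {Z : Lp H 2 P}
    (hZ : Tendsto (fun n => ∑ k ∈ Finset.range n, randomSMul P (A (g k)) (I (g k))) atTop (𝓝 Z))
    (y : H) : (fun ω => ⟪y, Z ω⟫_ℝ) =ᵐ[P] I (ContinuousLinearMap.adjoint A y) := by
  set Φ : Lp H 2 P →L[ℝ] Lp ℝ 2 P := (innerSL ℝ y).compLpL 2 P
  have h1 : ∀ k, Φ (randomSMul P (A (g k)) (I (g k))) =
      I (⟪g k, ContinuousLinearMap.adjoint A y⟫_ℝ • g k) := fun k => by
    rw [map_smul]
    refine Lp.ext ?_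
    filter_upwards [ContinuousLinearMap.coeFn_compLpL (innerSL ℝ y)
        (randomSMul P (A (g k)) (I (g k))), coeFn_randomSMul (A (g k)) (I (g k)),
      Lp.coeFn_smul ⟪g k, ContinuousLinearMap.adjoint A y⟫_ℝ (I (g k))] with ω k1 k2 k3
    rw [k1, k2, k3, Pi.smul_apply, innerSL_apply_apply, real_inner_smul_right,
      ContinuousLinearMap.adjoint_inner_right, smul_eq_mul, mul_comm, real_inner_comm]
  have h2 := (Φ.continuous.tendsto Z).comp hZ
  have h3 : Tendsto (fun n => ∑ k ∈ Finset.range n,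
      I (⟪g k, ContinuousLinearMap.adjoint A y⟫_ℝ • g k)) atTop
        (𝓝 (I (ContinuousLinearMap.adjoint A y))) := by
    have := ((g.hasSum_repr (ContinuousLinearMap.adjoint A y)).mapL
      I.toContinuousLinearMap).tendsto_sum_nat
    simpa [HilbertBasis.repr_apply_apply] using this
  have h4 : Φ Z = I (ContinuousLinearMap.adjoint A y) := by
    refine tendsto_nhds_unique h2 (h3.congr fun n => ?_)
    simp only [Function.comp_apply, map_sum Φ, h1]
  rw [← h4]
  filter_upwards [ContinuousLinearMap.coeFn_compLpL (innerSL ℝ y) Z] with ω k1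
  rw [k1, innerSL_apply_apply]

/-- The random vector with given Gaussian coordinates `I (A† y)`, for `A` Hilbert–Schmidt. -/
lemma exists_randomVector (I : L →ₗᵢ[ℝ] Lp ℝ 2 P) (A : L →L[ℝ] H) (g : HilbertBasis ℕ ℝ L)
    (hA : Summable fun k => ‖A (g k)‖ ^ 2) :
    ∃ Z : Lp H 2 P, ∀ y, (fun ω => ⟪y, Z ω⟫_ℝ) =ᵐ[P] I (ContinuousLinearMap.adjoint A y) :=
  ⟨_, inner_compLp_eq A g
    (summable_randomSMul (g.orthonormal.comp_linearIsometry I) hA).hasSum.tendsto_sum_nat⟩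

/-- The series for `g` has the same coordinates `I (A† y)` as `Z`, so its sum is `Z`. This is the
independence of measurable extensions from the basis. -/
lemma ae_tendsto_randomVector [IsProbabilityMeasure P] [SecondCountableTopology H] {I : L →ₗᵢ[ℝ] Lp ℝ 2 P}
    (hI : IsGaussianSubspace (LinearMap.range I.toLinearMap)) (A : L →L[ℝ] H)
    (g : HilbertBasis ℕ ℝ L) (hA : Summable fun k => ‖A (g k)‖ ^ 2) {Z : Lp H 2 P}
    (hZ : ∀ y, (fun ω => ⟪y, Z ω⟫_ℝ) =ᵐ[P] I (ContinuousLinearMap.adjoint A y)) :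
    ∀ᵐ ω ∂P, Tendsto (fun n => ∑ k ∈ Finset.range n, I (g k) ω • A (g k)) atTop (𝓝 (Z ω)) := by
  have ho : Orthonormal ℝ fun k => I (g k) := g.orthonormal.comp_linearIsometry I
  have hs := (summable_randomSMul (a := fun k => A (g k)) ho hA).hasSum.tendsto_sum_nat
  set Z' := ∑' k, randomSMul P (A (g k)) (I (g k))
  have h0 : (fun ω => Z ω - Z' ω) =ᵐ[P] 0 := by
    refine ae_eq_zero_of_forall_inner (𝕜 := ℝ) fun y => ?_
    filter_upwards [hZ y, inner_compLp_eq A g hs y] with ω h1 h2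
    rw [inner_sub_right, h1, h2]
    simp
  filter_upwards [ae_tendsto_sum_smul hI ho (fun k => ⟨g k, rfl⟩) hs, h0] with ω h1 h2
  rwa [sub_eq_zero.1 h2]

end RandomSeries

/-! ### Separability and bases -/

instance : Fact ((2 : ℝ≥0∞) ≠ ∞) := ⟨by norm_num⟩

lemma HilbertBasis.secondCountableTopology {H : Type*} [NormedAddCommGroup H]
    [InnerProductSpace ℝ H] (b : HilbertBasis ℕ ℝ H) : SecondCountableTopology H := by
  have h : IsSeparable (Set.univ : Set H) := by
    have := ((Set.countable_range b).isSeparable.span (R := ℝ)).closure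
    rwa [← Submodule.topologicalClosure_coe, b.dense_span, Submodule.top_coe] at this
  have := isSeparable_univ_iff.1 h
  exact UniformSpace.secondCountable_of_separable H

instance : SecondCountableTopology Hsc :=
  HilbertBasis.secondCountableTopology (HilbertBasis.ofRepr (LinearIsometryEquiv.refl ℝ Hsc))

instance {H : Type*} [NormedAddCommGroup H] [InnerProductSpace ℝ H] [CompleteSpace H]
    [SecondCountableTopology H] : SecondCountableTopology (StrongDual ℝ H) :=
  (InnerProductSpace.toDual ℝ H).symm.toHomeomorph.secondCountableTopology

instance (D : Opens (E d)) : CompleteSpace (HnegHalf D) :=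
  inferInstanceAs (CompleteSpace (StrongDual ℝ (HHalf D)))

lemma Orthonormal.countable {H ι : Type*} [NormedAddCommGroup H] [InnerProductSpace ℝ H]
    [SeparableSpace H] {v : ι → H} (hv : Orthonormal ℝ v) : Countable ι := by
  rw [← Set.countable_univ_iff]
  refine Set.PairwiseDisjoint.countable_of_isOpen (s := fun i => Metric.ball (v i) (1 / 2))
    (fun i _ j _ hij => Metric.ball_disjoint_ball ?_) (fun i _ => Metric.isOpen_ball)
    (fun i _ => Metric.nonempty_ball.2 (by norm_num))
  have h : ‖v i - v j‖ ^ 2 = 2 := by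
    rw [norm_sub_sq_real, hv.1, hv.1, hv.2 hij]; norm_num
  rw [dist_eq_norm]
  nlinarith [norm_nonneg (v i - v j)]

lemma exists_hilbertBasis_nat {H : Type*} [NormedAddCommGroup H] [InnerProductSpace ℝ H]
    [CompleteSpace H] [SeparableSpace H] {v : ℕ → H} (hv : Orthonormal ℝ v) :
    Nonempty (HilbertBasis ℕ ℝ H) := by
  obtain ⟨w, b, hw, hb⟩ := hv.toSubtypeRange.exists_hilbertBasis_extension
  have hinf : Infinite w :=
    ((Set.infinite_range_of_injective hv.linearIndependent.injective).mono hw).to_subtype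
  have : Countable w := Orthonormal.countable b.orthonormal
  obtain ⟨e⟩ := nonempty_equiv_of_countable (α := ℕ) (β := w)
  refine ⟨HilbertBasis.mk (b.orthonormal.comp e e.injective) ?_⟩
  have : Set.range (⇑b ∘ e) = Set.range b := e.surjective.range_comp b
  rw [this, b.dense_span]

/-- `L²(D)` is infinite-dimensional because `D`, having positive volume, is infinite and contains
infinitely many disjoint nonempty open sets; their normalised indicators are orthonormal. -/
lemma IsBoundedLipschitzDomain.exists_hilbertBasis {D : Opens (E d)}
    (hD : IsBoundedLipschitzDomain D) (hd : 0 < d) : Nonempty (HilbertBasis ℕ ℝ (L2 D)) := by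
  have : Nonempty (Fin d) := ⟨⟨0, hd⟩⟩
  have : Infinite D := by
    rw [← not_finite_iff_infinite]
    intro h
    exact (D.isOpen.measure_pos volume hD.nonempty).ne'
      ((Set.toFinite (D : Set (E d))).measure_zero volume)
  obtain ⟨U, hU1, hU2, hU3⟩ := exists_seq_infinite_isOpen_pairwise_disjoint D
  have hopen : ∀ n, IsOpen ((↑) '' U n : Set (E d)) := fun n =>
    D.isOpen.isOpenMap_subtype_val _ (hU2 n)
  have hsub : ∀ n, ((↑) '' U n : Set (E d)) ⊆ D := fun n => by
    rintro _ ⟨x, -, rfl⟩; exact x.2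
  set A : ℕ → BorelSubset D := fun n => ⟨(↑) '' U n, (hopen n).measurableSet, hsub n⟩
  set v : ℕ → L2 D := fun n => indicatorL2 hD.bounded (A n)
  have hv0 : ∀ n, v n ≠ 0 := fun n h => by
    have h1 := inner_indicatorL2 hD.bounded (A n) (A n)
    rw [show indicatorL2 hD.bounded (A n) = 0 from h, inner_zero_left, Set.inter_self] at h1
    have h2 : 0 < volume (A n).1 := (hopen n).measure_pos volume ((hU1 n).nonempty.image _)
    have h3 : volume (A n).1 < ∞ := (measure_mono (hsub n)).trans_lt hD.bounded.measure_lt_top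
    exact (ENNReal.toReal_pos h2.ne' h3.ne).ne h1
  refine exists_hilbertBasis_nat (v := fun n => ‖v n‖⁻¹ • v n) ⟨fun n => ?_, fun m n hmn => ?_⟩
  · rw [norm_smul, norm_inv, norm_norm, inv_mul_cancel₀ (norm_ne_zero_iff.2 (hv0 n))]
  · have : (A m).1 ∩ (A n).1 = ∅ := by
      rw [← Set.disjoint_iff_inter_eq_empty]
      exact Set.disjoint_image_of_injective Subtype.val_injective (hU3 hmn)
    simp only [real_inner_smul_left, real_inner_smul_right, v, inner_indicatorL2, this]
    simp

/-! ### The space `H_sc` -/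

lemma norm_scEmbed_le {D : Opens (E d)} (f : HilbertBasis ℕ ℝ (HnegHalf D)) (u : HnegHalf D) :
    ‖scEmbed f u‖ ≤ ‖u‖ := by
  rw [← f.repr.norm_map u]
  refine lp.norm_mono (by norm_num) fun k => ?_
  change ‖((k : ℝ) + 1)⁻¹ * ⟪u, f k⟫_ℝ‖ ≤ ‖f.repr u k‖
  rw [HilbertBasis.repr_apply_apply, real_inner_comm, norm_mul]
  refine mul_le_of_le_one_left (norm_nonneg _) ?_
  rw [norm_inv, Real.norm_of_nonneg (by positivity)]
  exact inv_le_one_of_one_le₀ (by linarith [(Nat.cast_nonneg k : (0 : ℝ) ≤ k)])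

/-- `scEmbed` as a continuous linear map. -/
def scEmbedL {D : Opens (E d)} (f : HilbertBasis ℕ ℝ (HnegHalf D)) : HnegHalf D →L[ℝ] Hsc :=
  LinearMap.mkContinuous
    { toFun := scEmbed f
      map_add' := fun u v => by
        ext k
        change ((k : ℝ) + 1)⁻¹ * ⟪u + v, f k⟫_ℝ =
          ((k : ℝ) + 1)⁻¹ * ⟪u, f k⟫_ℝ + ((k : ℝ) + 1)⁻¹ * ⟪v, f k⟫_ℝ
        rw [inner_add_left, mul_add]
      map_smul' := fun c u => by
        ext k
        change ((k : ℝ) + 1)⁻¹ * ⟪c • u, f k⟫_ℝ = c * (((k : ℝ) + 1)⁻¹ * ⟪u, f k⟫_ℝ)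
        rw [real_inner_smul_left]; ring }
    1 fun u => by rw [one_mul]; exact norm_scEmbed_le f u

lemma scEmbed_eq_zero {D : Opens (E d)} {f : HilbertBasis ℕ ℝ (HnegHalf D)} {u : HnegHalf D}
    (h : scEmbed f u = 0) : u = 0 := by
  refine f.repr.injective ?_
  rw [map_zero]
  ext k
  have h1 : ((k : ℝ) + 1)⁻¹ * ⟪u, f k⟫_ℝ = 0 := congrArg (fun x : Hsc => x k) h
  rw [HilbertBasis.repr_apply_apply, real_inner_comm]
  exact (mul_eq_zero.1 h1).resolve_left (by positivity)

lemma summable_inv_succ_sq : Summable fun k : ℕ => (((k : ℝ) + 1) ^ 2)⁻¹ := by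
  have := (summable_nat_add_iff 1).2 (Real.summable_nat_pow_inv.2 one_lt_two)
  simpa using this

/-- The inclusion of `H^{-1/2}(∂D)` in `H_sc(∂D)` is Hilbert–Schmidt. -/
lemma summable_norm_sq_scEmbed {D : Opens (E d)} (f : HilbertBasis ℕ ℝ (HnegHalf D)) {L : Type*}
    [NormedAddCommGroup L] [InnerProductSpace ℝ L] [CompleteSpace L] (B : L →L[ℝ] HnegHalf D)
    {g : ℕ → L} (hg : Orthonormal ℝ g) : Summable fun k => ‖scEmbed f (B (g k))‖ ^ 2 := by
  set B' := ContinuousLinearMap.adjoint B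
  have hs : ∀ u : HnegHalf D, Summable fun j : ℕ => (((j : ℝ) + 1) ^ 2)⁻¹ * ⟪u, f j⟫_ℝ ^ 2 :=
    fun u => by
    refine Summable.of_nonneg_of_le (fun j => by positivity) (fun j => ?_)
      (summable_inv_succ_sq.mul_right (‖u‖ ^ 2))
    refine mul_le_mul_of_nonneg_left ?_ (by positivity)
    have := abs_real_inner_le_norm u (f j)
    rw [f.orthonormal.1 j, mul_one] at this
    rw [← sq_abs]
    exact pow_le_pow_left₀ (abs_nonneg _) this 2
  refine summable_of_sum_le (c := ∑' j : ℕ, (((j : ℝ) + 1) ^ 2)⁻¹ * ‖B'‖ ^ 2)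
    (fun k => sq_nonneg _) fun s => ?_
  simp only [norm_scEmbed]
  -- Exchanging the sums puts the basis `f` outside; for each `j`, Bessel's inequality applied to
  -- `B† (f j)` bounds the inner sum by `‖B†‖²`, and the weights are summable.
  rw [← Summable.tsum_finsetSum fun k _ => hs _]
  refine Summable.tsum_le_tsum (fun j => ?_) (summable_sum fun k _ => hs _)
    (summable_inv_succ_sq.mul_right _)
  rw [← Finset.mul_sum]
  refine mul_le_mul_of_nonneg_left ?_ (by positivity)
  have h1 := hg.sum_inner_products_le (B' (f j)) (s := s)
  have h2 : ‖B' (f j)‖ ^ 2 ≤ ‖B'‖ ^ 2 := by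
    have := B'.le_opNorm (f j)
    rw [f.orthonormal.1 j, mul_one] at this
    exact pow_le_pow_left₀ (norm_nonneg _) this 2
  refine le_trans (le_of_eq (Finset.sum_congr rfl fun k _ => ?_)) (h1.trans h2)
  rw [ContinuousLinearMap.adjoint_inner_right, Real.norm_eq_abs, sq_abs]

/-! ### Evaluations of a Gaussian random distribution -/

section Evaluation

variable {Ω : Type*} [MeasurableSpace Ω] {P : Measure Ω} {H : Type*}
  [NormedAddCommGroup H] [InnerProductSpace ℝ H]
  {X : Ω → StrongDual ℝ H}

/-- Evaluation at a point, as a functional on `H^{-r}(D)`. -/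
def evalDual (y : H) : StrongDual ℝ (StrongDual ℝ H) :=
  ContinuousLinearMap.apply ℝ ℝ y

lemma memLp_eval (hX : HasGaussianLaw X P) (y : H) : MemLp (fun ω => X ω y) 2 P :=
  (show HasGaussianLaw (fun ω => X ω y) P from hX.map_fun (evalDual y)).memLp_two

/-- `y ↦ X(y)`, from `H` to `L²(P)`. -/
def evalₗ (hX : HasGaussianLaw X P) : H →ₗ[ℝ] Lp ℝ 2 P where
  toFun y := (memLp_eval hX y).toLp _
  map_add' y z := by
    rw [← MemLp.toLp_add]
    congr 1
    ext ω
    simp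
  map_smul' c y := by
    rw [RingHom.id_apply, ← MemLp.toLp_const_smul]
    congr 1
    ext ω
    simp

lemma coeFn_evalₗ (hX : HasGaussianLaw X P) (y : H) :
    evalₗ hX y =ᵐ[P] fun ω => X ω y := (memLp_eval hX y).coeFn_toLp

lemma isGaussianSubspace_range_evalₗ (hX : HasGaussianLaw X P)
    (h0 : ∀ l : StrongDual ℝ (StrongDual ℝ H), ∫ ω, l (X ω) ∂P = 0) :
    IsGaussianSubspace (LinearMap.range (evalₗ hX)) := by
  rintro _ ⟨y, rfl⟩
  have hg : HasGaussianLaw (fun ω => X ω y) P := hX.map_fun (evalDual y)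
  refine integral_exp_eq_of_hasGaussianLaw (hg.congr (coeFn_evalₗ hX y).symm) ?_
  rw [integral_congr_ae (coeFn_evalₗ hX y)]
  exact h0 (evalDual y)

/-- Composition with `X`, from `L²` of the law of `X` to `L²(P)`. -/
def pullback (P : Measure Ω) (hX : Measurable X) : Lp ℝ 2 (P.map X) →ₗᵢ[ℝ] Lp ℝ 2 P :=
  Lp.compMeasurePreservingₗᵢ ℝ X (hX.measurePreserving P)

lemma coeFn_pullback (hX : Measurable X) (h : Lp ℝ 2 (P.map X)) :
    pullback P hX h =ᵐ[P] fun ω => h (X ω) :=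
  Lp.coeFn_compMeasurePreserving h (hX.measurePreserving P)

/-- The measurable linear functionals, as random variables. -/
def dualPullback (P : Measure Ω) (hX : Measurable X) : dualClosure (P.map X) →ₗᵢ[ℝ] Lp ℝ 2 P :=
  (pullback P hX).comp (dualClosure (P.map X)).subtypeₗᵢ

lemma coeFn_dualPullback (hX : Measurable X) (h : dualClosure (P.map X)) :
    dualPullback P hX h =ᵐ[P] fun ω => (h : Lp ℝ 2 (P.map X)) (X ω) := coeFn_pullback hX _

instance (μ : Measure (StrongDual ℝ H)) : CompleteSpace (dualClosure μ) :=
  (Submodule.isClosed_topologicalClosure _).completeSpace_coe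

lemma isClosed_range_dualPullback (hX : Measurable X) :
    IsClosed (LinearMap.range (dualPullback P hX).toLinearMap : Set (Lp ℝ 2 P)) :=
  (dualPullback P hX).isometry.isClosedEmbedding.isClosed_range

variable [CompleteSpace H]

/-- Reflexivity of a Hilbert space. Measurable linear functionals of `X` are therefore limits of the
evaluations `X(y)`. -/
lemma exists_eq_eval (L : StrongDual ℝ (StrongDual ℝ H)) : ∃ y : H, ∀ b : StrongDual ℝ H, L b = b y := by
  set J : H →L[ℝ] StrongDual ℝ H := (innerSL ℝ : H →L[ℝ] H →L[ℝ] ℝ)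
  refine ⟨(InnerProductSpace.toDual ℝ H).symm (L.comp J), fun b => ?_⟩
  obtain ⟨x, rfl⟩ := (InnerProductSpace.toDual ℝ H).surjective b
  rw [InnerProductSpace.toDual_apply_apply, real_inner_comm, InnerProductSpace.toDual_symm_apply]
  rfl

variable [SecondCountableTopology H]

lemma memLp_id_map (hG : HasGaussianLaw X P) : MemLp id 2 (P.map X) := by
  have := hG.isGaussian_map
  exact IsGaussian.memLp_id (P.map X) 2 (by norm_num)

lemma pullback_toLp (hX : Measurable X) (hG : HasGaussianLaw X P) (L : StrongDual ℝ (StrongDual ℝ H))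
    {y : H} (hy : ∀ b : StrongDual ℝ H, L b = b y) :
    pullback P hX (StrongDual.toLp (P.map X) 2 L) = evalₗ hG y := by
  rw [StrongDual.toLp_apply (memLp_id_map hG)]
  refine Lp.ext ?_
  filter_upwards [coeFn_pullback hX (MemLp.toLp L (L.comp_memLp' (memLp_id_map hG))),
    coeFn_evalₗ hG y,
    ae_of_ae_map hX.aemeasurable (MemLp.coeFn_toLp (L.comp_memLp' (memLp_id_map hG)))]
    with ω h1 h2 h3
  refine h1.trans ?_
  rw [h2, ← hy]
  exact h3

lemma pullback_mem_closure (hX : Measurable X) (hG : HasGaussianLaw X P)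
    (h : dualClosure (P.map X)) :
    pullback P hX (h : Lp ℝ 2 (P.map X)) ∈
      (LinearMap.range (evalₗ hG)).topologicalClosure := by
  refine closure_minimal (s := ((StrongDual.toLp (𝕜 := ℝ) (P.map X) 2).range : Set _))
    (t := {h : Lp ℝ 2 (P.map X) | pullback P hX h ∈ (LinearMap.range (evalₗ hG)).topologicalClosure}) ?_
    ((Submodule.isClosed_topologicalClosure _).preimage (pullback P hX).continuous) h.2
  rintro _ ⟨L, rfl⟩
  obtain ⟨y, hy⟩ := exists_eq_eval L
  exact Submodule.le_topologicalClosure _ ⟨y, (pullback_toLp hX hG L hy).symm⟩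

lemma evalₗ_mem_range (hX : Measurable X) (hG : HasGaussianLaw X P) (y : H) :
    evalₗ hG y ∈ LinearMap.range (dualPullback P hX).toLinearMap :=
  ⟨⟨StrongDual.toLp (P.map X) 2 (evalDual y), Submodule.le_topologicalClosure _ ⟨_, rfl⟩⟩,
    pullback_toLp hX hG _ fun _ => rfl⟩

/-- Evaluation commutes with the Bochner integral, so statements on Cameron–Martin vectors become
covariances in `L²(P)`. -/
lemma covOp_apply (hX : Measurable X) (hG : HasGaussianLaw X P) (h : dualClosure (P.map X))
    (y : H) : covOp (P.map X) h y = ⟪dualPullback P hX h, evalₗ hG y⟫_ℝ := by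
  have hi : Integrable (fun b => (h : Lp ℝ 2 (P.map X)) b • b) (P.map X) :=
    memLp_one_iff_integrable.1 ((memLp_id_map hG).smul (Lp.memLp (h : Lp ℝ 2 (P.map X))))
  rw [covOp, ContinuousLinearMap.integral_apply hi, integral_map hX.aemeasurable, L2.inner_def]
  · refine integral_congr_ae ?_
    filter_upwards [coeFn_dualPullback hX h, coeFn_evalₗ hG y] with ω h1 h2
    rw [h1, h2]
    simp [mul_comm]
  · exact (hi.aestronglyMeasurable.apply_continuousLinearMap y)

end Evaluation

/-! ### Existence -/

section RandomFunctional

variable {Ω : Type*} [MeasurableSpace Ω] {P : Measure Ω} {H L : Type*}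
  [NormedAddCommGroup H] [InnerProductSpace ℝ H]
  [NormedAddCommGroup L] [InnerProductSpace ℝ L] [CompleteSpace L]
  {I : L →ₗᵢ[ℝ] Lp ℝ 2 P} {X : Ω → StrongDual ℝ H}

lemma exists_randomFunctional [IsProbabilityMeasure P] [CompleteSpace H]
    (hI : IsGaussianSubspace (LinearMap.range I.toLinearMap))
    (A : L →L[ℝ] H) (g : HilbertBasis ℕ ℝ L) (hA : Summable fun k => ‖A (g k)‖ ^ 2) :
    ∃ X : Ω → StrongDual ℝ H, Measurable X ∧ HasGaussianLaw X P ∧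
      (∀ l : StrongDual ℝ (StrongDual ℝ H), ∫ ω, l (X ω) ∂P = 0) ∧
      ∀ y, (fun ω => X ω y) =ᵐ[P] I (ContinuousLinearMap.adjoint A y) := by
  obtain ⟨Z, hZ⟩ := exists_randomVector I A g hA
  set J : H →L[ℝ] StrongDual ℝ H := (innerSL ℝ : H →L[ℝ] H →L[ℝ] ℝ)
  have hJ : ∀ y : H, (fun ω => J (Z ω) y) =ᵐ[P] I (ContinuousLinearMap.adjoint A y) :=
    fun y => by
    filter_upwards [hZ y] with ω h
    rw [← h]
    exact real_inner_comm _ _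
  have hm : StronglyMeasurable fun ω => J (Z ω) :=
    J.continuous.comp_stronglyMeasurable (Lp.stronglyMeasurable Z)
  have hL : ∀ l : StrongDual ℝ (StrongDual ℝ H), ∃ f ∈ LinearMap.range I.toLinearMap,
      (fun ω => l (J (Z ω))) =ᵐ[P] f := fun l => by
    obtain ⟨y, hy⟩ := exists_eq_eval l
    simp only [hy]
    exact ⟨_, ⟨_, rfl⟩, hJ y⟩
  refine ⟨fun ω => J (Z ω), hm.measurable,
    isGaussian_of_aeeq_mem hI hm.measurable.aemeasurable hL, fun l => ?_, hJ⟩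
  obtain ⟨f, hf, h⟩ := hL l
  rw [integral_congr_ae h]
  exact hI.integral_eq_zero hf

/-- If `X(y) = I (A* y)` almost surely and `A*` has dense range, the measurable linear functionals
of `X` are the integrals `I g`. -/
lemma exists_dualClosure_equiv [CompleteSpace H] [SecondCountableTopology H] (hX : Measurable X)
    (hG : HasGaussianLaw X P) {A' : H →L[ℝ] L}
    (hA : DenseRange A') (h : ∀ y, (fun ω => X ω y) =ᵐ[P] I (A' y)) :
    ∃ U : dualClosure (P.map X) ≃ₗᵢ[ℝ] L, (∀ h, I (U h) = dualPullback P hX h) ∧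
      ∀ h y, covOp (P.map X) h y = ⟪U h, A' y⟫_ℝ := by
  have he : ∀ y, evalₗ hG y = I (A' y) := fun y => Lp.ext ((coeFn_evalₗ hG y).trans (h y))
  have hIc : IsClosed (LinearMap.range I.toLinearMap : Set (Lp ℝ 2 P)) :=
    I.isometry.isClosedEmbedding.isClosed_range
  have h1 : LinearMap.range (dualPullback P hX).toLinearMap ≤ LinearMap.range I.toLinearMap := by
    rintro _ ⟨b, rfl⟩
    refine Submodule.topologicalClosure_minimal (LinearMap.range (evalₗ hG)) ?_ hIc
      (pullback_mem_closure hX hG b)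
    rintro _ ⟨y, rfl⟩
    exact ⟨_, (he y).symm⟩
  have h2 : ∀ g, I g ∈ LinearMap.range (dualPullback P hX).toLinearMap := fun g => by
    refine hA.induction_on (p := fun g => I g ∈ LinearMap.range (dualPullback P hX).toLinearMap) g
      ((isClosed_range_dualPullback hX).preimage I.continuous) fun y => ?_
    rw [← he]
    exact evalₗ_mem_range hX hG y
  have h3 : LinearMap.range (dualPullback P hX).toLinearMap = LinearMap.range I.toLinearMap :=
    le_antisymm h1 (by rintro _ ⟨g, rfl⟩; exact h2 g)
  set U := ((dualPullback P hX).equivRange.trans (LinearIsometryEquiv.ofEq _ _ h3)).trans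
    I.equivRange.symm
  have hU : ∀ h, I (U h) = dualPullback P hX h := fun b =>
    congrArg Subtype.val (I.equivRange.apply_symm_apply
      (LinearIsometryEquiv.ofEq _ _ h3 ((dualPullback P hX).equivRange b)))
  refine ⟨U, hU, fun b y => ?_⟩
  rw [covOp_apply hX hG, ← hU, he, I.inner_map_map]

/-- `T` followed by the inclusion in `H_sc` is Hilbert–Schmidt, so it has a random vector `Z`
determined by its coordinates. Every basis `e` is carried by `U` to a basis of `L`, whose series
converges to the same `Z`. -/
lemma exists_tendsto_measurableExtension [IsProbabilityMeasure P] {D : Opens (E d)}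
    (f : HilbertBasis ℕ ℝ (HnegHalf D))
    (hI : IsGaussianSubspace (LinearMap.range I.toLinearMap)) (hX : Measurable X)
    (U : dualClosure (P.map X) ≃ₗᵢ[ℝ] L) (hU : ∀ h, I (U h) = dualPullback P hX h)
    (g : HilbertBasis ℕ ℝ L) (T : L →L[ℝ] HnegHalf D) :
    ∃ Z : Ω → Hsc, ∀ e : HilbertBasis ℕ ℝ (dualClosure (P.map X)), ∀ᵐ ω ∂P, Tendsto
      (fun n => ∑ k ∈ Finset.range n, ((e k : Lp ℝ 2 (P.map X)) (X ω)) • scEmbed f (T (U (e k))))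
      atTop (𝓝 (Z ω)) := by
  obtain ⟨Z, hZ⟩ := exists_randomVector I (scEmbedL f ∘L T) g
    (summable_norm_sq_scEmbed f T g.orthonormal)
  refine ⟨Z, fun e => ?_⟩
  set g' : HilbertBasis ℕ ℝ L := HilbertBasis.ofRepr (U.symm.trans e.repr)
  have hg' : ∀ k, g' k = U (e k) := fun k => by
    simp only [g', ← HilbertBasis.repr_symm_single]
    rfl
  have h1 := ae_tendsto_randomVector hI (scEmbedL f ∘L T) g'
    (summable_norm_sq_scEmbed f T g'.orthonormal) hZ
  have h2 : ∀ᵐ ω ∂P, ∀ k, dualPullback P hX (e k) ω = (e k : Lp ℝ 2 (P.map X)) (X ω) :=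
    ae_all_iff.2 fun k => coeFn_dualPullback hX (e k)
  filter_upwards [h1, h2] with ω k1 k2
  simp only [hg', hU, k2] at k1
  exact k1

end RandomFunctional

lemma scEmbed_neg_smul {D : Opens (E d)} (f : HilbertBasis ℕ ℝ (HnegHalf D)) (c : ℝ)
    (u : HnegHalf D) : scEmbed f (-(c • u)) = -(c • scEmbed f u) :=
  (map_neg (scEmbedL f) (c • u)).trans (congrArg _ (map_smul (scEmbedL f) c u))

lemma tendsto_sum_smul_neg_smul {H : Type*} [NormedAddCommGroup H] [NormedSpace ℝ H] {c : ℕ → ℝ}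
    {a : ℕ → H} {z : H}
    (h : Tendsto (fun n => ∑ k ∈ Finset.range n, c k • a k) atTop (𝓝 z)) (b : ℝ) :
    Tendsto (fun n => ∑ k ∈ Finset.range n, c k • -(b • a k)) atTop (𝓝 (-(b • z))) := by
  refine (h.const_smul b).neg.congr fun n => ?_
  rw [Finset.smul_sum, ← Finset.sum_neg_distrib]
  exact Finset.sum_congr rfl fun k _ => by rw [smul_neg, smul_comm]

section Existence

variable {D : Opens (E d)} {Ω : Type*} [MeasurableSpace Ω] {P : Measure Ω}
  [IsProbabilityMeasure P] {W : BorelSubset D → Ω → ℝ} {lam β r : ℝ} {bc : BoundaryCondition}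
  {S : L2 D →L[ℝ] H1 D} {I : L2 D →ₗᵢ[ℝ] Lp ℝ 2 P} {X : Ω → Hneg D r}

lemma represents_of_inner {b : Hneg D r} {v : L2 D}
    (h : ∀ φ : 𝓓(D, ℝ), b (testEmbed D r φ) = ⟪v, testL2 φ⟫_ℝ) : Represents b v :=
  fun φ => (h φ).trans (integral_eq_inner_testL2 v φ).symm

/-- Each Cameron–Martin vector is `S (U h)` and satisfies the boundary condition. Dirichlet and
Neumann series vanish term by term; in the Robin case the series of normal derivatives is `-β` times
that of the traces. -/
lemma IsSolutionOperator.satisfiesBC (hS : IsSolutionOperator D lam β bc S)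
    (f : HilbertBasis ℕ ℝ (HnegHalf D))
    (hI : IsGaussianSubspace (LinearMap.range I.toLinearMap)) (hX : Measurable X)
    (g : HilbertBasis ℕ ℝ (L2 D)) (U : dualClosure (P.map X) ≃ₗᵢ[ℝ] L2 D)
    (hU : ∀ h, I (U h) = dualPullback P hX h)
    (hrep : ∀ h, Represents (covOp (P.map X) h) (S (U h)).fn) : SatisfiesBC P X f β bc := by
  have hne : Nonempty (HilbertBasis ℕ ℝ (dualClosure (P.map X))) :=
    ⟨HilbertBasis.ofRepr (U.trans g.repr)⟩
  have h0 : scEmbed f 0 = 0 := map_zero (scEmbedL f)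
  have hb := hS.boundary
  match bc, hb with
  | .dirichlet, hb =>
    refine ⟨0, ⟨hne, fun e => ⟨fun k => S (U (e k)), 0, fun k => ⟨hrep (e k), hb _⟩, ?_⟩⟩, by simp⟩
    simp [h0]
  | .neumann, hb =>
    refine ⟨0, ⟨hne, fun e => ⟨fun k => S (U (e k)), 0, fun k => ⟨hrep (e k), hb _⟩, ?_⟩⟩, by simp⟩
    simp [h0]
  | .robin, ⟨B, hB⟩ =>
    obtain ⟨Z, hZ⟩ := exists_tendsto_measurableExtension f hI hX U hU g B
    refine ⟨fun ω => -(β • Z ω), Z,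
      ⟨hne, fun e => ⟨fun k => S (U (e k)), fun k => -(β • B (U (e k))),
        fun k => ⟨hrep (e k), (hB _).2⟩, ?_⟩⟩,
      ⟨hne, fun e => ⟨fun k => S (U (e k)), fun k => B (U (e k)),
        fun k => ⟨hrep (e k), (hB _).1⟩, hZ e⟩⟩, by simp⟩
    filter_upwards [hZ e] with ω h
    simp only [scEmbed_neg_smul]
    exact tendsto_sum_smul_neg_smul h β

/-- By symmetry of `S`, the random functional with coordinates `I (A† y)` is indeed `φ ↦ ∫ (S φ)
dW`. -/
lemma IsSolutionOperator.adjoint_testEmbed (hS : IsSolutionOperator D lam β bc S) (hr : 0 ≤ r)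
    (φ : 𝓓(D, ℝ)) :
    ContinuousLinearMap.adjoint (l2ToHtilde D r ∘L H1.fnL D ∘L S) (testEmbed D r φ) =
      (S (testL2 φ)).fn := by
  refine ext_inner_left ℝ fun h => ?_
  rw [ContinuousLinearMap.adjoint_inner_right, ← hS.symm]
  exact inner_l2ToHtilde hr _ φ

/-- The solution: `X(φ) = ∫ (S φ) dW`. -/
lemma IsSolutionOperator.exists_isSolution (hS : IsSolutionOperator D lam β bc S)
    (hD : IsBoundedLipschitzDomain D) (hd : 0 < d) (hr0 : 0 ≤ r) (hr : (d : ℝ) / 2 - 1 < r)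
    (f : HilbertBasis ℕ ℝ (HnegHalf D)) (hI : IsWienerMap D P W I) :
    ∃ X : Ω → Hneg D r, IsSolution D r lam β f P W bc X := by
  obtain ⟨g⟩ := hD.exists_hilbertBasis hd
  set A := l2ToHtilde D r ∘L H1.fnL D ∘L S
  obtain ⟨M, hM⟩ := hD.exists_hilbertSchmidt_bound hd hS.symm hr0 hr
  obtain ⟨X, hX, hG, h0, h⟩ := exists_randomFunctional hI.isGaussianSubspace A g
    (summable_of_sum_le (fun k => sq_nonneg _) (hM g g.orthonormal))
  -- This identity is used twice: it gives the equation, and it shows that the range of the adjoint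
  -- contains the test functions, hence is dense in `L²(D)`.
  have htest : ∀ φ, ContinuousLinearMap.adjoint A
      (testEmbed D r (-testLaplacian φ + lam • φ)) = testL2 φ := fun φ => by
    rw [hS.adjoint_testEmbed hr0, hS.apply_test, testH1ₗ_fn]
  obtain ⟨U, hU, hcov⟩ := exists_dualClosure_equiv hX hG
    ((denseRange_testL2 D).mono (by rintro _ ⟨φ, rfl⟩; exact ⟨_, htest φ⟩)) h
  have hrep : ∀ h, Represents (covOp (P.map X) h) (S (U h)).fn := fun b =>
    represents_of_inner fun φ => ((hcov b _).trans
      (congrArg _ (hS.adjoint_testEmbed hr0 φ))).trans (hS.symm _ _).symm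
  refine ⟨X, hX, hG, h0, ⟨‖S‖, fun b => ⟨S (U b), hrep b, ?_, _, hS.isWeakLaplacian _⟩⟩,
    fun φ => ?_, hS.satisfiesBC f hI.isGaussianSubspace hX g U hU hrep⟩
  · exact (S.le_opNorm _).trans_eq (by rw [U.norm_map])
  · rw [hI.isWienerIntegral_iff φ (memLp_testFunction φ)]
    have := h (testEmbed D r (-testLaplacian φ + lam • φ))
    rwa [htest] at this

end Existence

/-! ### Uniqueness -/

/-- Pairing with `a j` gives centred Gaussian sums tending to zero, so their characteristic
functions at one tend to `1`. Their variances are at least `‖a j‖⁴` as soon as the term `j` is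
included, which bounds these values by `exp (-‖a j‖⁴ / 2)`. -/
lemma IsGaussianSubspace.eq_zero_of_tendsto_zero {Ω : Type*} [MeasurableSpace Ω] {P : Measure Ω}
    [IsProbabilityMeasure P] {H : Type*} [NormedAddCommGroup H] [InnerProductSpace ℝ H]
    {G : Submodule ℝ (Lp ℝ 2 P)} (hG : IsGaussianSubspace G) {ξ : ℕ → Lp ℝ 2 P}
    (hξ : Orthonormal ℝ ξ) (hξG : ∀ k, ξ k ∈ G) {a : ℕ → H}
    (h : ∀ᵐ ω ∂P, Tendsto (fun n => ∑ k ∈ Finset.range n, ξ k ω • a k) atTop (𝓝 0)) (j : ℕ) :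
    a j = 0 := by
  set c : ℕ → ℝ := fun k => ⟪a j, a k⟫_ℝ
  set η : ℕ → Lp ℝ 2 P := fun n => ∑ k ∈ Finset.range n, c k • ξ k
  have hη : ∀ᵐ ω ∂P, Tendsto (fun n => η n ω) atTop (𝓝 0) := by
    have h1 : ∀ᵐ ω ∂P, ∀ n, η n ω = ∑ k ∈ Finset.range n, (c k • ξ k : Lp ℝ 2 P) ω :=
      ae_all_iff.2 fun n => by
        filter_upwards [Lp.coeFn_finsetSum (Finset.range n) fun k => c k • ξ k] with ω h1
        rw [h1, Finset.sum_apply]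
    have h2 : ∀ᵐ ω ∂P, ∀ k, (c k • ξ k : Lp ℝ 2 P) ω = c k * ξ k ω :=
      ae_all_iff.2 fun k => Lp.coeFn_smul (c k) (ξ k)
    filter_upwards [h, h1, h2] with ω k0 k1 k2
    have hc : Continuous fun x : H => ⟪a j, x⟫_ℝ := by fun_prop
    have := (hc.tendsto 0).comp k0
    rw [inner_zero_right] at this
    refine this.congr fun n => ?_
    rw [k1, Function.comp_apply, inner_sum]
    refine Finset.sum_congr rfl fun k _ => ?_
    rw [k2, real_inner_smul_right, mul_comm]
  have hInt : Tendsto (fun n => ∫ ω, Complex.exp (Complex.I * η n ω) ∂P) atTop (𝓝 1) := by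
    have h1 : (1 : ℂ) = ∫ _, (1 : ℂ) ∂P := by simp
    rw [h1]
    refine tendsto_integral_of_dominated_convergence (fun _ => 1)
      (fun n => (integrable_exp_I_mul (Lp.aestronglyMeasurable (η n))).aestronglyMeasurable)
      (integrable_const _) (fun n => .of_forall fun ω => ?_) ?_
    · rw [mul_comm, Complex.norm_exp_ofReal_mul_I]
    · filter_upwards [hη] with ω hω
      have hc : Continuous fun y : ℝ => Complex.exp (Complex.I * y) := by fun_prop
      simpa [Function.comp_def] using (hc.tendsto 0).comp hω
  have hnorm : ∀ n, ‖η n‖ ^ 2 = ∑ k ∈ Finset.range n, c k ^ 2 := fun n => by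
    rw [← real_inner_self_eq_norm_sq, hξ.inner_sum]
    simp [sq]
  have hle : ∀ᶠ n in atTop, ‖∫ ω, Complex.exp (Complex.I * η n ω) ∂P‖ ≤
      Real.exp (-(c j ^ 2) / 2) := by
    filter_upwards [eventually_gt_atTop j] with n hn
    rw [hG (η n) (G.sum_mem fun k _ => G.smul_mem _ (hξG k)), Complex.norm_exp]
    refine Real.exp_le_exp.2 ?_
    have h1 : (-(‖η n‖ : ℂ) ^ 2 / 2).re = -‖η n‖ ^ 2 / 2 := by
      rw [show (-(‖η n‖ : ℂ) ^ 2 / 2) = ((-‖η n‖ ^ 2 / 2 : ℝ) : ℂ) by push_cast; rfl,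
        Complex.ofReal_re]
    have h2 : c j ^ 2 ≤ ∑ k ∈ Finset.range n, c k ^ 2 :=
      Finset.single_le_sum (f := fun k => c k ^ 2) (fun k _ => sq_nonneg _)
        (Finset.mem_range.2 hn)
    rw [h1, hnorm]
    linarith
  have h3 := le_of_tendsto hInt.norm hle
  rw [norm_one, Real.one_le_exp_iff] at h3
  have h4 : c j = 0 := by nlinarith [sq_nonneg (c j)]
  exact inner_self_eq_zero.1 h4

lemma tendsto_sum_smul_add_smul {H : Type*} [NormedAddCommGroup H] [NormedSpace ℝ H] {c : ℕ → ℝ}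
    {a b : ℕ → H} {y z : H}
    (hy : Tendsto (fun n => ∑ k ∈ Finset.range n, c k • a k) atTop (𝓝 y))
    (hz : Tendsto (fun n => ∑ k ∈ Finset.range n, c k • b k) atTop (𝓝 z)) (x : ℝ) :
    Tendsto (fun n => ∑ k ∈ Finset.range n, c k • (a k + x • b k)) atTop (𝓝 (y + x • z)) := by
  refine (hy.add (hz.const_smul x)).congr fun n => ?_
  rw [Finset.smul_sum, ← Finset.sum_add_distrib]
  exact Finset.sum_congr rfl fun k _ => by rw [smul_add, smul_comm]

section Uniqueness

variable {D : Opens (E d)} {Ω : Type*} [MeasurableSpace Ω] {P : Measure Ω}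
  [IsProbabilityMeasure P] {W : BorelSubset D → Ω → ℝ} {lam β r : ℝ} {bc : BoundaryCondition}
  {f : HilbertBasis ℕ ℝ (HnegHalf D)} {X : Ω → Hneg D r}

lemma Represents.unique {b : Hneg D r} {u v : H1 D} (hu : Represents b u.fn)
    (hv : Represents b v.fn) : u = v :=
  H1.ext (L2_ext_of_testFunction fun φ => (hu φ).symm.trans (hv φ))

lemma eq_zero_of_ae_tendsto_zero (hX : Measurable X) (hG : HasGaussianLaw X P)
    (h0 : ∀ l : StrongDual ℝ (Hneg D r), ∫ ω, l (X ω) ∂P = 0)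
    (e : HilbertBasis ℕ ℝ (dualClosure (P.map X))) {t : ℕ → HnegHalf D}
    (h : ∀ᵐ ω ∂P, Tendsto (fun n => ∑ k ∈ Finset.range n,
      ((e k : Lp ℝ 2 (P.map X)) (X ω)) • scEmbed f (t k)) atTop (𝓝 0)) (k : ℕ) : t k = 0 := by
  have h1 : ∀ᵐ ω ∂P, ∀ k, dualPullback P hX (e k) ω = (e k : Lp ℝ 2 (P.map X)) (X ω) :=
    ae_all_iff.2 fun k => coeFn_dualPullback hX (e k)
  refine scEmbed_eq_zero (f := f) ((isGaussianSubspace_range_evalₗ hG h0).topologicalClosure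
    |>.eq_zero_of_tendsto_zero (ξ := fun k => dualPullback P hX (e k))
      (e.orthonormal.comp_linearIsometry _) (fun k => pullback_mem_closure hX hG (e k))
      (a := fun k => scEmbed f (t k)) ?_ k)
  filter_upwards [h, h1] with ω k1 k2
  simp only [k2]
  exact k1

lemma tendsto_sum_smul_scEmbed_add {c : ℕ → ℝ} {s t : ℕ → HnegHalf D} {y z : Hsc}
    (hy : Tendsto (fun n => ∑ k ∈ Finset.range n, c k • scEmbed f (s k)) atTop (𝓝 y))
    (hz : Tendsto (fun n => ∑ k ∈ Finset.range n, c k • scEmbed f (t k)) atTop (𝓝 z)) (b : ℝ) :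
    Tendsto (fun n => ∑ k ∈ Finset.range n, c k • scEmbed f (s k + b • t k)) atTop
      (𝓝 (y + b • z)) := by
  have he : ∀ u v : HnegHalf D, scEmbed f (u + b • v) = scEmbed f u + b • scEmbed f v :=
    fun u v => ((scEmbedL f).map_add u (b • v)).trans (congrArg _ ((scEmbedL f).map_smul b v))
  simp only [he]
  exact tendsto_sum_smul_add_smul hy hz b

set_option maxHeartbeats 800000 in
lemma IsMeasurableExtension.exists_of_ae_eq_zero {B : H1 D → HnegHalf D → Prop} {Z : Ω → Hsc}
    (hX : Measurable X) (hG : HasGaussianLaw X P)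
    (h0 : ∀ l : StrongDual ℝ (Hneg D r), ∫ ω, l (X ω) ∂P = 0)
    (hZ : IsMeasurableExtension P X f B Z) (hZ0 : ∀ᵐ ω ∂P, Z ω = 0) :
    ∃ (e : HilbertBasis ℕ ℝ (dualClosure (P.map X))) (u : ℕ → H1 D), ∀ k,
      Represents (covOp (P.map X) (e k)) (u k).fn ∧ B (u k) 0 := by
  obtain ⟨e⟩ := hZ.1
  obtain ⟨u, t, hut, hlim⟩ := hZ.2 e
  have ht : ∀ k, t k = 0 := eq_zero_of_ae_tendsto_zero (f := f) hX hG h0 e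
    (by filter_upwards [hlim, hZ0] with ω h1 h2; exact h1.mono_right (congrArg 𝓝 h2).le)
  exact ⟨e, u, fun k => ⟨(hut k).1, ht k ▸ (hut k).2⟩⟩

set_option maxHeartbeats 800000 in
lemma IsMeasurableExtension.exists_of_ae_add_eq_zero {B B' : H1 D → HnegHalf D → Prop}
    {Y Z : Ω → Hsc} (hX : Measurable X) (hG : HasGaussianLaw X P)
    (h0 : ∀ l : StrongDual ℝ (Hneg D r), ∫ ω, l (X ω) ∂P = 0)
    (hY : IsMeasurableExtension P X f B Y) (hZ : IsMeasurableExtension P X f B' Z)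
    (hYZ : ∀ᵐ ω ∂P, Y ω + β • Z ω = 0) :
    ∃ (e : HilbertBasis ℕ ℝ (dualClosure (P.map X))) (u : ℕ → H1 D), ∀ k,
      Represents (covOp (P.map X) (e k)) (u k).fn ∧ ∃ t, B' (u k) t ∧ B (u k) (-(β • t)) := by
  obtain ⟨e⟩ := hY.1
  obtain ⟨u, s, hus, hlim⟩ := hY.2 e
  obtain ⟨v, t, hvt, hlim'⟩ := hZ.2 e
  have ht : ∀ k, s k + β • t k = 0 := eq_zero_of_ae_tendsto_zero (f := f) hX hG h0 e (by
    filter_upwards [hlim, hlim', hYZ] with ω h1 h2 h3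
    exact (tendsto_sum_smul_scEmbed_add h1 h2 β).mono_right (congrArg 𝓝 h3).le)
  refine ⟨e, u, fun k => ⟨(hus k).1, t k, ?_, ?_⟩⟩
  -- The two extensions provide separate representatives `u k` and `v k` of the same Cameron–Martin
  -- vector; they coincide.
  · rw [(hus k).1.unique (hvt k).1]
    exact (hvt k).2
  · rw [← eq_neg_of_add_eq_zero_left (ht k)]
    exact (hus k).2

/-- The basis vectors of the Cameron–Martin space satisfy the boundary condition. -/
lemma SatisfiesBC.exists_homogeneousBC (hX : Measurable X) (hG : HasGaussianLaw X P)
    (h0 : ∀ l : StrongDual ℝ (Hneg D r), ∫ ω, l (X ω) ∂P = 0) (h : SatisfiesBC P X f β bc) :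
    ∃ (e : HilbertBasis ℕ ℝ (dualClosure (P.map X))) (u : ℕ → H1 D), ∀ k,
      Represents (covOp (P.map X) (e k)) (u k).fn ∧ HomogeneousBC D β (u k) bc := by
  cases bc
  · obtain ⟨Z, hZ, hZ0⟩ := h
    exact hZ.exists_of_ae_eq_zero hX hG h0 hZ0
  · obtain ⟨Y, hY, hY0⟩ := h
    exact hY.exists_of_ae_eq_zero hX hG h0 hY0
  · obtain ⟨Y, Z, hY, hZ, hYZ⟩ := h
    exact hY.exists_of_ae_add_eq_zero hX hG h0 hZ hYZ

end Uniqueness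

/-! ### Identification of a Gaussian field from its covariances with a basis -/

lemma HilbertBasis.eq_of_forall_inner_map {L M : Type*} [NormedAddCommGroup L]
    [InnerProductSpace ℝ L] [NormedAddCommGroup M] [InnerProductSpace ℝ M]
    (e : HilbertBasis ℕ ℝ L) {J : L →ₗᵢ[ℝ] M} {ξ η : M}
    (hξ : ξ ∈ LinearMap.range J.toLinearMap) (hη : η ∈ LinearMap.range J.toLinearMap)
    (h : ∀ k, ⟪J (e k), ξ⟫_ℝ = ⟪J (e k), η⟫_ℝ) : ξ = η := by
  obtain ⟨a, rfl⟩ := hξ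
  obtain ⟨b, rfl⟩ := hη
  congr 1
  refine e.repr.injective (lp.ext (funext fun k => ?_))
  rw [e.repr_apply_apply, e.repr_apply_apply]
  exact (J.inner_map_map _ _).symm.trans ((h k).trans (J.inner_map_map _ _))

/-- Separability allows a countable dense set of evaluations, hence a single null set; continuity of
the functionals extends the equality. -/
lemma ae_eq_of_denseRange {Ω : Type*} [MeasurableSpace Ω] {P : Measure Ω} {H ι : Type*}
    [NormedAddCommGroup H] [InnerProductSpace ℝ H] [SecondCountableTopology H] {j : ι → H}
    (hj : DenseRange j) {X X' : Ω → StrongDual ℝ H} {Y : ι → Ω → ℝ}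
    (h : ∀ i, (fun ω => X ω (j i)) =ᵐ[P] Y i) (h' : ∀ i, (fun ω => X' ω (j i)) =ᵐ[P] Y i) :
    ∀ᵐ ω ∂P, X' ω = X ω := by
  obtain ⟨c, hcj, hc, hd⟩ := Dense.exists_countable_dense_subset (s := Set.range j) hj
  have hall : ∀ᵐ ω ∂P, ∀ y ∈ c, X' ω y = X ω y := (ae_ball_iff hc).2 fun y hy => by
    obtain ⟨i, rfl⟩ := hcj hy
    exact (h' i).trans (h i).symm
  filter_upwards [hall] with ω hω
  exact DFunLike.coe_injective (Continuous.ext_on hd (X' ω).continuous (X ω).continuous hω)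

/-- The equation puts every `I v` in the closed space of measurable functionals of `X`, by density
of `t`. There a variable is determined by its covariances with the basis `e`, and both sides have
the covariances `⟪g k, v⟫`. -/
lemma evalₗ_eq_of_denseRange {Ω : Type*} [MeasurableSpace Ω] {P : Measure Ω} {H L ι : Type*}
    [NormedAddCommGroup H] [InnerProductSpace ℝ H] [CompleteSpace H] [SecondCountableTopology H]
    [NormedAddCommGroup L] [InnerProductSpace ℝ L] {I : L →ₗᵢ[ℝ] Lp ℝ 2 P}
    {X : Ω → StrongDual ℝ H} (hX : Measurable X) (hG : HasGaussianLaw X P)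
    (e : HilbertBasis ℕ ℝ (dualClosure (P.map X))) {j : ι → H} {t : ι → L} (ht : DenseRange t)
    (hj : ∀ i, evalₗ hG (j i) = I (t i)) {g : ℕ → L}
    (hg : ∀ k i, ⟪dualPullback P hX (e k), evalₗ hG (j i)⟫_ℝ = ⟪g k, t i⟫_ℝ) {y : H} {v : L}
    (hy : ∀ k, ⟪dualPullback P hX (e k), evalₗ hG y⟫_ℝ = ⟪g k, v⟫_ℝ) : evalₗ hG y = I v := by
  have hmem : ∀ v, I v ∈ LinearMap.range (dualPullback P hX).toLinearMap := fun v => by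
    refine ht.induction_on
      (p := fun v => I v ∈ LinearMap.range (dualPullback P hX).toLinearMap) v
      ((isClosed_range_dualPullback hX).preimage I.continuous) fun i => ?_
    rw [← hj]
    exact evalₗ_mem_range hX hG (j i)
  have hinner : ∀ k v, ⟪dualPullback P hX (e k), I v⟫_ℝ = ⟪g k, v⟫_ℝ := fun k v => by
    refine ht.induction_on (p := fun v => ⟪dualPullback P hX (e k), I v⟫_ℝ = ⟪g k, v⟫_ℝ) v
      (isClosed_eq (continuous_const.inner I.continuous) (continuous_const.inner continuous_id))
      fun i => ?_
    rw [← hj, hg]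
  refine HilbertBasis.eq_of_forall_inner_map e (evalₗ_mem_range hX hG _) (hmem _) fun k => ?_
  rw [hy, hinner]

section Uniqueness

variable {D : Opens (E d)} {Ω : Type*} [MeasurableSpace Ω] {P : Measure Ω}
  {W : BorelSubset D → Ω → ℝ} {lam β r : ℝ} {bc : BoundaryCondition}
  {f : HilbertBasis ℕ ℝ (HnegHalf D)} {X : Ω → Hneg D r} {S : L2 D →L[ℝ] H1 D}
  {I : L2 D →ₗᵢ[ℝ] Lp ℝ 2 P}

lemma Represents.inner_dualPullback (hX : Measurable X) (hG : HasGaussianLaw X P)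
    {h : dualClosure (P.map X)} {v : L2 D} (hv : Represents (covOp (P.map X) h) v) (φ : 𝓓(D, ℝ)) :
    ⟪dualPullback P hX h, evalₗ hG (testEmbed D r φ)⟫_ℝ = ⟪v, testL2 φ⟫_ℝ :=
  (covOp_apply hX hG h _).symm.trans ((hv φ).trans (integral_eq_inner_testL2 v φ))

/-- Any solution is given by the solution operator: `X(ψ) = ∫ (S ψ) dW`. -/
lemma IsSolution.ae_eq_integral [IsProbabilityMeasure P] (h : IsSolution D r lam β f P W bc X)
    (hS : IsSolutionOperator D lam β bc S) (hI : IsWienerMap D P W I) (ψ : 𝓓(D, ℝ)) :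
    (fun ω => X ω (testEmbed D r ψ)) =ᵐ[P] I (S (testL2 ψ)).fn := by
  have hX := h.measurable
  have hG := h.gaussian
  obtain ⟨e, u, hu⟩ := h.boundary.exists_homogeneousBC hX hG h.mean_zero
  have heq : ∀ φ, evalₗ hG (testEmbed D r (-testLaplacian φ + lam • φ)) = I (testL2 φ) :=
    fun φ => Lp.ext ((coeFn_evalₗ hG _).trans
      ((hI.isWienerIntegral_iff φ (memLp_testFunction φ) _).1 (h.equation φ)))
  -- The Cameron–Martin condition gives `Δ (u k) ∈ L²(D)`; with the homogeneous boundary condition,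
  -- deterministic uniqueness applies.
  have hg : ∀ k, ∃ g, u k = S g := fun k => by
    obtain ⟨C, hC⟩ := h.cameronMartin
    obtain ⟨v, hv, -, w, hw⟩ := hC (e k)
    obtain rfl := (hu k).1.unique hv
    exact ⟨_, hS.unique _ w hw (hu k).2⟩
  choose g hg using hg
  have hinner : ∀ k φ, ⟪dualPullback P hX (e k), evalₗ hG (testEmbed D r φ)⟫_ℝ =
      ⟪g k, (S (testL2 φ)).fn⟫_ℝ := fun k φ =>
    ((hu k).1.inner_dualPullback hX hG φ).trans
      ((congrArg (fun w : H1 D => ⟪w.fn, testL2 φ⟫_ℝ) (hg k)).trans (hS.symm _ _))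
  have hfin : evalₗ hG (testEmbed D r ψ) = I (S (testL2 ψ)).fn := by
    -- The dense family consists of the test functions `φ`, reached from the evaluations at `-Δφ +
    -- lam φ`; on these `S` gives back `φ`, so the covariances agree.
    refine evalₗ_eq_of_denseRange hX hG e (denseRange_testL2 D) heq (fun k φ => ?_)
      (fun k => hinner k ψ)
    exact (hinner k _).trans ((congrArg (fun w : H1 D => ⟪g k, w.fn⟫_ℝ) (hS.apply_test φ)).trans
      (congrArg (fun w : L2 D => ⟪g k, w⟫_ℝ) (testH1ₗ_fn φ)))
  exact (coeFn_evalₗ hG (testEmbed D r ψ)).symm.trans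
    (.of_eq (congrArg (fun ξ : Lp ℝ 2 P => (ξ : Ω → ℝ)) hfin))

end Uniqueness

end WhiteNoiseBVP

end

/-! ### Existence and pathwise uniqueness -/

theorem mainTheorem1 {d : ℕ} (hd : 2 ≤ d)
    (D : TopologicalSpace.Opens (EuclideanSpace ℝ (Fin d)))
    (hD : WhiteNoiseBVP.IsBoundedLipschitzDomain D)
    (lam β r : ℝ) (hlam : 0 < lam) (hβ : 0 < β) (hr : (d : ℝ) / 2 - 1 < r)
    (f : HilbertBasis ℕ ℝ (WhiteNoiseBVP.HnegHalf D))
    {Ω : Type*} [MeasurableSpace Ω] (P : MeasureTheory.Measure Ω)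
    [MeasureTheory.IsProbabilityMeasure P]
    (W : WhiteNoiseBVP.BorelSubset D → Ω → ℝ) (hW : WhiteNoiseBVP.IsWhiteNoise D P W)
    (bc : WhiteNoiseBVP.BoundaryCondition) :
    ∃ X : Ω → WhiteNoiseBVP.Hneg D r,
      WhiteNoiseBVP.IsSolution D r lam β f P W bc X ∧
      ∀ X' : Ω → WhiteNoiseBVP.Hneg D r,
        WhiteNoiseBVP.IsSolution D r lam β f P W bc X' → ∀ᵐ ω ∂P, X' ω = X ω := by
  have hd0 : 0 < d := by omega
  -- For `d ≥ 2` the condition on `r` forces `r > 0`, so the `H^r` norm dominates the `L²` norm of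
  -- test functions and `L²(D)` embeds in `H^{-r}(D)`.
  have hr0 : 0 ≤ r := by
    have : (2 : ℝ) ≤ d := by exact_mod_cast hd
    linarith
  obtain ⟨S, hS⟩ := hD.exists_isSolutionOperator hd0 hlam hβ bc
  obtain ⟨I, hI⟩ := hW.exists_isWienerMap hD.bounded
  obtain ⟨X, hX⟩ := hS.exists_isSolution hD hd0 hr0 hr f hI
  -- Both solutions agree almost surely with `I (S φ)` at each test function `φ`, and test functions
  -- are dense.
  exact ⟨X, hX, fun X' hX' => WhiteNoiseBVP.ae_eq_of_denseRange
    (WhiteNoiseBVP.denseRange_testEmbed D r) (hX.ae_eq_integral hS hI)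
    (hX'.ae_eq_integral hS hI)⟩
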